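/- Let $k\ge 3$ be an integer. Then the following two statements are equivalent. 1. There are a real $\varepsilon>0$ (with $\varepsilon<k$) and an algorithm for $k$-Coloring with running time $O\big((k-\varepsilon)^{\mathrm{pw}}\, N^{O(1)}\big)$: the input is a simple graph $G$ with vertex set $\{0,\dots,n-1\}$, given by a list of its edges, together with a path decomposition of $G$ of width $\mathrm{pw}$, and the algorithm decides whether $G$ has a proper coloring with $k$ colors. 2. The Primal Pathwidth-Strong Exponential Time Hypothesis (PP-SETH) is false. Here the PP-SETH is the following hypothesis: for all $\varepsilon>0$ (with $\varepsilon<2$) there is no algorithm that takes as input a 3-SAT instance $\phi$ (a CNF formula in which each clause has at most three literals) and a path decomposition of width $\mathrm{pw}$ of its primal graph (the graph on the variables of $\phi$ in which two distinct variables are adjacent if they appear together in a clause), and decides whether $\phi$ is satisfiable in time $O\big((2-\varepsilon)^{\mathrm{pw}}\, N^{O(1)}\big)$. In both cases $N$ is the size of the input. The constants hidden in the $O$-notation may depend on $k$, on $\varepsilon$ and on the algorithm, but not on the input. Algorithms are deterministic programs of a random access machine, with running time measured under the logarithmic cost criterion. A path decomposition of a graph is a finite sequence of sets of vertices (bags)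 such that every vertex lies in some bag, the two ends of every edge lie in a common bag, and the bags that contain a given vertex are consecutive in the sequence; its width is the maximum size of a bag minus one (taken to be $0$ if all bags are empty). -/

import Mathlib

namespace PathwidthSETH

/-! ### Random access machines with logarithmic cost -/

/-- Programs of a random access machine, in structured form. The machine has registers
`R 0, R 1, …` and random access memories (arrays) `A 0, A 1, …`, all of whose cells hold natural
numbers. A given program mentions only finitely many registers and arrays. -/
inductive Program : Type
  /-- `R i := c` -/
  | const (i c : ℕ) : Program
  /-- `R i := R j + R l` -/
  | add (i j l : ℕ) : Program
  /-- `R i := max (R j - R l) 0` -/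
  | sub (i j l : ℕ) : Program
  /-- `R i := A a [R j]` (indirect addressing) -/
  | load (i a j : ℕ) : Program
  /-- `A a [R i] := R j` (indirect addressing) -/
  | store (a i j : ℕ) : Program
  /-- first `P`, then `Q` -/
  | seq (P Q : Program) : Program
  /-- if `R i ≠ 0` then `P` else `Q` -/
  | ite (i : ℕ) (P Q : Program) : Program
  /-- while `R i ≠ 0` do `P` -/
  | while (i : ℕ) (P : Program) : Program

/-- Configuration of the machine: the contents of the registers and of the arrays. -/
structure State : Type where
  reg : ℕ → ℕ
  arr : ℕ → ℕ → ℕ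

/-- Overwrite register `i` by the value `v`. -/
def State.setReg (s : State) (i v : ℕ) : State :=
  ⟨Function.update s.reg i v, s.arr⟩

/-- Overwrite the cell with address `p` of array `a` by the value `v`. -/
def State.setArr (s : State) (a p v : ℕ) : State :=
  ⟨s.reg, Function.update s.arr a (Function.update (s.arr a) p v)⟩

/-- `Exec P s s' t`: started in the configuration `s`, the program `P` halts in the configuration
`s'`, after running for time `t`. Time is counted under the logarithmic cost criterion: every
instruction and every test costs one plus the bit lengths of the numbers (addresses included)
that it handles. -/
inductive Exec : Program → State → State → ℕ → Prop
  | const (s : State) (i c : ℕ) :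
      Exec (.const i c) s (s.setReg i c) (1 + c.size)
  | add (s : State) (i j l : ℕ) :
      Exec (.add i j l) s (s.setReg i (s.reg j + s.reg l))
        (1 + (s.reg j).size + (s.reg l).size)
  | sub (s : State) (i j l : ℕ) :
      Exec (.sub i j l) s (s.setReg i (s.reg j - s.reg l))
        (1 + (s.reg j).size + (s.reg l).size)
  | load (s : State) (i a j : ℕ) :
      Exec (.load i a j) s (s.setReg i (s.arr a (s.reg j)))
        (1 + (s.reg j).size + (s.arr a (s.reg j)).size)
  | store (s : State) (a i j : ℕ) :
      Exec (.store a i j) s (s.setArr a (s.reg i) (s.reg j))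
        (1 + (s.reg i).size + (s.reg j).size)
  | seq {P Q : Program} {s s₁ s₂ : State} {t₁ t₂ : ℕ} :
      Exec P s s₁ t₁ → Exec Q s₁ s₂ t₂ → Exec (.seq P Q) s s₂ (t₁ + t₂)
  | ite_true {i : ℕ} {P Q : Program} {s s₁ : State} {t : ℕ} :
      s.reg i ≠ 0 → Exec P s s₁ t → Exec (.ite i P Q) s s₁ (1 + (s.reg i).size + t)
  | ite_false {i : ℕ} {P Q : Program} {s s₁ : State} {t : ℕ} :
      s.reg i = 0 → Exec Q s s₁ t → Exec (.ite i P Q) s s₁ (1 + (s.reg i).size + t)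
  | while_done {i : ℕ} {P : Program} {s : State} :
      s.reg i = 0 → Exec (.while i P) s s (1 + (s.reg i).size)
  | while_step {i : ℕ} {P : Program} {s s₁ s₂ : State} {t₁ t₂ : ℕ} :
      s.reg i ≠ 0 → Exec P s s₁ t₁ → Exec (.while i P) s₁ s₂ t₂ →
        Exec (.while i P) s s₂ (1 + (s.reg i).size + t₁ + t₂)

/-- Initial configuration on the input word `w`: the word is stored in array `0`, its length is in
register `0`, and everything else is `0`. -/
def initial (w : List ℕ) : State where
  reg := fun i => if i = 0 then w.length else 0
  arr := fun a p => if a = 0 then w.getD p 0 else 0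

/-- The decision problem `yes` on the inputs `ι`, written as words by `enc` and with parameter `p`,
is solved by an algorithm in time `O(β ^ p · N ^ O(1))`, where `N` is the size of the input. The
algorithm answers yes by halting with a non-zero number in register `0`. -/
def SolvableInTime {ι : Type} (enc : ι → List ℕ) (yes : ι → Prop) (p : ι → ℕ) (β : ℝ) :
    Prop :=
  ∃ (P : Program) (C c : ℕ), ∀ x : ι, ∃ (s : State) (t : ℕ),
    Exec P (initial (enc x)) s t ∧ (s.reg 0 ≠ 0 ↔ yes x) ∧
      (t : ℝ) ≤ C * β ^ p x * ((enc x).length : ℝ) ^ c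

/-! ### Path decompositions -/

/-- The sequence of bags `B` is a path decomposition of the graph `G`. -/
structure IsPathDecomposition {V : Type} (G : SimpleGraph V) (B : List (Finset V)) : Prop where
  vertex_mem : ∀ v : V, ∃ b ∈ B, v ∈ b
  edge_mem : ∀ v w : V, G.Adj v w → ∃ b ∈ B, v ∈ b ∧ w ∈ b
  interval : ∀ (v : V) (i j l : ℕ), i ≤ j → j ≤ l →
    v ∈ B.getD i ∅ → v ∈ B.getD l ∅ → v ∈ B.getD j ∅

/-- The width: the maximum size of a bag minus one (and `0` if there are no non-empty bags). -/
def width {V : Type} (B : List (Finset V)) : ℕ :=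
  (B.map Finset.card).foldr max 0 - 1

/-- The sequence of bags that is given by a list of lists of vertices. -/
def bagSets {n : ℕ} (B : List (List (Fin n))) : List (Finset (Fin n)) :=
  B.map List.toFinset

/-! ### Words -/

/-- A list is written as its length, followed by its entries. -/
def encodeList {α : Type} (f : α → List ℕ) (l : List α) : List ℕ :=
  l.length :: l.flatMap f

/-- Bags are written as lists of lists of vertices. -/
def encodeBags {n : ℕ} (B : List (List (Fin n))) : List ℕ :=
  encodeList (encodeList fun v : Fin n => [(v : ℕ)]) B

/-! ### Coloring -/

/-- The graph on the vertices `0, …, n - 1` with the listed edges. -/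
def edgeGraph {n : ℕ} (E : List (Fin n × Fin n)) : SimpleGraph (Fin n) :=
  SimpleGraph.fromRel fun v w => (v, w) ∈ E

/-- Input of `k`-Coloring: a graph, given as a list of edges, and a path decomposition of it. -/
structure ColoringInstance : Type where
  n : ℕ
  edges : List (Fin n × Fin n)
  bags : List (List (Fin n))
  loopless : ∀ e ∈ edges, e.1 ≠ e.2
  decomposition : IsPathDecomposition (edgeGraph edges) (bagSets bags)

/-- The input of `k`-Coloring as a word. -/
def ColoringInstance.encode (I : ColoringInstance) : List ℕ :=
  I.n :: (encodeList (fun e : Fin I.n × Fin I.n => [(e.1 : ℕ), (e.2 : ℕ)]) I.edges ++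
    encodeBags I.bags)

/-- `k`-Coloring is solvable in time `O(β ^ pw · N ^ O(1))`, where `pw` is the width of the path
decomposition in the input, and `N` is the size of the input. -/
def ColoringSolvableInTime (k : ℕ) (β : ℝ) : Prop :=
  SolvableInTime ColoringInstance.encode (fun I => (edgeGraph I.edges).Colorable k)
    (fun I => width (bagSets I.bags)) β

/-! ### Satisfiability -/

/-- A literal over `n` variables: `(x, true)` stands for `x` and `(x, false)` for `¬ x`. -/
abbrev Literal (n : ℕ) : Type := Fin n × Bool

/-- A formula in conjunctive normal form over `n` variables, as a list of clauses. -/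
abbrev CNF (n : ℕ) : Type := List (List (Literal n))

/-- The formula has a satisfying assignment. -/
def CNF.Satisfiable {n : ℕ} (φ : CNF n) : Prop :=
  ∃ σ : Fin n → Bool, ∀ C ∈ φ, ∃ l ∈ C, σ l.1 = l.2

/-- The primal graph: two distinct variables are adjacent if they appear together in a clause. -/
def CNF.primalGraph {n : ℕ} (φ : CNF n) : SimpleGraph (Fin n) :=
  SimpleGraph.fromRel fun x y => ∃ C ∈ φ, (∃ b, (x, b) ∈ C) ∧ ∃ b, (y, b) ∈ C

/-- Input of 3-SAT: a formula with at most three literals in each clause, and a path decomposition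
of its primal graph. -/
structure ThreeSATInstance : Type where
  n : ℕ
  formula : CNF n
  bags : List (List (Fin n))
  arity : ∀ C ∈ formula, C.length ≤ 3
  decomposition : IsPathDecomposition formula.primalGraph (bagSets bags)

/-- The input of 3-SAT as a word. -/
def ThreeSATInstance.encode (I : ThreeSATInstance) : List ℕ :=
  I.n :: (encodeList (encodeList fun l : Literal I.n => [(l.1 : ℕ), l.2.toNat]) I.formula ++
    encodeBags I.bags)

/-- 3-SAT is solvable in time `O(β ^ pw · N ^ O(1))`, where `pw` is the width of the path
decomposition of the primal graph in the input, and `N` is the size of the input. -/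
def ThreeSATSolvableInTime (β : ℝ) : Prop :=
  SolvableInTime ThreeSATInstance.encode (fun I => I.formula.Satisfiable)
    (fun I => width (bagSets I.bags)) β

/-- The Primal Pathwidth-Strong Exponential Time Hypothesis: for no `ε > 0` is 3-SAT solvable in
time `(2 - ε) ^ pw · N ^ O(1)`. -/
def PPSETH : Prop :=
  ∀ ε : ℝ, 0 < ε → ε < 2 → ¬ ThreeSATSolvableInTime (2 - ε)

end PathwidthSETH

/-! Both problems are constraint satisfaction problems along a path decomposition: values below `a`
(`a = k` for coloring, `a = 2` for satisfiability), and constraints that each forbid one pattern on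
at most three variables. The core is a reduction, for arbitrary `a`, from such a problem of width
`w` to `b`-Coloring (`b ≥ 3`) or to 3-SAT (`b = 2`) of width about `w * q / t`, where `a ^ t ≤ b ^
q`. Since `q / t` can approach `log a / log b`, any base `β < b` for the target gives a base `β' <
a` for the source (`exists_params`, `pow_width_le`). The two directions of the theorem are the cases
`(a, b) = (2, k)` and `(k, 2)`.

To save width, `t` variables with `a` values are packed into `q` variables with `b` values. The
packing has to survive the passage from bag to bag. Each bag therefore gets its own copies of its
variables, sorted by first appearance, and the copies in consecutive bags are tied by equality
constraints. In this order the rank of a variable never increases from one bag to the next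
(`Src.rank_succ_le`), so two tied copies lie in a window of one block more than a bag occupies
(`Src.win_le`). Sliding this window along the blocks gives the new path decomposition; apart from
the window, a bag holds only a bounded number of vertices.

Over the new alphabet a constraint concerns three blocks. It is replaced by one constraint for each
of the `(b ^ q) ^ 3` possible contents, saying that a violating content does not occur
(`Src.sat_iff_digitSat`). Such a constraint forbids one pattern on `3 * q` digits and is realised by
a chain: a signal `0` enters at one end, passes each step whose digit matches the pattern, and must
not leave at the other end. For 3-SAT each step is a clause; for coloring it is a gadget of bounded
size with color lists enforced by a palette clique.

The construction must run on the random access machine. Closure properties of `PolyT`, `PolyP` and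
`Emit` replace explicit programming, and `Emit.transfer` composes the resulting program with a
solver for the target problem. -/

namespace PathwidthSETH

/-! ### Polynomial bounds -/

/-- The function `T` is bounded by a polynomial. -/
def PolyBd (T : ℕ → ℕ) : Prop := ∃ c, ∀ M, T M ≤ (M + 2) ^ c

/-- The base `M + 2` is at least `2` for every `M`, so a power of it absorbs any constant. -/
theorem PolyBd.const (n : ℕ) : PolyBd fun _ => n :=
  ⟨n, fun M => (Nat.lt_two_pow_self.le).trans (Nat.pow_le_pow_left (by omega) n)⟩

theorem PolyBd.id : PolyBd fun M => M := ⟨1, fun M => by simp⟩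

theorem PolyBd.mul {T U : ℕ → ℕ} (hT : PolyBd T) (hU : PolyBd U) :
    PolyBd fun M => T M * U M := by
  obtain ⟨c, hc⟩ := hT
  obtain ⟨d, hd⟩ := hU
  exact ⟨c + d, fun M => by rw [pow_add]; exact Nat.mul_le_mul (hc M) (hd M)⟩

theorem PolyBd.add {T U : ℕ → ℕ} (hT : PolyBd T) (hU : PolyBd U) :
    PolyBd fun M => T M + U M := by
  obtain ⟨c, hc⟩ := hT
  obtain ⟨d, hd⟩ := hU
  refine ⟨c + d + 1, fun M => ?_⟩
  have h1 : (M + 2) ^ c ≤ (M + 2) ^ (c + d) := Nat.pow_le_pow_right (by omega) (by omega)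
  have h2 : (M + 2) ^ d ≤ (M + 2) ^ (c + d) := Nat.pow_le_pow_right (by omega) (by omega)
  have := hc M
  have := hd M
  rw [pow_succ]
  nlinarith [Nat.zero_le ((M + 2) ^ (c + d) * M)]

theorem PolyBd.comp {T U : ℕ → ℕ} (hT : PolyBd T) (hU : PolyBd U) :
    PolyBd fun M => T (U M) := by
  obtain ⟨c, hc⟩ := hT
  obtain ⟨d, hd⟩ := hU.add (.const 2)
  refine ⟨d * c, fun M => (hc _).trans ?_⟩
  rw [pow_mul]
  exact Nat.pow_le_pow_left (hd M) c

/-- Bit lengths are bounded crudely by the numbers themselves. Nothing is lost, because all numbers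
handled by the reduction are polynomial in the length of the input. -/
theorem size_le_self (n : ℕ) : n.size ≤ n := Nat.size_le.2 Nat.lt_two_pow_self

/-- The primed rules take the operands as explicit values, so that costs and final configurations of
composed programs stay free of nested updates. -/
theorem Exec.add' {s : State} {i j l a b : ℕ} (ha : s.reg j = a) (hb : s.reg l = b) :
    Exec (.add i j l) s (s.setReg i (a + b)) (1 + a.size + b.size) := by
  subst ha hb
  exact .add s i j l

theorem Exec.sub' {s : State} {i j l a b : ℕ} (ha : s.reg j = a) (hb : s.reg l = b) :
    Exec (.sub i j l) s (s.setReg i (a - b)) (1 + a.size + b.size) := by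
  subst ha hb
  exact .sub s i j l

theorem Exec.load' {s : State} {i a j p v : ℕ} (hp : s.reg j = p) (hv : s.arr a p = v) :
    Exec (.load i a j) s (s.setReg i v) (1 + p.size + v.size) := by
  subst hp hv
  exact .load s i a j

theorem Exec.store' {s : State} {a i j p v : ℕ} (hp : s.reg i = p) (hv : s.reg j = v) :
    Exec (.store a i j) s (s.setArr a p v) (1 + p.size + v.size) := by
  subst hp hv
  exact .store s a i j

/-! ### Frame properties and renaming -/

/-- A bound for the registers that occur in a program. -/
def Program.maxReg : Program → ℕ
  | .const i _ => i + 1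
  | .add i j l => i + j + l + 1
  | .sub i j l => i + j + l + 1
  | .load i _ j => i + j + 1
  | .store _ i j => i + j + 1
  | .seq P Q => P.maxReg + Q.maxReg
  | .ite i P Q => i + 1 + P.maxReg + Q.maxReg
  | .while i P => i + 1 + P.maxReg

/-- A bound for the arrays that occur in a program. -/
def Program.maxArr : Program → ℕ
  | .const _ _ => 0
  | .add _ _ _ => 0
  | .sub _ _ _ => 0
  | .load _ a _ => a + 1
  | .store a _ _ => a + 1
  | .seq P Q => P.maxArr + Q.maxArr
  | .ite _ P Q => P.maxArr + Q.maxArr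
  | .while _ P => P.maxArr

/-- Cells outside the footprint of a program keep their initial `0`; in `Emit.transfer` they serve
as blank memory for the next program. -/
theorem Exec.reg_frame {P : Program} {s s' : State} {t : ℕ} (h : Exec P s s' t) :
    ∀ i, P.maxReg ≤ i → s'.reg i = s.reg i := by
  induction h with
  | seq _ _ h₁ h₂ =>
    intro i hi
    simp only [Program.maxReg] at hi
    rw [h₂ i (by omega), h₁ i (by omega)]
  | ite_true _ _ h => intro i hi; simp only [Program.maxReg] at hi; exact h i (by omega)
  | ite_false _ _ h => intro i hi; simp only [Program.maxReg] at hi; exact h i (by omega)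
  | while_done => intros; rfl
  | while_step _ _ _ h₁ h₂ =>
    intro i hi
    have := hi
    simp only [Program.maxReg] at hi
    rw [h₂ i this, h₁ i (by omega)]
  | store => intros; rfl
  | _ =>
    intro i hi
    simp only [Program.maxReg] at hi
    simp only [State.setReg]
    rw [Function.update_of_ne (by omega)]

theorem Exec.arr_frame {P : Program} {s s' : State} {t : ℕ} (h : Exec P s s' t) :
    ∀ a, P.maxArr ≤ a → s'.arr a = s.arr a := by
  induction h with
  | seq _ _ h₁ h₂ =>
    intro i hi
    simp only [Program.maxArr] at hi
    rw [h₂ i (by omega), h₁ i (by omega)]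
  | ite_true _ _ h => intro i hi; simp only [Program.maxArr] at hi; exact h i (by omega)
  | ite_false _ _ h => intro i hi; simp only [Program.maxArr] at hi; exact h i (by omega)
  | while_step _ _ _ h₁ h₂ =>
    intro i hi
    have := hi
    simp only [Program.maxArr] at hi
    rw [h₂ i this, h₁ i (by omega)]
  | store =>
    intro i hi
    simp only [Program.maxArr] at hi
    simp only [State.setArr]
    rw [Function.update_of_ne (by omega)]
  | _ => intros; rfl

/-- Rename the registers by `ρ` and the arrays by `τ`. -/
def Program.rename (ρ τ : ℕ → ℕ) : Program → Program
  | .const i c => .const (ρ i) c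
  | .add i j l => .add (ρ i) (ρ j) (ρ l)
  | .sub i j l => .sub (ρ i) (ρ j) (ρ l)
  | .load i a j => .load (ρ i) (τ a) (ρ j)
  | .store a i j => .store (τ a) (ρ i) (ρ j)
  | .seq P Q => .seq (P.rename ρ τ) (Q.rename ρ τ)
  | .ite i P Q => .ite (ρ i) (P.rename ρ τ) (Q.rename ρ τ)
  | .while i P => .while (ρ i) (P.rename ρ τ)

/-- The part of the configuration that a renamed program sees. -/
def State.pull (ρ τ : ℕ → ℕ) (s : State) : State := ⟨fun i => s.reg (ρ i), fun a => s.arr (τ a)⟩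

theorem State.pull_setReg {ρ τ : ℕ → ℕ} (hρ : ρ.Injective) (s : State) (i v : ℕ) :
    (s.setReg (ρ i) v).pull ρ τ = (s.pull ρ τ).setReg i v := by
  simp only [State.pull, State.setReg, State.mk.injEq, and_true]
  exact Function.update_comp_eq_of_injective _ hρ _ _

theorem State.pull_setArr {ρ τ : ℕ → ℕ} (hτ : τ.Injective) (s : State) (a p v : ℕ) :
    (s.setArr (τ a) p v).pull ρ τ = (s.pull ρ τ).setArr a p v := by
  simp only [State.pull, State.setArr, State.mk.injEq, true_and]
  exact Function.update_comp_eq_of_injective _ hτ _ _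

/-- Injectivity keeps distinct cells distinct, so the renamed program mirrors the run step by step.
The cost is equal because the names of registers and arrays are not charged, only contents and
addresses. -/
theorem Exec.rename {ρ τ : ℕ → ℕ} (hρ : ρ.Injective) (hτ : τ.Injective) {P : Program}
    {s₁ s₁' : State} {t : ℕ} (h : Exec P s₁ s₁' t) :
    ∀ s : State, s.pull ρ τ = s₁ →
      ∃ s' : State, Exec (P.rename ρ τ) s s' t ∧ s'.pull ρ τ = s₁' := by
  induction h with
  | const _ i c =>
    rintro s rfl
    exact ⟨_, .const s (ρ i) c, State.pull_setReg hρ _ _ _⟩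
  | add _ i j l =>
    rintro s rfl
    exact ⟨_, .add s (ρ i) (ρ j) (ρ l), State.pull_setReg hρ _ _ _⟩
  | sub _ i j l =>
    rintro s rfl
    exact ⟨_, .sub s (ρ i) (ρ j) (ρ l), State.pull_setReg hρ _ _ _⟩
  | load _ i a j =>
    rintro s rfl
    exact ⟨_, .load s (ρ i) (τ a) (ρ j), State.pull_setReg hρ _ _ _⟩
  | store _ a i j =>
    rintro s rfl
    exact ⟨_, .store s (τ a) (ρ i) (ρ j), State.pull_setArr hτ _ _ _ _⟩
  | seq _ _ ih₁ ih₂ =>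
    intro s hs
    obtain ⟨s', e₁, h₁⟩ := ih₁ s hs
    obtain ⟨s'', e₂, h₂⟩ := ih₂ s' h₁
    exact ⟨s'', .seq e₁ e₂, h₂⟩
  | ite_true hi _ ih =>
    rintro s rfl
    obtain ⟨s', e, h⟩ := ih s rfl
    exact ⟨s', .ite_true hi e, h⟩
  | ite_false hi _ ih =>
    rintro s rfl
    obtain ⟨s', e, h⟩ := ih s rfl
    exact ⟨s', .ite_false hi e, h⟩
  | while_done hi =>
    rintro s rfl
    exact ⟨s, .while_done hi, rfl⟩
  | while_step hi _ _ ih₁ ih₂ =>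
    rintro s rfl
    obtain ⟨s', e₁, h₁⟩ := ih₁ s rfl
    obtain ⟨s'', e₂, h₂⟩ := ih₂ s' h₁
    exact ⟨s'', .while_step hi e₁ e₂, h₂⟩

/-! ### Functions computed in polynomial time -/

/-- A context consists of a word, kept in array `0`, and finitely many numbers, kept in
registers. -/
class Ctx (α : Type) where
  word : α → List ℕ
  vals : α → List ℕ

instance : Ctx (List ℕ) := ⟨fun w => w, fun _ => []⟩

/-- Pairing adds one register to the context; loop indices and accumulators enter in this way. -/
instance {α : Type} [Ctx α] : Ctx (α × ℕ) := ⟨fun x => Ctx.word x.1, fun x => x.2 :: Ctx.vals x.1⟩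

/-- All numbers in the context are at most `M`. -/
def CtxBd {α : Type} [Ctx α] (x : α) (M : ℕ) : Prop :=
  (∀ v ∈ Ctx.word x, v ≤ M) ∧ ∀ v ∈ Ctx.vals x, v ≤ M

/-- The configuration `s` holds the context `x`, with the numbers in the registers `ℓ`. -/
def Rep {α : Type} [Ctx α] (ℓ : List ℕ) (x : α) (s : State) : Prop :=
  ℓ.map s.reg = Ctx.vals x ∧ ∀ p, s.arr 0 p = (Ctx.word x).getD p 0

/-- A numerical function of the context that is computed in polynomial time, by programs that
keep all arrays and all registers below a given one, which receives the result. -/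
def PolyT {α : Type} [Ctx α] (f : α → ℕ) : Prop :=
  ∃ T, PolyBd T ∧ (∀ x M, CtxBd x M → f x ≤ T M) ∧ ∀ (ℓ : List ℕ) (d : ℕ), (∀ r ∈ ℓ, r < d) →
    ∃ P : Program, ∀ x s M, CtxBd x M → Rep ℓ x s → ∃ s' t, Exec P s s' t ∧ s'.arr = s.arr ∧
      (∀ i < d, s'.reg i = s.reg i) ∧ s'.reg d = f x ∧ t ≤ T M

section
variable {α : Type} [Ctx α]

theorem CtxBd.mono {x : α} {M M' : ℕ} (h : CtxBd x M) (hM : M ≤ M') : CtxBd x M' :=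
  ⟨fun v hv => (h.1 v hv).trans hM, fun v hv => (h.2 v hv).trans hM⟩

theorem CtxBd.pair {x : α} {n M : ℕ} (h : CtxBd x M) (hn : n ≤ M) : CtxBd (x, n) M :=
  ⟨h.1, by
    intro v hv
    rcases List.mem_cons.1 hv with rfl | hv
    · exact hn
    · exact h.2 v hv⟩

theorem CtxBd.fst {x : α × ℕ} {M : ℕ} (h : CtxBd x M) : CtxBd x.1 M :=
  ⟨h.1, fun v hv => h.2 v (List.mem_cons_of_mem _ hv)⟩

theorem CtxBd.snd {x : α × ℕ} {M : ℕ} (h : CtxBd x M) : x.2 ≤ M :=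
  h.2 _ List.mem_cons_self

theorem CtxBd.getD {x : α} {M : ℕ} (h : CtxBd x M) (p : ℕ) : (Ctx.word x).getD p 0 ≤ M := by
  by_cases hp : p < (Ctx.word x).length
  · rw [List.getD_eq_getElem _ _ hp]
    exact h.1 _ (List.getElem_mem hp)
  · rw [List.getD_eq_default _ _ (by omega)]
    exact Nat.zero_le _

theorem Rep.frame {ℓ : List ℕ} {x : α} {s s' : State} {d : ℕ} (h : Rep ℓ x s)
    (hℓ : ∀ r ∈ ℓ, r < d) (ha : s'.arr 0 = s.arr 0) (hr : ∀ i < d, s'.reg i = s.reg i) :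
    Rep ℓ x s' := by
  refine ⟨?_, fun p => by rw [ha]; exact h.2 p⟩
  rw [← h.1]
  exact List.map_congr_left fun r hr' => hr r (hℓ r hr')

theorem Rep.cons {ℓ : List ℕ} {x : α} {s : State} {r n : ℕ} (h : Rep ℓ x s)
    (hn : s.reg r = n) : Rep (r :: ℓ) (x, n) s :=
  ⟨by rw [List.map_cons, hn, h.1]; rfl, h.2⟩

theorem PolyT.const (n : ℕ) : PolyT fun _ : α => n := by
  refine ⟨fun _ => 1 + n.size + n, .const _, fun _ _ _ => Nat.le_add_left _ _, fun ℓ d _ =>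
    ⟨.const d n, fun x s M _ _ => ⟨_, _, .const s d n, rfl, ?_, ?_, Nat.le_add_right _ _⟩⟩⟩
  · intro i hi
    simp only [State.setReg]
    rw [Function.update_of_ne (by omega)]
  · simp [State.setReg]

theorem PolyT.congr {f g : α → ℕ} (hf : PolyT f) (h : ∀ x, g x = f x) : PolyT g := by
  rwa [show g = f from funext h]

theorem PolyT.fst {f : α → ℕ} (hf : PolyT f) : PolyT fun x : α × ℕ => f x.1 := by
  obtain ⟨T, hT, hb, h⟩ := hf
  refine ⟨T, hT, fun x M hx => hb _ _ hx.fst, fun ℓ d hℓ => ?_⟩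
  obtain ⟨P, hP⟩ := h ℓ.tail d fun r hr => hℓ r (List.mem_of_mem_tail hr)
  refine ⟨P, fun x s M hx hs => hP x.1 s M hx.fst ⟨?_, hs.2⟩⟩
  rw [List.map_tail, hs.1]
  rfl

theorem PolyT.snd : PolyT fun x : α × ℕ => x.2 := by
  refine ⟨fun M => 1 + 0 + (1 + M + 0) + M, ?_, fun x M hx => hx.snd.trans (Nat.le_add_left _ _),
    fun ℓ d hℓ => ?_⟩
  · exact ((PolyBd.const _).add (((PolyBd.const _).add .id).add (.const 0))).add .id
  · cases ℓ with
    -- The context contains at least one number, so an empty list of registers represents nothing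
    -- and any program will do.
    | nil => exact ⟨.const 0 0, fun x s M _ hs => absurd hs.1 (by simp [Ctx.vals])⟩
    | cons r ℓ =>
      have hr : r < d := hℓ r List.mem_cons_self
      refine ⟨.seq (.const d 0) (.add d r d), fun x s M hx hs =>
        ⟨_, _, .seq (.const s d 0) (.add _ d r d), rfl, ?_, ?_, ?_⟩⟩
      · intro i hi
        simp only [State.setReg]
        rw [Function.update_of_ne (by omega), Function.update_of_ne (by omega)]
      · have := hs.1
        simp only [List.map_cons, Ctx.vals, List.cons.injEq] at this
        simp [State.setReg, Function.update_of_ne hr.ne, this.1]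
      · have := hs.1
        simp only [List.map_cons, Ctx.vals, List.cons.injEq] at this
        have h2 := hx.snd
        have h3 := size_le_self x.2
        simp only [State.setReg, Function.update_of_ne hr.ne, Function.update_self, this.1,
          Nat.size_zero]
        omega

theorem PolyT.read {f : α → ℕ} (hf : PolyT f) : PolyT fun x => (Ctx.word x).getD (f x) 0 := by
  obtain ⟨T, hT, hb, h⟩ := hf
  refine ⟨fun M => T M + (1 + T M + M), hT.add (((PolyBd.const 1).add hT).add .id), fun x M hx =>
    (hx.getD _).trans (Nat.le_add_left _ _ |>.trans (Nat.le_add_left _ _)), fun ℓ d hℓ => ?_⟩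
  obtain ⟨P, hP⟩ := h ℓ d hℓ
  refine ⟨.seq P (.load d 0 d), fun x s M hx hs => ?_⟩
  obtain ⟨s', t, e, ha, hr, hd, ht⟩ := hP x s M hx hs
  refine ⟨_, _, .seq e (.load s' d 0 d), ha, ?_, ?_, ?_⟩
  · intro i hi
    simp only [State.setReg]
    rw [Function.update_of_ne (by omega), hr i hi]
  · simp [State.setReg, ha, hd, hs.2]
  · have h1 := size_le_self (f x)
    have h2 := size_le_self (s'.arr 0 (s'.reg d))
    have h3 := hb x M hx
    have h4 : s'.arr 0 (s'.reg d) ≤ M := by rw [ha, hs.2]; exact hx.getD _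
    rw [hd] at h2 h4 ⊢
    beta_reduce
    omega

theorem PolyT.add {f g : α → ℕ} (hf : PolyT f) (hg : PolyT g) : PolyT fun x => f x + g x := by
  obtain ⟨T, hT, hTb, hf⟩ := hf
  obtain ⟨U, hU, hUb, hg⟩ := hg
  refine ⟨fun M => T M + (U M + (1 + T M + U M)),
    hT.add (hU.add (((PolyBd.const 1).add hT).add hU)), fun x M hx => ?_, fun ℓ d hℓ => ?_⟩
  · have := hTb x M hx
    have := hUb x M hx
    beta_reduce
    omega
  obtain ⟨P, hP⟩ := hf ℓ d hℓ
  obtain ⟨Q, hQ⟩ := hg ℓ (d + 1) fun r hr => (hℓ r hr).trans (Nat.lt_succ_self d)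
  refine ⟨.seq P (.seq Q (.add d d (d + 1))), fun x s M hx hs => ?_⟩
  obtain ⟨s₁, t₁, e₁, a₁, r₁, d₁, ht₁⟩ := hP x s M hx hs
  obtain ⟨s₂, t₂, e₂, a₂, r₂, d₂, ht₂⟩ := hQ x s₁ M hx (hs.frame hℓ (by rw [a₁]) r₁)
  have hd : s₂.reg d = f x := by rw [r₂ d (Nat.lt_succ_self d), d₁]
  refine ⟨_, _, .seq e₁ (.seq e₂ (.add s₂ d d (d + 1))), a₂.trans a₁, ?_, ?_, ?_⟩
  · intro i hi
    simp only [State.setReg]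
    rw [Function.update_of_ne (by omega), r₂ i (by omega), r₁ i hi]
  · simp [State.setReg, hd, d₂]
  · have := size_le_self (f x)
    have := size_le_self (g x)
    have := hTb x M hx
    have := hUb x M hx
    rw [hd, d₂]
    beta_reduce
    omega

theorem PolyT.sub {f g : α → ℕ} (hf : PolyT f) (hg : PolyT g) : PolyT fun x => f x - g x := by
  obtain ⟨T, hT, hTb, hf⟩ := hf
  obtain ⟨U, hU, hUb, hg⟩ := hg
  refine ⟨fun M => T M + (U M + (1 + T M + U M)),
    hT.add (hU.add (((PolyBd.const 1).add hT).add hU)), fun x M hx => ?_, fun ℓ d hℓ => ?_⟩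
  · have := hTb x M hx
    beta_reduce
    omega
  obtain ⟨P, hP⟩ := hf ℓ d hℓ
  obtain ⟨Q, hQ⟩ := hg ℓ (d + 1) fun r hr => (hℓ r hr).trans (Nat.lt_succ_self d)
  refine ⟨.seq P (.seq Q (.sub d d (d + 1))), fun x s M hx hs => ?_⟩
  obtain ⟨s₁, t₁, e₁, a₁, r₁, d₁, ht₁⟩ := hP x s M hx hs
  obtain ⟨s₂, t₂, e₂, a₂, r₂, d₂, ht₂⟩ := hQ x s₁ M hx (hs.frame hℓ (by rw [a₁]) r₁)
  have hd : s₂.reg d = f x := by rw [r₂ d (Nat.lt_succ_self d), d₁]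
  refine ⟨_, _, .seq e₁ (.seq e₂ (.sub s₂ d d (d + 1))), a₂.trans a₁, ?_, ?_, ?_⟩
  · intro i hi
    simp only [State.setReg]
    rw [Function.update_of_ne (by omega), r₂ i (by omega), r₁ i hi]
  · simp [State.setReg, hd, d₂]
  · have := size_le_self (f x)
    have := size_le_self (g x)
    have := hTb x M hx
    have := hUb x M hx
    rw [hd, d₂]
    beta_reduce
    omega

theorem PolyT.ite_ne_zero {c f g : α → ℕ} (hc : PolyT c) (hf : PolyT f) (hg : PolyT g) :
    PolyT fun x => if c x ≠ 0 then f x else g x := by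
  obtain ⟨S, hS, hSb, hc⟩ := hc
  obtain ⟨T, hT, hTb, hf⟩ := hf
  obtain ⟨U, hU, hUb, hg⟩ := hg
  refine ⟨fun M => S M + (1 + S M + (T M + U M)),
    hS.add (((PolyBd.const 1).add hS).add (hT.add hU)), fun x M hx => ?_, fun ℓ d hℓ => ?_⟩
  · have := hTb x M hx
    have := hUb x M hx
    dsimp only
    split_ifs <;> omega
  obtain ⟨P, hP⟩ := hc ℓ d hℓ
  obtain ⟨Q, hQ⟩ := hf ℓ d hℓ
  obtain ⟨R, hR⟩ := hg ℓ d hℓ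
  refine ⟨.seq P (.ite d Q R), fun x s M hx hs => ?_⟩
  obtain ⟨s₁, t₁, e₁, a₁, r₁, d₁, ht₁⟩ := hP x s M hx hs
  have hs₁ := hs.frame hℓ (by rw [a₁]) r₁
  have := size_le_self (c x)
  have := hSb x M hx
  by_cases h : c x = 0
  · obtain ⟨s₂, t₂, e₂, a₂, r₂, d₂, ht₂⟩ := hR x s₁ M hx hs₁
    refine ⟨s₂, _, .seq e₁ (.ite_false (by rw [d₁, h]) e₂), a₂.trans a₁, fun i hi => ?_, ?_, ?_⟩
    · rw [r₂ i hi, r₁ i hi]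
    · simp [h, d₂]
    · rw [d₁]
      beta_reduce
      omega
  · obtain ⟨s₂, t₂, e₂, a₂, r₂, d₂, ht₂⟩ := hQ x s₁ M hx hs₁
    refine ⟨s₂, _, .seq e₁ (.ite_true (by rwa [d₁]) e₂), a₂.trans a₁, fun i hi => ?_, ?_, ?_⟩
    · rw [r₂ i hi, r₁ i hi]
    · simp [h, d₂]
    · rw [d₁]
      beta_reduce
      omega

/-- Recursion, provided that all intermediate values are polynomially bounded. -/
theorem PolyT.recursion {n f : α → ℕ} {g : (α × ℕ) × ℕ → ℕ} (hn : PolyT n) (hf : PolyT f)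
    (hg : PolyT g) {B : ℕ → ℕ} (hB : PolyBd B) (F : α → ℕ → ℕ) (hF0 : ∀ x, F x 0 = f x)
    (hF : ∀ x i, F x (i + 1) = g ((x, i), F x i))
    (hFB : ∀ x M, CtxBd x M → ∀ i ≤ n x, F x i ≤ B M) : PolyT fun x => F x (n x) := by
  obtain ⟨S, hS, hSb, hn⟩ := hn
  obtain ⟨T, hT, hTb, hf⟩ := hf
  obtain ⟨U, hU, hUb, hg⟩ := hg
  -- `K M` bounds every number in the context of one round (input, index and accumulator), and `I M`
  -- bounds the time of a round.
  set K : ℕ → ℕ := fun M => M + S M + B M with hK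
  have hKp : PolyBd K := (PolyBd.id.add hS).add hB
  set I : ℕ → ℕ := fun M => 1 + S M + (U (K M) + (20 + 4 * K M)) with hI
  have hIp : PolyBd I := ((PolyBd.const 1).add hS).add
    ((hU.comp hKp).add ((PolyBd.const 20).add ((PolyBd.const 4).mul hKp)))
  refine ⟨fun M => B M + (T M + (1 + (S M + (1 + S M * I M)))),
    hB.add (hT.add ((PolyBd.const 1).add (hS.add ((PolyBd.const 1).add (hS.mul hIp))))),
    fun x M hx => (hFB x M hx _ le_rfl).trans (Nat.le_add_right _ _), fun ℓ d hℓ => ?_⟩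
  obtain ⟨P, hP⟩ := hf ℓ d hℓ
  obtain ⟨Q, hQ⟩ := hn ℓ (d + 2) fun r hr => (hℓ r hr).trans (by omega)
  obtain ⟨R, hR⟩ := hg (d :: (d + 1) :: ℓ) (d + 3) (by
    intro r hr
    simp only [List.mem_cons] at hr
    rcases hr with rfl | rfl | hr
    · omega
    · omega
    · have := hℓ r hr
      omega)
  -- Register `d` holds the accumulator, `d + 1` the index, `d + 2` the number of rounds left, `d +
  -- 3` the new value of `g`, and `d + 4` a constant.
  set body : Program := .seq R (.seq (.const (d + 4) 0) (.seq (.add d (d + 3) (d + 4))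
    (.seq (.const (d + 4) 1) (.seq (.add (d + 1) (d + 1) (d + 4))
      (.sub (d + 2) (d + 2) (d + 4)))))) with hbody
  have loop : ∀ x M, CtxBd x M → ∀ r i s, r + i = n x → Rep ℓ x s → s.reg d = F x i →
      s.reg (d + 1) = i → s.reg (d + 2) = r → ∃ s' t, Exec (.while (d + 2) body) s s' t ∧
        s'.arr = s.arr ∧ (∀ j < d, s'.reg j = s.reg j) ∧ s'.reg d = F x (n x) ∧
        t ≤ 1 + r * I M := by
    intro x M hx r
    have hSM := hSb x M hx
    induction r with
    | zero =>
      intro i s hri hs h0 h1 h2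
      refine ⟨s, _, .while_done h2, rfl, fun _ _ => rfl, ?_, ?_⟩
      · rw [h0, ← hri, zero_add]
      · rw [h2]
        simp
    | succ r ih =>
      intro i s hri hs h0 h1 h2
      have hFi := hFB x M hx i (by omega)
      have hFi' := hFB x M hx (i + 1) (by omega)
      have hKM : K M = M + S M + B M := rfl
      have hx' : CtxBd ((x, i), F x i) (K M) :=
        ((hx.mono (by omega)).pair (by omega)).pair (by omega)
      obtain ⟨s₁, t₁, e₁, a₁, r₁, d₁, ht₁⟩ := hR ((x, i), F x i) s (K M) hx'
        ((hs.cons h1).cons h0)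
      have h1' : s₁.reg (d + 1) = i := by rw [r₁ _ (by omega), h1]
      have h2' : s₁.reg (d + 2) = r + 1 := by rw [r₁ _ (by omega), h2]
      rw [← hF] at d₁
      obtain ⟨s₂, hs₂⟩ : ∃ s₂, s₂ = ((((s₁.setReg (d + 4) 0).setReg d (F x (i + 1) + 0)).setReg
        (d + 4) 1).setReg (d + 1) (i + 1)).setReg (d + 2) (r + 1 - 1) := ⟨_, rfl⟩
      have e := Exec.seq e₁ (.seq (.const s₁ (d + 4) 0)
        (.seq (.add' (i := d) (j := d + 3) (l := d + 4) (a := F x (i + 1)) (b := 0) (by simpa [State.setReg] using d₁)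
          (by simp [State.setReg])) (.seq (.const _ (d + 4) 1)
        (.seq (.add' (i := d + 1) (j := d + 1) (l := d + 4) (a := i) (b := 1) (by simpa [State.setReg] using h1') (by simp [State.setReg]))
          (.sub' (i := d + 2) (j := d + 2) (l := d + 4) (a := r + 1) (b := 1) (by simpa [State.setReg] using h2')
            (by simp [State.setReg]))))))
      rw [← hs₂] at e
      have hr₂ : ∀ j < d, s₂.reg j = s.reg j := by
        intro j hj
        rw [hs₂]
        simp only [State.setReg]
        rw [Function.update_of_ne (by omega), Function.update_of_ne (by omega),
          Function.update_of_ne (by omega), Function.update_of_ne (by omega),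
          Function.update_of_ne (by omega), r₁ j (by omega)]
      have ha₂ : s₂.arr = s.arr := by rw [hs₂, ← a₁]; rfl
      obtain ⟨s₃, t₃, e₃, a₃, r₃, d₃, ht₃⟩ := ih (i + 1) s₂ (by omega)
        (hs.frame hℓ (by rw [ha₂]) hr₂) (by simp [hs₂, State.setReg])
        (by simp [hs₂, State.setReg]) (by simp [hs₂, State.setReg])
      refine ⟨s₃, _, .while_step (by rw [h2]; omega) e e₃, a₃.trans ha₂,
        fun j hj => (r₃ j hj).trans (hr₂ j hj), d₃, ?_⟩
      have := size_le_self (r + 1)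
      have := size_le_self i
      have := size_le_self (F x (i + 1))
      rw [h2, Nat.succ_mul]
      simp only [Nat.size_zero, Nat.size_one, hI, hK] at *
      omega
  refine ⟨.seq P (.seq (.const (d + 1) 0) (.seq Q (.while (d + 2) body))), fun x s M hx hs => ?_⟩
  obtain ⟨s₁, t₁, e₁, a₁, r₁, d₁, ht₁⟩ := hP x s M hx hs
  have hs₁ := hs.frame hℓ (by rw [a₁]) r₁
  have hs₂ : Rep ℓ x (s₁.setReg (d + 1) 0) := hs₁.frame hℓ rfl (by
    intro i hi
    simp only [State.setReg]
    rw [Function.update_of_ne (by omega)])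
  obtain ⟨s₃, t₃, e₃, a₃, r₃, d₃, ht₃⟩ := hQ x _ M hx hs₂
  have hs₃ : Rep ℓ x s₃ := hs₂.frame (d := d) hℓ (by rw [a₃]) fun i hi => r₃ i (by omega)
  obtain ⟨s₄, t₄, e₄, a₄, r₄, d₄, ht₄⟩ := loop x M hx (n x) 0 s₃ rfl hs₃
    (by rw [r₃ _ (by omega), hF0]; simp [State.setReg, d₁])
    (by rw [r₃ _ (by omega)]; simp [State.setReg]) d₃
  refine ⟨s₄, _, .seq e₁ (.seq (.const s₁ (d + 1) 0) (.seq e₃ e₄)),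
    a₄.trans (a₃.trans a₁), ?_, d₄, ?_⟩
  · intro i hi
    rw [r₄ i hi, r₃ i (by omega)]
    simp only [State.setReg]
    rw [Function.update_of_ne (by omega), r₁ i hi]
  · have := Nat.mul_le_mul_right (I M) (hSb x M hx)
    simp only [Nat.size_zero]
    omega

end

/-! ### Arithmetic and decidable properties in polynomial time -/

open Finset in
theorem PolyT.sum {α : Type} [Ctx α] {n : α → ℕ} {g : α → ℕ → ℕ} (hn : PolyT n)
    (hg : PolyT fun p : α × ℕ => g p.1 p.2) : PolyT fun x => ∑ i ∈ range (n x), g x i := by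
  obtain ⟨S, hS, hSb, -⟩ := id hn
  obtain ⟨U, hU, hUb, -⟩ := id hg
  refine PolyT.recursion (f := fun _ => 0) (g := fun p => p.2 + g p.1.1 p.1.2) hn (.const 0)
    (PolyT.snd.add hg.fst) (hS.mul (hU.comp (PolyBd.id.add hS)))
    (fun x k => ∑ i ∈ range k, g x i) (fun x => sum_range_zero _)
    (fun x i => sum_range_succ _ _) ?_
  intro x M hx k hk
  have hn := hSb x M hx
  have h : ∑ i ∈ range k, g x i ≤ (range k).card • U (M + S M) := by
    refine sum_le_card_nsmul _ _ _ fun i hi => hUb (x, i) _ ((hx.mono ?_).pair ?_)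
    · omega
    · have := mem_range.1 hi
      omega
  rw [card_range, smul_eq_mul] at h
  exact h.trans (Nat.mul_le_mul_right _ (hk.trans hn))

section
variable {α : Type} [Ctx α]

/-- Multiplication is not an instruction; repeated addition is affordable because the values are
polynomially bounded. -/
theorem PolyT.mul {f g : α → ℕ} (hf : PolyT f) (hg : PolyT g) : PolyT fun x => f x * g x :=
  (PolyT.sum (g := fun x _ => g x) hf hg.fst).congr fun x => by simp

/-- A property of the context that is decided in polynomial time. -/
def PolyP (p : α → Prop) : Prop := ∃ f : α → ℕ, PolyT f ∧ ∀ x, f x ≠ 0 ↔ p x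

theorem PolyP.congr {p q : α → Prop} (hp : PolyP p) (h : ∀ x, q x ↔ p x) : PolyP q := by
  rwa [show q = p from funext fun x => propext (h x)]

theorem PolyP.lt {f g : α → ℕ} (hf : PolyT f) (hg : PolyT g) : PolyP fun x => f x < g x :=
  ⟨_, hg.sub hf, fun x => by omega⟩

theorem PolyP.not {p : α → Prop} (hp : PolyP p) : PolyP fun x => ¬ p x := by
  obtain ⟨f, hf, h⟩ := hp
  exact ⟨_, (PolyT.const 1).sub hf, fun x => by have := h x; beta_reduce; rw [← this]; omega⟩

theorem PolyP.or {p q : α → Prop} (hp : PolyP p) (hq : PolyP q) : PolyP fun x => p x ∨ q x := by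
  obtain ⟨f, hf, h⟩ := hp
  obtain ⟨g, hg, h'⟩ := hq
  exact ⟨_, hf.add hg, fun x => by have := h x; have := h' x; beta_reduce; rw [← h x, ← h' x]; omega⟩

theorem PolyP.and {p q : α → Prop} (hp : PolyP p) (hq : PolyP q) : PolyP fun x => p x ∧ q x :=
  (hp.not.or hq.not).not.congr fun x => by tauto

theorem PolyP.le {f g : α → ℕ} (hf : PolyT f) (hg : PolyT g) : PolyP fun x => f x ≤ g x :=
  (PolyP.lt hg hf).not.congr fun x => by omega

theorem PolyP.eq {f g : α → ℕ} (hf : PolyT f) (hg : PolyT g) : PolyP fun x => f x = g x :=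
  ((PolyP.le hf hg).and (PolyP.le hg hf)).congr fun x => by omega

theorem PolyT.ite {p : α → Prop} [DecidablePred p] {f g : α → ℕ} (hp : PolyP p) (hf : PolyT f)
    (hg : PolyT g) : PolyT fun x => if p x then f x else g x := by
  obtain ⟨c, hc, h⟩ := hp
  exact (PolyT.ite_ne_zero hc hf hg).congr fun x => by simp only [h]

theorem PolyP.exists_lt {n : α → ℕ} {p : α → ℕ → Prop} (hn : PolyT n)
    (hp : PolyP fun x : α × ℕ => p x.1 x.2) : PolyP fun x => ∃ i < n x, p x i := by
  obtain ⟨f, hf, h⟩ := hp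
  refine ⟨_, PolyT.sum (g := fun x i => f (x, i)) hn hf, fun x => ?_⟩
  rw [Ne, Finset.sum_eq_zero_iff]
  simp only [Finset.mem_range, not_forall, exists_prop]
  exact exists_congr fun i => and_congr_right fun _ => h (x, i)

theorem PolyP.forall_lt {n : α → ℕ} {p : α → ℕ → Prop} (hn : PolyT n)
    (hp : PolyP fun x : α × ℕ => p x.1 x.2) : PolyP fun x => ∀ i < n x, p x i :=
  (PolyP.exists_lt (p := fun x i => ¬ p x i) hn hp.not).not.congr fun x => by simp

theorem PolyT.count {n : α → ℕ} {p : α → ℕ → Prop} [∀ x, DecidablePred (p x)] (hn : PolyT n)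
    (hp : PolyP fun x : α × ℕ => p x.1 x.2) :
    PolyT fun x => ((Finset.range (n x)).filter (p x)).card := by
  classical
  refine (PolyT.sum (g := fun x i => if p x i then 1 else 0) hn
    (PolyT.ite hp (.const 1) (.const 0))).congr fun x => ?_
  rw [Finset.card_filter]

/-- The quotient counts the positive multiples of `g x` up to `f x`; the condition `0 < g x` yields
the value `0` for division by zero. -/
theorem PolyT.div {f g : α → ℕ} (hf : PolyT f) (hg : PolyT g) : PolyT fun x => f x / g x := by
  classical
  refine (PolyT.count (p := fun x i => 0 < g x ∧ (i + 1) * g x ≤ f x) hf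
    ((PolyP.lt (.const 0) hg.fst).and (PolyP.le ((PolyT.snd.add (.const 1)).mul hg.fst)
      hf.fst))).congr fun x => ?_
  rcases Nat.eq_zero_or_pos (g x) with h | h
  · simp [h]
  · have : (Finset.range (f x)).filter (fun i => 0 < g x ∧ (i + 1) * g x ≤ f x) =
        Finset.range (f x / g x) := by
      ext i
      simp only [Finset.mem_filter, Finset.mem_range]
      rw [← Nat.le_div_iff_mul_le h]
      have := Nat.div_le_self (f x) (g x)
      omega
    rw [this, Finset.card_range]

theorem PolyT.mod {f g : α → ℕ} (hf : PolyT f) (hg : PolyT g) : PolyT fun x => f x % g x :=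
  (hf.sub (hg.mul (hf.div hg))).congr fun x => by
    have := Nat.mod_add_div (f x) (g x)
    omega

theorem PolyT.max {f g : α → ℕ} (hf : PolyT f) (hg : PolyT g) : PolyT fun x => max (f x) (g x) :=
  (hf.add (hg.sub hf)).congr fun x => by omega

/-- The largest value of `g` below `n`. -/
def maxBelow (n : ℕ) (g : ℕ → ℕ) : ℕ := (Finset.range n).sup g

theorem PolyT.maxBelow {n : α → ℕ} {g : α → ℕ → ℕ} (hn : PolyT n)
    (hg : PolyT fun p : α × ℕ => g p.1 p.2) : PolyT fun x => maxBelow (n x) (g x) := by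
  obtain ⟨S, hS, hSb, -⟩ := id hn
  obtain ⟨U, hU, hUb, -⟩ := id hg
  refine PolyT.recursion (f := fun _ => 0) (g := fun p => Max.max (g p.1.1 p.1.2) p.2) hn
    (.const 0) (hg.fst.max .snd) (hU.comp (PolyBd.id.add hS))
    (fun x k => PathwidthSETH.maxBelow k (g x)) (fun x => rfl)
    (fun x i => by simp [PathwidthSETH.maxBelow, Finset.range_add_one]) ?_
  intro x M hx k hk
  have hn := hSb x M hx
  refine Finset.sup_le fun i hi => hUb (x, i) _ ((hx.mono ?_).pair ?_)
  · omega
  · have := Finset.mem_range.1 hi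
    omega

/-- The digit of weight `b ^ i` of `x` in base `b`. -/
def digit (b x i : ℕ) : ℕ := x / b ^ i % b

/-- Iterated division keeps all intermediate values below `f x`, whereas `b ^ g x` itself could be
exponentially large. -/
theorem PolyT.div_pow {f g : α → ℕ} (b : ℕ) (hf : PolyT f) (hg : PolyT g) :
    PolyT fun x => f x / b ^ g x := by
  obtain ⟨S, hS, hSb, -⟩ := id hf
  refine PolyT.recursion (f := f) (g := fun p => p.2 / b) hg hf (PolyT.snd.div (.const b)) hS
    (fun x k => f x / b ^ k) (fun x => by simp) (fun x i => by rw [pow_succ, Nat.div_div_eq_div_mul])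
    fun x M hx i _ => (Nat.div_le_self _ _).trans (hSb x M hx)

theorem PolyT.digit {f g : α → ℕ} (b : ℕ) (hf : PolyT f) (hg : PolyT g) :
    PolyT fun x => digit b (f x) (g x) :=
  (PolyT.div_pow b hf hg).mod (.const b)

end

/-! ### Words written in polynomial time -/

/-- The word `out` is stored in array `1`, and its length in the first cell of array `2`. -/
def Out (s : State) (out : List ℕ) : Prop :=
  (∀ p, s.arr 1 p = out.getD p 0) ∧ s.arr 2 0 = out.length

/-- A function from the context to words that is written in polynomial time at the end of the
output. -/
def Emit {α : Type} [Ctx α] (f : α → List ℕ) : Prop :=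
  ∃ T, PolyBd T ∧ (∀ x M, CtxBd x M → (f x).length ≤ T M) ∧
    ∀ (ℓ : List ℕ) (d : ℕ), (∀ r ∈ ℓ, r < d) → ∃ P : Program, ∀ x s M out, CtxBd x M →
      Rep ℓ x s → Out s out → out.length ≤ M → ∃ s' t, Exec P s s' t ∧ s'.arr 0 = s.arr 0 ∧
        (∀ i < d, s'.reg i = s.reg i) ∧ Out s' (out ++ f x) ∧ (∀ a, 3 ≤ a → s'.arr a = s.arr a) ∧
        t ≤ T M

section
variable {α : Type} [Ctx α]

theorem Emit.congr {f g : α → List ℕ} (hf : Emit f) (h : ∀ x, g x = f x) : Emit g := by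
  rwa [show g = f from funext h]

theorem Emit.singleton {f : α → ℕ} (hf : PolyT f) : Emit fun x => [f x] := by
  obtain ⟨T, hT, hTb, h⟩ := hf
  refine ⟨fun M => T M + (10 + T M + 5 * M) + 1,
    (hT.add (((PolyBd.const 10).add hT).add ((PolyBd.const 5).mul .id))).add (.const 1),
    fun x M _ => by simp, fun ℓ d hℓ => ?_⟩
  obtain ⟨P, hP⟩ := h ℓ d hℓ
  refine ⟨.seq P (.seq (.const (d + 1) 0) (.seq (.load (d + 2) 2 (d + 1)) (.seq
    (.store 1 (d + 2) d) (.seq (.const (d + 3) 1) (.seq (.add (d + 2) (d + 2) (d + 3))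
      (.store 2 (d + 1) (d + 2))))))), fun x s M out hx hs ho hM => ?_⟩
  obtain ⟨s₁, t₁, e₁, a₁, r₁, d₁, ht₁⟩ := hP x s M hx hs
  have hL : s₁.arr 2 0 = out.length := by rw [a₁]; exact ho.2
  obtain ⟨s₂, hs₂⟩ : ∃ s₂, s₂ = (((((s₁.setReg (d + 1) 0).setReg (d + 2) out.length).setArr 1
    out.length (f x)).setReg (d + 3) 1).setReg (d + 2) (out.length + 1)).setArr 2 0
      (out.length + 1) := ⟨_, rfl⟩
  have e := e₁.seq (.seq (.const s₁ (d + 1) 0) (.seq (.load' (i := d + 2) (a := 2) (j := d + 1)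
    (p := 0) (v := out.length) (by simp [State.setReg]) (by simpa [State.setReg] using hL))
    (.seq (.store' (a := 1) (i := d + 2) (j := d) (p := out.length) (v := f x)
      (by simp [State.setReg]) (by simpa [State.setReg] using d₁)) (.seq (.const _ (d + 3) 1)
    (.seq (.add' (i := d + 2) (j := d + 2) (l := d + 3) (a := out.length) (b := 1)
      (by simp [State.setReg, State.setArr]) (by simp [State.setReg])) (.store' (a := 2)
        (i := d + 1) (j := d + 2) (p := 0) (v := out.length + 1)
          (by simp [State.setReg, State.setArr]) (by simp [State.setReg])))))))
  rw [← hs₂] at e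
  refine ⟨s₂, _, e, ?_, ?_, ⟨?_, ?_⟩, ?_, ?_⟩
  · simp [hs₂, State.setArr, State.setReg, a₁]
  · intro i hi
    rw [hs₂, ← r₁ i hi]
    simp only [State.setArr, State.setReg]
    rw [Function.update_of_ne (by omega), Function.update_of_ne (by omega),
      Function.update_of_ne (by omega), Function.update_of_ne (by omega)]
  · intro p
    simp only [hs₂, State.setArr, State.setReg, a₁]
    rw [Function.update_of_ne (by omega), Function.update_self]
    by_cases hp : p = out.length
    · subst hp
      simp
    · rw [Function.update_of_ne hp, ho.1]
      simp only [List.getD_eq_getElem?_getD]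
      rcases Nat.lt_or_gt_of_ne hp with h | h
      · rw [List.getElem?_append_left h]
      · rw [List.getElem?_eq_none h.le, List.getElem?_eq_none (by simp; omega)]
  · simp [hs₂, State.setArr]
  · intro a ha
    simp only [hs₂, State.setArr, State.setReg, a₁]
    rw [Function.update_of_ne (by omega), Function.update_of_ne (by omega)]
  · have := size_le_self (f x)
    have := hTb x M hx
    have := size_le_self out.length
    have := size_le_self (out.length + 1)
    simp only [Nat.size_zero, Nat.size_one]
    omega

theorem Emit.append {f g : α → List ℕ} (hf : Emit f) (hg : Emit g) :
    Emit fun x => f x ++ g x := by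
  obtain ⟨T, hT, hTb, hf⟩ := hf
  obtain ⟨U, hU, hUb, hg⟩ := hg
  refine ⟨fun M => T M + U M + U (M + T M), (hT.add hU).add (hU.comp (PolyBd.id.add hT)),
    fun x M hx => ?_, fun ℓ d hℓ => ?_⟩
  · have := hTb x M hx
    have := hUb x M hx
    rw [List.length_append]
    beta_reduce
    omega
  obtain ⟨P, hP⟩ := hf ℓ d hℓ
  obtain ⟨Q, hQ⟩ := hg ℓ d hℓ
  refine ⟨.seq P Q, fun x s M out hx hs ho hM => ?_⟩
  obtain ⟨s₁, t₁, e₁, a₁, r₁, o₁, b₁, ht₁⟩ := hP x s M out hx hs ho hM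
  -- After the first program the output may be longer than `M`, so the second one is run with the
  -- bound `M + T M`.
  obtain ⟨s₂, t₂, e₂, a₂, r₂, o₂, b₂, ht₂⟩ := hQ x s₁ (M + T M) _ (hx.mono (Nat.le_add_right _ _))
    (hs.frame hℓ a₁ r₁) o₁ (by
      have := hTb x M hx
      rw [List.length_append]
      omega)
  refine ⟨s₂, _, e₁.seq e₂, a₂.trans a₁, fun i hi => (r₂ i hi).trans (r₁ i hi), ?_,
    fun a ha => (b₂ a ha).trans (b₁ a ha), ?_⟩
  · rwa [List.append_assoc] at o₂
  · beta_reduce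
    omega

theorem Emit.cons {f : α → ℕ} {g : α → List ℕ} (hf : PolyT f) (hg : Emit g) :
    Emit fun x => f x :: g x :=
  (Emit.singleton hf).append hg

theorem flatMap_range_succ {β : Type} (k : ℕ) (g : ℕ → List β) :
    (List.range (k + 1)).flatMap g = (List.range k).flatMap g ++ g k := by
  rw [List.range_succ, List.flatMap_append, List.flatMap_singleton]

theorem Emit.flatMap {n : α → ℕ} {g : α → ℕ → List ℕ} (hn : PolyT n)
    (hg : Emit fun p : α × ℕ => g p.1 p.2) :
    Emit fun x => (List.range (n x)).flatMap (g x) := by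
  obtain ⟨S, hS, hSb, hn⟩ := hn
  obtain ⟨U, hU, hUb, hg⟩ := hg
  have len : ∀ x M, CtxBd x M → ∀ k ≤ n x,
      ((List.range k).flatMap (g x)).length ≤ k * U (M + S M) := by
    intro x M hx k
    have hnx := hSb x M hx
    induction k with
    | zero => simp
    | succ k ih =>
      intro hk
      rw [flatMap_range_succ, List.length_append, Nat.succ_mul]
      exact Nat.add_le_add (ih (by omega))
        (hUb (x, k) _ ((hx.mono (Nat.le_add_right _ _)).pair (by omega)))
  -- The last summand accounts for the output of the previous rounds, so `K M` bounds the numbers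
  -- and the output length at the start of every round.
  set K : ℕ → ℕ := fun M => M + S M + S M * U (M + S M) with hK
  have hL : PolyBd fun M => S M * U (M + S M) := hS.mul (hU.comp (PolyBd.id.add hS))
  have hKp : PolyBd K := (PolyBd.id.add hS).add hL
  set I : ℕ → ℕ := fun M => 20 + 4 * S M + U (K M) with hI
  have hIp : PolyBd I := ((PolyBd.const 20).add ((PolyBd.const 4).mul hS)).add (hU.comp hKp)
  refine ⟨fun M => S M * U (M + S M) + (1 + (S M + (1 + S M * I M))),
    hL.add ((PolyBd.const 1).add (hS.add ((PolyBd.const 1).add (hS.mul hIp)))),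
    fun x M hx => ((len x M hx _ le_rfl).trans
      (Nat.mul_le_mul_right _ (hSb x M hx))).trans (Nat.le_add_right _ _), fun ℓ d hℓ => ?_⟩
  obtain ⟨Q, hQ⟩ := hn ℓ (d + 1) fun r hr => (hℓ r hr).trans (by omega)
  obtain ⟨R, hR⟩ := hg (d :: ℓ) (d + 2) (by
    intro r hr
    simp only [List.mem_cons] at hr
    rcases hr with rfl | hr
    · omega
    · have := hℓ r hr
      omega)
  set body : Program := .seq R (.seq (.const (d + 2) 1) (.seq (.add d d (d + 2))
    (.sub (d + 1) (d + 1) (d + 2)))) with hbody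
  have loop : ∀ x M out, CtxBd x M → out.length ≤ M → ∀ r i s, r + i = n x → Rep ℓ x s →
      s.reg d = i → s.reg (d + 1) = r → Out s (out ++ (List.range i).flatMap (g x)) →
      ∃ s' t, Exec (.while (d + 1) body) s s' t ∧
        s'.arr 0 = s.arr 0 ∧ (∀ j < d, s'.reg j = s.reg j) ∧
        Out s' (out ++ (List.range (n x)).flatMap (g x)) ∧
        (∀ a, 3 ≤ a → s'.arr a = s.arr a) ∧ t ≤ 1 + r * I M := by
    intro x M out hx hM r
    have hSM := hSb x M hx
    induction r with
    | zero =>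
      intro i s hri hs h0 h1 ho
      refine ⟨s, _, .while_done h1, rfl, fun _ _ => rfl, ?_, fun _ _ => rfl, ?_⟩
      · rwa [← hri, zero_add]
      · rw [h1]
        simp
    | succ r ih =>
      intro i s hri hs h0 h1 ho
      have hKM : K M = M + S M + S M * U (M + S M) := rfl
      have hx' : CtxBd (x, i) (K M) := (hx.mono (by omega)).pair (by omega)
      obtain ⟨s₁, t₁, e₁, a₁, r₁, o₁, b₁, ht₁⟩ := hR (x, i) s (K M) _ hx' (hs.cons h0) ho (by
        have := len x M hx i (by omega)
        have := Nat.mul_le_mul_right (U (M + S M)) (show i ≤ S M by omega)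
        rw [List.length_append]
        omega)
      rw [List.append_assoc, ← flatMap_range_succ] at o₁
      have h0' : s₁.reg d = i := by rw [r₁ _ (by omega), h0]
      have h1' : s₁.reg (d + 1) = r + 1 := by rw [r₁ _ (by omega), h1]
      obtain ⟨s₂, hs₂⟩ : ∃ s₂, s₂ = ((s₁.setReg (d + 2) 1).setReg d (i + 1)).setReg
        (d + 1) (r + 1 - 1) := ⟨_, rfl⟩
      have e := Exec.seq e₁ (.seq (.const s₁ (d + 2) 1)
        (.seq (.add' (i := d) (j := d) (l := d + 2) (a := i) (b := 1)
          (by simpa [State.setReg] using h0') (by simp [State.setReg]))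
        (.sub' (i := d + 1) (j := d + 1) (l := d + 2) (a := r + 1) (b := 1)
          (by simpa [State.setReg] using h1') (by simp [State.setReg]))))
      rw [← hs₂] at e
      have hr₂ : ∀ j < d, s₂.reg j = s.reg j := by
        intro j hj
        rw [hs₂]
        simp only [State.setReg]
        rw [Function.update_of_ne (by omega), Function.update_of_ne (by omega),
          Function.update_of_ne (by omega), r₁ j (by omega)]
      have ha₂ : s₂.arr = s₁.arr := by rw [hs₂]; rfl
      obtain ⟨s₃, t₃, e₃, a₃, r₃, o₃, b₃, ht₃⟩ := ih (i + 1) s₂ (by omega)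
        (hs.frame hℓ (by rw [ha₂, a₁]) hr₂) (by simp [hs₂, State.setReg])
        (by simp [hs₂, State.setReg]) (by simpa only [Out, ha₂] using o₁)
      refine ⟨s₃, _, .while_step (by rw [h1]; omega) e e₃, a₃.trans (by rw [ha₂, a₁]),
        fun j hj => (r₃ j hj).trans (hr₂ j hj), o₃,
        fun a ha => (b₃ a ha).trans (by rw [ha₂, b₁ a ha]), ?_⟩
      have := size_le_self (r + 1)
      have := size_le_self i
      rw [h1, Nat.succ_mul]
      simp only [Nat.size_one, hI] at *
      omega
  refine ⟨.seq (.const d 0) (.seq Q (.while (d + 1) body)), fun x s M out hx hs ho hM => ?_⟩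
  have hs₂ : Rep ℓ x (s.setReg d 0) := hs.frame hℓ rfl (by
    intro i hi
    simp only [State.setReg]
    rw [Function.update_of_ne (by omega)])
  obtain ⟨s₃, t₃, e₃, a₃, r₃, d₃, ht₃⟩ := hQ x _ M hx hs₂
  have hs₃ : Rep ℓ x s₃ := hs₂.frame (d := d) hℓ (by rw [a₃]) fun i hi => r₃ i (by omega)
  obtain ⟨s₄, t₄, e₄, a₄, r₄, o₄, b₄, ht₄⟩ := loop x M out hx hM (n x) 0 s₃ rfl hs₃
    (by rw [r₃ _ (by omega)]; simp [State.setReg]) d₃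
    (by simpa [Out, a₃, State.setReg] using ho)
  refine ⟨s₄, _, .seq (.const s d 0) (.seq e₃ e₄), by rw [a₄, a₃]; rfl, ?_, o₄,
    fun a ha => by rw [b₄ a ha, a₃]; rfl, ?_⟩
  · intro i hi
    rw [r₄ i hi, r₃ i (by omega)]
    simp only [State.setReg]
    rw [Function.update_of_ne (by omega)]
  · have := Nat.mul_le_mul_right (I M) (hSb x M hx)
    simp only [Nat.size_zero]
    omega

end

/-! ### Reductions -/

/-- The reduction program is followed by the solver, renamed so that it finds its input where the
output was written. The reduction contributes a polynomial in the input length, which `β' ^ p x ≥ 1`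
absorbs; the solver contributes `β ^ p' (red x)` times a polynomial. The hypothesis `hbd` lets the
word length serve as the bound `M` of the context. -/
theorem Emit.transfer {ι κ : Type} {enc : ι → List ℕ} {enc' : κ → List ℕ} {yes : ι → Prop}
    {yes' : κ → Prop} {p : ι → ℕ} {p' : κ → ℕ} {β β' : ℝ} (red : ι → κ) (F : List ℕ → List ℕ)
    (hF : Emit F) (henc : ∀ x, enc' (red x) = F (enc x)) (hyes : ∀ x, yes' (red x) ↔ yes x)
    (hbd : ∀ x, 1 ≤ (enc x).length ∧ ∀ v ∈ enc x, v ≤ (enc x).length) (hβ : 0 ≤ β) (hβ' : 1 ≤ β')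
    (K : ℕ) (hK : ∀ x, β ^ p' (red x) ≤ K * β' ^ p x) (h : SolvableInTime enc' yes' p' β) :
    SolvableInTime enc yes p β' := by
  obtain ⟨T, ⟨c, hc⟩, hTb, hP⟩ := hF
  obtain ⟨P, hP⟩ := hP [] 0 (by simp)
  obtain ⟨Q, C, e, hQ⟩ := h
  -- The solver shares only register `0` (loaded with the word length) and array `1` (the word) with
  -- the reduction. Its other cells are moved beyond the footprint of `P` and are therefore still
  -- `0`.
  set ρ : ℕ → ℕ := fun i => if i = 0 then 0 else i + P.maxReg with hρ
  set τ : ℕ → ℕ := fun a => if a = 0 then 1 else a + (P.maxArr + 3) with hτ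
  have hρi : ρ.Injective := by
    intro i j hij
    simp only [hρ] at hij
    split_ifs at hij <;> omega
  have hτi : τ.Injective := by
    intro i j hij
    simp only [hτ] at hij
    split_ifs at hij <;> omega
  refine ⟨.seq P (.seq (.const 0 0) (.seq (.load 0 2 0) (Q.rename ρ τ))),
    3 ^ c * 4 + C * K * (3 ^ c) ^ e, c + c * e, fun x => ?_⟩
  obtain ⟨s₁, t₁, e₁, a₁, -, o₁, b₁, ht₁⟩ := hP (enc x) (initial (enc x)) (enc x).length []
    ⟨(hbd x).2, by simp [Ctx.vals]⟩ ⟨rfl, fun p => by simp [initial, Ctx.word]⟩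
    ⟨fun p => by simp [initial], by simp [initial]⟩ (by simp)
  rw [List.nil_append, ← henc] at o₁
  have hlen := hTb (enc x) (enc x).length ⟨(hbd x).2, by simp [Ctx.vals]⟩
  rw [← henc] at hlen
  obtain ⟨s₂, hs₂⟩ : ∃ s₂, s₂ = (s₁.setReg 0 0).setReg 0 (enc' (red x)).length := ⟨_, rfl⟩
  have hload : Exec (.load 0 2 0) (s₁.setReg 0 0) s₂
      (1 + Nat.size 0 + (enc' (red x)).length.size) := by
    rw [hs₂]
    exact .load' (by simp [State.setReg]) (by simpa [State.setReg] using o₁.2)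
  have hpull : s₂.pull ρ τ = initial (enc' (red x)) := by
    rw [hs₂]
    simp only [State.pull, initial, State.mk.injEq, State.setReg]
    constructor
    · funext i
      by_cases hi : i = 0
      · simp [hi, hρ]
      · have h0 : ρ i ≠ 0 := by simp [hρ, hi]
        have h1 : P.maxReg ≤ ρ i := by simp [hρ, hi]
        rw [Function.update_of_ne h0, Function.update_of_ne h0, e₁.reg_frame _ h1]
        simp [initial, h0, hi]
    · funext a p
      by_cases ha : a = 0
      · simp [ha, hτ, o₁.1]
      · have h0 : τ a ≠ 0 := by simp only [hτ, ha, if_false]; omega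
        have h1 : P.maxArr ≤ τ a := by simp only [hτ, ha, if_false]; omega
        rw [e₁.arr_frame _ h1]
        simp [initial, h0, ha]
  obtain ⟨s₃, t₃, e₃, y₃, ht₃⟩ := hQ (red x)
  obtain ⟨s₄, e₄, p₄⟩ := e₃.rename hρi hτi s₂ hpull
  refine ⟨s₄, _, e₁.seq (.seq (.const s₁ 0 0) (hload.seq e₄)), ?_, ?_⟩
  · rw [← hyes, ← y₃, ← p₄]
    rfl
  · set N := (enc x).length with hN
    have hN1 : 1 ≤ N := (hbd x).1
    -- Since `N ≥ 1`, `N + 2 ≤ 3 * N`.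
    have hTN : T N ≤ 3 ^ c * N ^ c := by
      rw [← mul_pow]
      exact (hc N).trans (Nat.pow_le_pow_left (by omega) c)
    have hsz := size_le_self (enc' (red x)).length
    have hpos : 1 ≤ 3 ^ c * N ^ c := Nat.one_le_iff_ne_zero.2 (by positivity)
    have hA : t₁ + (1 + Nat.size 0 + (1 + Nat.size 0 + (enc' (red x)).length.size)) ≤
        3 ^ c * N ^ c * 4 := by
      simp only [Nat.size_zero]
      omega
    have hlen' : (enc' (red x)).length ≤ 3 ^ c * N ^ c := hlen.trans hTN
    have hA' : ((t₁ + (1 + Nat.size 0 + (1 + Nat.size 0 + (enc' (red x)).length.size)) : ℕ) : ℝ) ≤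
        ((3 ^ c * N ^ c * 4 : ℕ) : ℝ) := by exact_mod_cast hA
    have hl : (((enc' (red x)).length : ℝ)) ^ e ≤ ((3 ^ c * N ^ c : ℕ) : ℝ) ^ e :=
      pow_le_pow_left₀ (by positivity) (by exact_mod_cast hlen') e
    have hβp : (1 : ℝ) ≤ β' ^ p x := one_le_pow₀ hβ'
    have hN1' : (1 : ℝ) ≤ N := by exact_mod_cast hN1
    have hB : (t₃ : ℝ) ≤ C * (K * β' ^ p x) * ((3 ^ c * N ^ c : ℕ) : ℝ) ^ e := by
      refine ht₃.trans ?_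
      have := hK x
      have h0 : (0 : ℝ) ≤ β ^ p' (red x) := pow_nonneg hβ _
      gcongr
    have hpow1 : (N : ℝ) ^ c ≤ N ^ (c + c * e) := pow_le_pow_right₀ hN1' (by omega)
    have hpow2 : (N : ℝ) ^ (c * e) ≤ N ^ (c + c * e) := pow_le_pow_right₀ hN1' (by omega)
    calc ((t₁ + (1 + Nat.size 0 + (1 + Nat.size 0 + (enc' (red x)).length.size + t₃)) : ℕ) : ℝ)
        = ((t₁ + (1 + Nat.size 0 + (1 + Nat.size 0 + (enc' (red x)).length.size)) : ℕ) : ℝ) +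
          t₃ := by push_cast; ring
      _ ≤ ((3 ^ c * N ^ c * 4 : ℕ) : ℝ) + C * (K * β' ^ p x) * ((3 ^ c * N ^ c : ℕ) : ℝ) ^ e :=
          add_le_add hA' hB
      _ = 3 ^ c * 4 * (1 * N ^ c) + C * K * (3 ^ c) ^ e * (β' ^ p x * N ^ (c * e)) := by
          push_cast
          rw [mul_pow, ← pow_mul, ← pow_mul]
          ring
      _ ≤ 3 ^ c * 4 * (β' ^ p x * N ^ (c + c * e)) +
          C * K * (3 ^ c) ^ e * (β' ^ p x * N ^ (c + c * e)) := by gcongr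
      _ = ((3 ^ c * 4 + C * K * (3 ^ c) ^ e : ℕ) : ℝ) * β' ^ p x * N ^ (c + c * e) := by
          push_cast
          ring

open Finset

/-! ### Constraint satisfaction along a path decomposition -/

/-- A constraint satisfaction problem with `n` variables, a path decomposition with `m` bags
(`mem i v` tells whether the bag `i` contains `v`), and `numC` constraints. The constraint `j`
says that not all of the variables `var j r`, `r < 3`, take the values `val j r`. -/
structure Src : Type where
  n : ℕ
  m : ℕ
  numC : ℕ
  mem : ℕ → ℕ → Bool
  var : ℕ → ℕ → ℕ
  val : ℕ → ℕ → ℕ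

/-- `t` variables with `a` values are to be written as `q` variables with `b` values. -/
structure Params : Type where
  a : ℕ
  b : ℕ
  t : ℕ
  q : ℕ

structure Params.Valid (p : Params) : Prop where
  two_le_a : 2 ≤ p.a
  two_le_b : 2 ≤ p.b
  t_pos : 0 < p.t
  q_pos : 0 < p.q
  pow_le : p.a ^ p.t ≤ p.b ^ p.q

/-- The value `y` has the required form `v`; here `v = a` admits all values. -/
def Match (a v y : ℕ) : Prop := v = y ∨ v = a

instance (a v y : ℕ) : Decidable (Match a v y) := inferInstanceAs (Decidable (_ ∨ _))

namespace Src

variable (S : Src) (p : Params)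

/-- The problem has a solution with values below `a`. -/
def Sat (a : ℕ) : Prop :=
  ∃ col : ℕ → ℕ, (∀ v < S.n, col v < a) ∧
    ∀ j < S.numC, ∃ r < 3, ¬ Match a (S.val j r) (col (S.var j r))

/-- The first alternative of `scope` is a constraint that always fails, as an empty clause does; its
variables may be meaningless. In the second, pairwise common bags suffice, because intervals have
the Helly property. -/
structure Valid (a : ℕ) : Prop where
  mem_bound : ∀ i v, S.mem i v = true → i < S.m ∧ v < S.n
  interval : ∀ v i j l, i ≤ j → j ≤ l → S.mem i v = true → S.mem l v = true → S.mem j v = true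
  scope : ∀ j < S.numC, (∀ r < 3, S.val j r = a) ∨
    ∀ r < 3, ∀ r' < 3, ∃ i, S.mem i (S.var j r) = true ∧ S.mem i (S.var j r') = true

/-- The first bag that contains `v`. -/
def first (v : ℕ) : ℕ := #{i ∈ range S.m | ∀ i' < i + 1, ¬ S.mem i' v = true}

/-- The variables are ordered by their first appearance. -/
def Before (u v : ℕ) : Prop := S.first u < S.first v ∨ S.first u = S.first v ∧ u < v

instance (u v : ℕ) : Decidable (S.Before u v) := inferInstanceAs (Decidable (_ ∨ _))

/-- The rank of `v` in the bag `i`. -/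
def rank (i v : ℕ) : ℕ := #{u ∈ range S.n | S.mem i u = true ∧ S.Before u v}

def bagCard (i : ℕ) : ℕ := #{u ∈ range S.n | S.mem i u = true}

def maxCard : ℕ := maxBelow S.m S.bagCard

/-- The number of blocks for one bag. -/
def blocks : ℕ := S.maxCard / p.t + 1

/-- The place of the variable `v` of the bag `i`. -/
def place (i v : ℕ) : ℕ := i * (S.blocks p * p.t) + S.rank i v

/-- A bag that contains the variables of the constraint `j`. -/
def home (j : ℕ) : ℕ := maxBelow 3 fun r => S.first (S.var j r)

/-- Behind the original constraints come those that tie copies in consecutive bags. The one for bag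
`i`, variable `v` and values `c`, `c'` in bags `i`, `i + 1` has the number `((i * n + v) * a + c') *
a + c`. -/
def numC' : ℕ := S.numC + S.m * S.n * p.a * p.a

def eqVar (j : ℕ) : ℕ := j / p.a / p.a % S.n

def eqBag (j : ℕ) : ℕ := j / p.a / p.a / S.n

/-- The variable `eqVar j` must take the same value in the bag `eqBag j` and in the next bag, and
`j` stands for one of the violations of this rule. -/
def Link (j : ℕ) : Prop :=
  j % p.a ≠ j / p.a % p.a ∧ S.mem (S.eqBag p j) (S.eqVar p j) = true ∧
    S.mem (S.eqBag p j + 1) (S.eqVar p j) = true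

instance (j : ℕ) : Decidable (S.Link p j) := inferInstanceAs (Decidable (_ ∧ _))

/-- The places in the constraint `j`. -/
def pos (j r : ℕ) : ℕ :=
  if j < S.numC then S.place p (S.home j) (S.var j r) else
    if S.Link p (j - S.numC) ∧ 0 < r then
      S.place p (S.eqBag p (j - S.numC) + 1) (S.eqVar p (j - S.numC))
    else S.place p (S.eqBag p (j - S.numC)) (S.eqVar p (j - S.numC))

/-- The values in the constraint `j`. -/
def value (j r : ℕ) : ℕ :=
  if j < S.numC then S.val j r else
    if S.Link p (j - S.numC) then
      if 0 < r then (j - S.numC) / p.a % p.a else (j - S.numC) % p.a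
    else p.a + 1

/-- The first block of the window of the constraint `j`. -/
def win (j : ℕ) : ℕ :=
  if j < S.numC then S.home j * S.blocks p else
    S.place p (S.eqBag p (j - S.numC)) (S.eqVar p (j - S.numC)) / p.t

variable {S p}

/-! ### First appearances, ranks and places -/

theorem first_eq {i v : ℕ} (hi : i < S.m) (h : S.mem i v = true)
    (hmin : ∀ j < i, ¬ S.mem j v = true) : S.first v = i := by
  have : {k ∈ range S.m | ∀ i' < k + 1, ¬ S.mem i' v = true} = range i := by
    ext k
    simp only [mem_filter, mem_range]
    constructor
    · rintro ⟨_, hk⟩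
      by_contra hik
      exact hk i (by omega) h
    · intro hk
      exact ⟨by omega, fun i' hi' => hmin i' (by omega)⟩
  rw [first, this, card_range]

/-- The value `S.m` is attained by variables that lie in no bag; a constraint that always fails may
mention such variables. -/
theorem first_le_m (v : ℕ) : S.first v ≤ S.m :=
  (card_filter_le _ _).trans (card_range _).le

theorem first_spec {a : ℕ} (hS : S.Valid a) {i v : ℕ} (h : S.mem i v = true) :
    S.mem (S.first v) v = true ∧ S.first v ≤ i := by
  classical
  have hex : ∃ i, S.mem i v = true := ⟨i, h⟩
  have := first_eq (hS.mem_bound _ _ (Nat.find_spec hex)).1 (Nat.find_spec hex)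
    fun j hj => Nat.find_min hex hj
  rw [this]
  exact ⟨Nat.find_spec hex, Nat.find_min' hex h⟩

/-- The Helly property: the later of the two first appearances lies between `S.first u` and the
common bag `i`. -/
theorem mem_first {a : ℕ} (hS : S.Valid a) {i u v : ℕ} (hu : S.mem i u = true)
    (hv : S.mem i v = true) (h : S.first u ≤ S.first v) : S.mem (S.first v) u = true :=
  hS.interval u _ _ _ h (first_spec hS hv).2 (first_spec hS hu).1 hu

theorem before_trans {u v w : ℕ} (h : S.Before u v) (h' : S.Before v w) : S.Before u w := by
  unfold Before at *
  omega

theorem rank_le_maxCard {a : ℕ} (hS : S.Valid a) (i v : ℕ) : S.rank i v ≤ S.maxCard := by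
  by_cases hi : i < S.m
  · refine (card_le_card (fun u hu => ?_)).trans
      (le_sup (f := S.bagCard) (mem_range.2 hi))
    simp only [mem_filter] at hu ⊢
    exact ⟨hu.1, hu.2.1⟩
  · have : S.rank i v = 0 := by
      rw [rank, card_eq_zero, filter_eq_empty_iff]
      rintro u - ⟨hu, -⟩
      exact hi (hS.mem_bound _ _ hu).1
    omega

theorem rank_lt {a : ℕ} (hS : S.Valid a) (hp : p.Valid) (i v : ℕ) :
    S.rank i v < S.blocks p * p.t := by
  have h1 := rank_le_maxCard hS i v
  have h2 := Nat.div_add_mod S.maxCard p.t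
  have h3 := Nat.mod_lt S.maxCard hp.t_pos
  rw [blocks, Nat.succ_mul, mul_comm]
  omega

theorem rank_lt_rank {i u v : ℕ} (hu : S.mem i u = true) (hun : u < S.n) (h : S.Before u v) :
    S.rank i u < S.rank i v := by
  refine card_lt_card ⟨fun w hw => ?_, fun hsub => ?_⟩
  · simp only [mem_filter] at hw ⊢
    exact ⟨hw.1, hw.2.1, before_trans hw.2.2 h⟩
  · have := (mem_filter.1 (hsub (mem_filter.2 ⟨mem_range.2 hun, hu, h⟩))).2.2
    unfold Before at this
    omega

theorem rank_injective {a : ℕ} (hS : S.Valid a) {i u v : ℕ} (hu : S.mem i u = true)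
    (hv : S.mem i v = true) (h : S.rank i u = S.rank i v) : u = v := by
  by_contra hne
  have : S.Before u v ∨ S.Before v u := by
    unfold Before
    omega
  rcases this with h' | h'
  · exact (rank_lt_rank hu (hS.mem_bound _ _ hu).2 h').ne h
  · exact (rank_lt_rank hv (hS.mem_bound _ _ hv).2 h').ne' h

/-- A variable of the bag `i + 1` that precedes `v` appeared no later than `v`, hence no later than
the bag `i`, so by the interval property it is already in the bag `i`. New variables are thus ranked
behind the old ones. This is the reason for sorting by first appearance. -/
theorem rank_succ_le {a : ℕ} (hS : S.Valid a) {i v : ℕ} (hv : S.mem i v = true) :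
    S.rank (i + 1) v ≤ S.rank i v := by
  refine card_le_card fun u hu => ?_
  simp only [mem_filter] at hu ⊢
  refine ⟨hu.1, ?_, hu.2.2⟩
  have h1 := (first_spec hS hv).2
  have h2 := first_spec hS hu.2.1
  exact hS.interval u (S.first u) i (i + 1) (by have := hu.2.2; unfold Before at this; omega)
    (by omega) h2.1 hu.2.1

theorem home_spec {a : ℕ} (hS : S.Valid a) {j : ℕ}
    (h : ∀ r < 3, ∀ r' < 3, ∃ i, S.mem i (S.var j r) = true ∧ S.mem i (S.var j r') = true)
    {r : ℕ} (hr : r < 3) : S.mem (S.home j) (S.var j r) = true := by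
  obtain ⟨r', hr', e⟩ := exists_mem_eq_sup (range 3) ⟨0, by simp⟩ fun r => S.first (S.var j r)
  have hle : S.first (S.var j r) ≤ S.home j :=
    le_sup (f := fun r => S.first (S.var j r)) (mem_range.2 hr)
  rw [home, maxBelow, e] at hle ⊢
  obtain ⟨i, h1, h2⟩ := h r hr r' (mem_range.1 hr')
  exact mem_first hS h1 h2 hle

theorem home_le (j : ℕ) : S.home j ≤ S.m := by
  unfold home maxBelow
  exact Finset.sup_le fun _ _ => first_le_m _

theorem place_injective {a : ℕ} (hS : S.Valid a) {i u v : ℕ}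
    (hu : S.mem i u = true) (hv : S.mem i v = true) (h : S.place p i u = S.place p i v) : u = v :=
  rank_injective hS hu hv (by unfold place at h; omega)

theorem place_div {a : ℕ} (hS : S.Valid a) (hp : p.Valid) (i v : ℕ) :
    S.place p i v / (S.blocks p * p.t) = i := by
  have := rank_lt hS hp i v
  rw [place, mul_comm i, Nat.mul_add_div (by omega), Nat.div_eq_of_lt this, add_zero]

/-- There is a solution for the sequence of places. -/
def PlaceSat (S : Src) (p : Params) : Prop :=
  ∃ y : ℕ → ℕ, (∀ x, y x < p.a) ∧
    ∀ j < S.numC' p, ∃ r < 3, ¬ Match p.a (S.value p j r) (y (S.pos p j r))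

/-- Each place takes the value of the variable that has a copy there, which is unique by
`place_injective`; idle places take `0`. -/
theorem placeSat_of_sat (hS : S.Valid p.a) (hp : p.Valid) (h : S.Sat p.a) : S.PlaceSat p := by
  classical
  obtain ⟨col, hcol, hC⟩ := h
  have ha : 0 < p.a := by have := hp.two_le_a; omega
  set y : ℕ → ℕ := fun x =>
    if h : ∃ v, S.mem (x / (S.blocks p * p.t)) v = true ∧
      S.place p (x / (S.blocks p * p.t)) v = x then col h.choose else 0 with hy
  have hyv : ∀ i v, S.mem i v = true → y (S.place p i v) = col v := by
    intro i v hv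
    have hex : ∃ u, S.mem (S.place p i v / (S.blocks p * p.t)) u = true ∧
        S.place p (S.place p i v / (S.blocks p * p.t)) u = S.place p i v := by
      rw [place_div hS hp]
      exact ⟨v, hv, rfl⟩
    simp only [hy]
    rw [dif_pos hex]
    congr 1
    have := hex.choose_spec
    generalize hex.choose = u at this
    rw [place_div hS hp] at this
    exact place_injective hS this.1 hv this.2
  refine ⟨y, fun x => ?_, fun j _ => ?_⟩
  · simp only [hy]
    split_ifs with h
    · exact hcol _ (hS.mem_bound _ _ h.choose_spec.1).2
    · exact ha
  · by_cases hj : j < S.numC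
    · obtain ⟨r, hr, hm⟩ := hC j hj
      refine ⟨r, hr, ?_⟩
      rcases hS.scope j hj with h | h
      · exact absurd (Or.inr (h r hr)) hm
      · simp only [value, pos, hj, if_true]
        rwa [hyv _ _ (home_spec hS h hr)]
    · by_cases hl : S.Link p (j - S.numC)
      · by_contra hcon
        push Not at hcon
        have h0 := hcon 0 (by omega)
        have h1 := hcon 1 (by omega)
        simp only [value, pos, hj, hl, if_false, if_true, true_and, lt_irrefl, Nat.one_pos] at h0 h1
        rw [hyv _ _ hl.2.1] at h0
        rw [hyv _ _ hl.2.2] at h1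
        have b0 := Nat.mod_lt (j - S.numC) ha
        have b1 := Nat.mod_lt ((j - S.numC) / p.a) ha
        have := hl.1
        unfold Match at h0 h1
        omega
      -- Without a link the prescribed value is `a + 1`, which is neither a value of `y` nor the
      -- wildcard `a`, so the constraint holds trivially.
      · refine ⟨0, by omega, ?_⟩
        simp only [value, hj, hl, if_false, Match]
        have : y (S.pos p j 0) < p.a := by
          simp only [hy]
          split_ifs with h
          · exact hcol _ (hS.mem_bound _ _ h.choose_spec.1).2
          · exact ha
        omega

/-- The ties carry the value of a variable from the bag of its first appearance to every later bag
that contains it, so reading it off at the first appearance is consistent with all constraints. -/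
theorem sat_of_placeSat (hS : S.Valid p.a) (hp : p.Valid) (h : S.PlaceSat p) : S.Sat p.a := by
  obtain ⟨y, hy, hC⟩ := h
  have ha : 0 < p.a := by have := hp.two_le_a; omega
  have step : ∀ i v, S.mem i v = true → S.mem (i + 1) v = true →
      y (S.place p i v) = y (S.place p (i + 1) v) := by
    intro i v h1 h2
    by_contra hne
    have hv := (hS.mem_bound _ _ h1).2
    have hi := (hS.mem_bound _ _ h1).1
    set c := y (S.place p i v) with hc
    set c' := y (S.place p (i + 1) v) with hc'
    have hca : c < p.a := hy _
    have hca' : c' < p.a := hy _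
    -- The number of the tie that forbids exactly the two differing values `c` and `c'`.
    set j := ((i * S.n + v) * p.a + c') * p.a + c with hj
    have e1 : j % p.a = c := by
      rw [hj, mul_comm, Nat.mul_add_mod, Nat.mod_eq_of_lt hca]
    have e2 : j / p.a = (i * S.n + v) * p.a + c' := by
      rw [hj, mul_comm, Nat.mul_add_div ha, Nat.div_eq_of_lt hca, add_zero]
    have e3 : j / p.a % p.a = c' := by
      rw [e2, mul_comm, Nat.mul_add_mod, Nat.mod_eq_of_lt hca']
    have e4 : j / p.a / p.a = i * S.n + v := by
      rw [e2, mul_comm, Nat.mul_add_div ha, Nat.div_eq_of_lt hca', add_zero]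
    have e5 : S.eqVar p j = v := by
      rw [eqVar, e4, mul_comm, Nat.mul_add_mod, Nat.mod_eq_of_lt hv]
    have e6 : S.eqBag p j = i := by
      rw [eqBag, e4, mul_comm, Nat.mul_add_div (by omega), Nat.div_eq_of_lt hv, add_zero]
    have hlink : S.Link p j := by
      refine ⟨?_, ?_, ?_⟩
      · rw [e1, e3]
        exact hne
      · rwa [e5, e6]
      · rwa [e5, e6]
    have hlt : j < S.m * S.n * p.a * p.a := by
      have h1 : i * S.n + v < S.m * S.n := by
        calc i * S.n + v < (i + 1) * S.n := by rw [Nat.succ_mul]; omega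
          _ ≤ S.m * S.n := Nat.mul_le_mul_right _ hi
      have h2 : (i * S.n + v) * p.a + c' < S.m * S.n * p.a := by
        calc (i * S.n + v) * p.a + c' < (i * S.n + v + 1) * p.a := by
              rw [Nat.succ_mul]
              omega
          _ ≤ _ := Nat.mul_le_mul_right _ h1
      calc j < ((i * S.n + v) * p.a + c' + 1) * p.a := by
            rw [hj, Nat.succ_mul _ p.a]
            omega
        _ ≤ _ := Nat.mul_le_mul_right _ h2
    obtain ⟨r, hr, hm⟩ := hC (S.numC + j) (by unfold numC'; omega)
    apply hm
    simp only [value, pos, Nat.not_lt.2 (Nat.le_add_right S.numC j), if_false,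
      Nat.add_sub_cancel_left, hlink, if_true, true_and, e1, e3, e5, e6]
    split_ifs
    · exact Or.inl hc'
    · exact Or.inl hc
  have all : ∀ d v, S.mem (S.first v + d) v = true → S.mem (S.first v) v = true →
      y (S.place p (S.first v + d) v) = y (S.place p (S.first v) v) := by
    intro d v
    induction d with
    | zero => intros; rfl
    | succ d ih =>
      intro h1 h2
      have h3 := hS.interval v _ (S.first v + d) _ (by omega) (by omega) h2 h1
      rw [← ih h3 h2]
      exact (step _ _ h3 h1).symm
  refine ⟨fun v => y (S.place p (S.first v) v), fun v _ => hy _, fun j hj => ?_⟩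
  obtain ⟨r, hr, hm⟩ := hC j (by unfold numC'; omega)
  refine ⟨r, hr, fun hmm => hm ?_⟩
  simp only [value, pos, hj, if_true]
  rcases hS.scope j hj with h | h
  · exact Or.inr (h r hr)
  · have h1 := home_spec hS h hr
    have h2 := first_spec hS h1
    have := all (S.home j - S.first (S.var j r)) (S.var j r)
      (by rwa [Nat.add_sub_cancel' h2.2]) h2.1
    rw [Nat.add_sub_cancel' h2.2] at this
    rwa [this]

/-! ### Windows of consecutive blocks -/

theorem place_block {a : ℕ} (hS : S.Valid a) (hp : p.Valid) (i v : ℕ) :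
    i * S.blocks p ≤ S.place p i v / p.t ∧ S.place p i v / p.t < i * S.blocks p + S.blocks p := by
  have h := rank_lt hS hp i v
  have e : S.place p i v / p.t = i * S.blocks p + S.rank i v / p.t := by
    rw [place, show i * (S.blocks p * p.t) = p.t * (i * S.blocks p) by ring,
      Nat.mul_add_div hp.t_pos]
  have := (Nat.div_lt_iff_lt_mul hp.t_pos).2 h
  rw [e]
  exact ⟨Nat.le_add_right _ _, Nat.add_lt_add_left this _⟩

theorem blocks_pos : 0 < S.blocks p := Nat.succ_pos _

/-- An original constraint stays within the blocks of its home bag. For a tie, the copy in the next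
bag lies in a later block, and by `rank_succ_le` it is at most `S.blocks p` blocks away; this costs
the one extra block of the window. -/
theorem win_le {a : ℕ} (hS : S.Valid a) (hp : p.Valid) (j r : ℕ) :
    S.win p j ≤ S.pos p j r / p.t ∧ S.pos p j r / p.t ≤ S.win p j + S.blocks p := by
  unfold win pos
  by_cases hj : j < S.numC
  · simp only [hj, if_true]
    have := place_block hS hp (S.home j) (S.var j r)
    omega
  · simp only [hj, if_false]
    by_cases hl : S.Link p (j - S.numC) ∧ 0 < r
    · simp only [hl, and_self, if_true]
      set i := S.eqBag p (j - S.numC)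
      set v := S.eqVar p (j - S.numC)
      have h1 := place_block hS hp i v
      have h2 := place_block hS hp (i + 1) v
      have h3 : S.rank (i + 1) v ≤ S.rank i v := rank_succ_le hS hl.1.2.1
      have h4 : S.place p (i + 1) v ≤ S.place p i v + p.t * S.blocks p := by
        unfold place
        rw [Nat.succ_mul, mul_comm p.t]
        omega
      have h5 := Nat.div_le_div_right (c := p.t) h4
      rw [Nat.add_mul_div_left _ _ hp.t_pos] at h5
      rw [Nat.succ_mul] at h2
      omega
    · simp only [hl, if_false]
      omega

/-- The factor is `S.m + 1` rather than `S.m` because the home of a constraint that always fails can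
be `S.m`. -/
theorem win_lt (hS : S.Valid p.a) (hp : p.Valid) {j : ℕ} (hj : j < S.numC' p) :
    S.win p j < (S.m + 1) * S.blocks p := by
  have hJ := S.blocks_pos (p := p)
  unfold win
  split_ifs with h
  · exact Nat.mul_lt_mul_of_pos_right (Nat.lt_succ_of_le (home_le j)) hJ
  · have h1 := (place_block hS hp (S.eqBag p (j - S.numC)) (S.eqVar p (j - S.numC))).2
    have h2 : S.eqBag p (j - S.numC) < S.m := by
      unfold numC' at hj
      have h3 : j - S.numC < S.m * S.n * p.a * p.a := by omega
      rw [eqBag]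
      rcases Nat.eq_zero_or_pos S.n with hn | hn
      · simp [hn] at h3
      · rw [Nat.div_lt_iff_lt_mul hn, Nat.div_lt_iff_lt_mul (by have := hp.two_le_a; omega),
          Nat.div_lt_iff_lt_mul (by have := hp.two_le_a; omega)]
        exact h3
    have h3 := Nat.mul_le_mul_right (S.blocks p) h2
    rw [Nat.succ_mul] at h3 ⊢
    omega

end Src

/-! ### Changing the alphabet -/

/-- The number with the given digits. -/
def fromDigits (b q : ℕ) (f : ℕ → ℕ) : ℕ := ∑ i ∈ range q, f i * b ^ i

theorem fromDigits_lt {b q : ℕ} {f : ℕ → ℕ} (hf : ∀ i, f i < b) : fromDigits b q f < b ^ q := by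
  induction q with
  | zero => simp [fromDigits]
  | succ q ih =>
    rw [fromDigits, sum_range_succ, ← fromDigits, pow_succ]
    have h : f q + 1 ≤ b := hf q
    have := Nat.mul_le_mul_right (b ^ q) h
    rw [Nat.succ_mul] at this
    rw [mul_comm (b ^ q)]
    omega

theorem digit_fromDigits {b q : ℕ} {f : ℕ → ℕ} (hf : ∀ i, f i < b) {i : ℕ} (hi : i < q) :
    digit b (fromDigits b q f) i = f i := by
  have hb : 0 < b := (Nat.zero_le _).trans_lt (hf 0)
  induction q with
  | zero => omega
  | succ q ih =>
    rw [fromDigits, sum_range_succ, ← fromDigits]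
    rcases Nat.lt_succ_iff_lt_or_eq.1 hi with h | rfl
    · rw [digit, show f q * b ^ q = b ^ i * (b * (f q * b ^ (q - i - 1))) by
        rw [show b ^ q = b ^ (i + 1 + (q - i - 1)) by congr 1; omega, pow_add, pow_succ]; ring,
        Nat.add_mul_div_left _ _ (by positivity), Nat.add_mul_mod_self_left, ← digit, ih h]
    · rw [digit, mul_comm, Nat.add_mul_div_left _ _ (by positivity),
        Nat.div_eq_of_lt (fromDigits_lt hf), zero_add, Nat.mod_eq_of_lt (hf _)]

theorem digit_lt {b : ℕ} (hb : 0 < b) (x i : ℕ) : digit b x i < b := Nat.mod_lt _ hb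

theorem eq_of_digit_eq {b q x y : ℕ} (hx : x < b ^ q) (hy : y < b ^ q)
    (h : ∀ i < q, digit b x i = digit b y i) : x = y := by
  induction q generalizing x y with
  | zero => simp at hx hy; omega
  | succ q ih =>
    have h0 := h 0 (by omega)
    simp only [digit, pow_zero, Nat.div_one] at h0
    have hd := ih (x := x / b) (y := y / b) (Nat.div_lt_of_lt_mul (by rwa [← pow_succ']))
      (Nat.div_lt_of_lt_mul (by rwa [← pow_succ'])) fun i hi => by
        have := h (i + 1) (by omega)
        simpa only [digit, pow_succ', ← Nat.div_div_eq_div_mul] using this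
    rw [← Nat.div_add_mod x b, ← Nat.div_add_mod y b, hd, h0]

/-! ### Constraints on the digits of three blocks -/

namespace Src

variable (S : Src) (p : Params)

/-- The constraints over the new alphabet are numbered by a constraint over the old alphabet and
three blocks of `q` values. -/
def numE : ℕ := S.numC' p * (p.b ^ p.q) ^ 3

/-- The constraint over the old alphabet. -/
def cons (e : ℕ) : ℕ := e / (p.b ^ p.q) ^ 3

/-- The values in the block number `r`. -/
def code (e r : ℕ) : ℕ := digit (p.b ^ p.q) e r

/-- The constraint `e` is not vacuous. -/
def Live (e : ℕ) : Prop :=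
  ∀ r < 3, Match p.a (S.value p (cons p e) r) (digit p.a (code p e r) (S.pos p (cons p e) r % p.t))

instance : DecidablePred (S.Live p) := fun _ => Nat.decidableBallLT _ _

/-- The variables in the constraint `e`. -/
def litVar (e r : ℕ) : ℕ := S.pos p (cons p e) (r / p.q) / p.t * p.q + r % p.q

/-- The values in the constraint `e`. -/
def litVal (e r : ℕ) : ℕ := digit p.b (code p e (r / p.q)) (r % p.q)

/-- There is a solution over the new alphabet. -/
def DigitSat : Prop :=
  ∃ x : ℕ → ℕ, (∀ v, x v < p.b) ∧
    ∀ e < S.numE p, S.Live p e → ∃ r < 3 * p.q, x (S.litVar p e r) ≠ litVal p e r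

variable {S p}

/-- A block of `t` values is a number below `a ^ t ≤ b ^ q`, so it can be rewritten with `q` digits
in base `b`. If all digits agreed with the pattern of a live constraint, the blocks would have the
listed contents, and these violate the underlying constraint. -/
theorem digitSat_of_placeSat (hp : p.Valid) (h : S.PlaceSat p) : S.DigitSat p := by
  obtain ⟨y, hy, hC⟩ := h
  have hb : 0 < p.b := by have := hp.two_le_b; omega
  set σ : ℕ → ℕ := fun B => fromDigits p.a p.t fun o => y (B * p.t + o) with hσ
  have hσlt : ∀ B, σ B < p.b ^ p.q := fun B => (fromDigits_lt fun _ => hy _).trans_le hp.pow_le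
  refine ⟨fun v => digit p.b (σ (v / p.q)) (v % p.q), fun v => digit_lt hb _ _, ?_⟩
  intro e he hlive
  by_contra hcon
  push Not at hcon
  obtain ⟨r, hr, hm⟩ := hC (cons p e) (Nat.div_lt_of_lt_mul (by rwa [mul_comm, ← numE]))
  apply hm
  have hQ : 0 < p.b ^ p.q := by positivity
  have hcode : σ (S.pos p (cons p e) r / p.t) = code p e r := by
    refine eq_of_digit_eq (hσlt _) (digit_lt hQ _ _) fun l hl => ?_
    have := hcon (r * p.q + l) (by
      calc r * p.q + l < (r + 1) * p.q := by rw [Nat.succ_mul]; omega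
        _ ≤ 3 * p.q := Nat.mul_le_mul_right _ hr)
    have e1 : (r * p.q + l) / p.q = r := by
      rw [mul_comm, Nat.mul_add_div hp.q_pos, Nat.div_eq_of_lt hl, add_zero]
    have e2 : (r * p.q + l) % p.q = l := by
      rw [mul_comm, Nat.mul_add_mod, Nat.mod_eq_of_lt hl]
    rw [litVal, litVar, e1, e2] at this
    rwa [mul_comm (_ / p.t), Nat.mul_add_div hp.q_pos, Nat.div_eq_of_lt hl, add_zero,
      Nat.mul_add_mod, Nat.mod_eq_of_lt hl] at this
  have := hlive r hr
  rw [← hcode, hσ] at this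
  beta_reduce at this
  rw [digit_fromDigits (fun _ => hy _) (Nat.mod_lt _ hp.t_pos), mul_comm,
    Nat.div_add_mod] at this
  exact this

/-- Every number below `b ^ q` is decoded by its lowest `t` digits in base `a`, even if it is not
below `a ^ t`; no content of a block needs to be excluded. -/
theorem placeSat_of_digitSat (hp : p.Valid) (h : S.DigitSat p) : S.PlaceSat p := by
  obtain ⟨x, hx, hC⟩ := h
  have ha : 0 < p.a := by have := hp.two_le_a; omega
  have hb : 0 < p.b := by have := hp.two_le_b; omega
  have hQ : 0 < p.b ^ p.q := by positivity
  set σ : ℕ → ℕ := fun B => fromDigits p.b p.q fun l => x (B * p.q + l) with hσ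
  have hσlt : ∀ B, σ B < p.b ^ p.q := fun B => fromDigits_lt fun _ => hx _
  refine ⟨fun z => digit p.a (σ (z / p.t)) (z % p.t), fun z => digit_lt ha _ _, ?_⟩
  intro j hj
  by_contra hcon
  push Not at hcon
  set τ := fromDigits (p.b ^ p.q) 3 fun r => σ (S.pos p j r / p.t) with hτ
  have hτlt : τ < (p.b ^ p.q) ^ 3 := fromDigits_lt fun _ => hσlt _
  -- The constraint that forbids the present contents of the three blocks of `j`. It is live because
  -- `j` is violated, so some digit would have to differ from itself.
  set e := (p.b ^ p.q) ^ 3 * j + τ with he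
  have e1 : cons p e = j := by
    rw [cons, he, Nat.mul_add_div (by positivity), Nat.div_eq_of_lt hτlt, add_zero]
  have e2 : ∀ r < 3, code p e r = σ (S.pos p j r / p.t) := by
    intro r hr
    rw [← digit_fromDigits (b := p.b ^ p.q) (q := 3)
      (f := fun r => σ (S.pos p j r / p.t)) (fun _ => hσlt _) hr, ← hτ, code, digit, digit, he,
      show (p.b ^ p.q) ^ 3 * j = (p.b ^ p.q) ^ r * ((p.b ^ p.q) * ((p.b ^ p.q) ^ (2 - r) * j)) by
        rw [show (p.b ^ p.q) ^ 3 = (p.b ^ p.q) ^ (r + 1 + (2 - r)) by congr 1; omega, pow_add,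
          pow_succ]
        ring, Nat.mul_add_div (by positivity), Nat.mul_add_mod]
  obtain ⟨r, hr, hne⟩ := hC e (by
    calc e < (p.b ^ p.q) ^ 3 * (j + 1) := by rw [Nat.mul_succ]; omega
      _ ≤ (p.b ^ p.q) ^ 3 * S.numC' p := Nat.mul_le_mul_left _ hj
      _ = S.numE p := mul_comm _ _) (by
    intro r hr
    rw [e1, e2 r hr]
    exact hcon r hr)
  apply hne
  have hr' : r / p.q < 3 := (Nat.div_lt_iff_lt_mul hp.q_pos).2 hr
  rw [litVar, litVal, e1, e2 _ hr', hσ]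
  beta_reduce
  rw [digit_fromDigits (fun _ => hx _) (Nat.mod_lt _ hp.q_pos)]

theorem sat_iff_digitSat (hS : S.Valid p.a) (hp : p.Valid) : S.Sat p.a ↔ S.DigitSat p :=
  ⟨fun h => digitSat_of_placeSat hp (placeSat_of_sat hS hp h),
    fun h => sat_of_placeSat hS hp (placeSat_of_digitSat hp h)⟩

end Src

/-! ### Lists of numbers and lists over `Fin n` -/

def finBags (n : ℕ) (B : List (List ℕ)) (h : ∀ l ∈ B, ∀ v ∈ l, v < n) : List (List (Fin n)) :=
  B.pmap (fun l hl => l.pmap Fin.mk hl) h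

theorem encodeList_pmap {α β : Type} {P : α → Prop} (f : ∀ x, P x → β) (l : List α)
    (h : ∀ x ∈ l, P x) (g : β → List ℕ) (g' : α → List ℕ) (hg : ∀ x hx, g (f x hx) = g' x) :
    encodeList g (l.pmap f h) = encodeList g' l := by
  unfold encodeList
  rw [List.length_pmap]
  congr 1
  induction l with
  | nil => rfl
  | cons x l ih =>
    rw [List.pmap, List.flatMap_cons, List.flatMap_cons, hg,
      ih fun y hy => h y (List.mem_cons_of_mem x hy)]

theorem encodeBags_finBags (n : ℕ) (B : List (List ℕ)) (h : ∀ l ∈ B, ∀ v ∈ l, v < n) :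
    encodeBags (finBags n B h) = encodeList (encodeList fun v => [v]) B :=
  encodeList_pmap _ _ _ _ _ fun _ _ => encodeList_pmap _ _ _ _ _ fun _ _ => rfl

theorem getD_bagSets {n : ℕ} (B : List (List (Fin n))) (i : ℕ) :
    (bagSets B).getD i ∅ = (B.getD i []).toFinset :=
  List.getD_map B [] List.toFinset

theorem mem_finBags_getD {n : ℕ} {B : List (List ℕ)} {h : ∀ l ∈ B, ∀ v ∈ l, v < n} {i : ℕ}
    {v : Fin n} : v ∈ (bagSets (finBags n B h)).getD i ∅ ↔ (v : ℕ) ∈ B.getD i [] := by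
  rw [getD_bagSets, List.mem_toFinset]
  have : (finBags n B h).getD i [] = (B.getD i []).pmap Fin.mk (by
      intro v hv
      by_cases hi : i < B.length
      · rw [List.getD_eq_getElem _ _ hi] at hv
        exact h _ (List.getElem_mem hi) v hv
      · rw [List.getD_eq_default _ _ (by omega)] at hv
        simp at hv) := by
    by_cases hi : i < B.length
    · simp [finBags, hi]
    · simp [finBags, hi]
  rw [this]
  simp only [List.mem_pmap]
  constructor
  · rintro ⟨a, ha, rfl⟩
    exact ha
  · intro hv
    exact ⟨v, hv, rfl⟩

theorem mem_bagSets {n : ℕ} {B : List (List (Fin n))} {P : Finset (Fin n) → Prop} :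
    (∃ b ∈ bagSets B, P b) ↔ ∃ i < B.length, P ((bagSets B).getD i ∅) := by
  constructor
  · rintro ⟨b, hb, h⟩
    obtain ⟨i, hi, rfl⟩ := List.mem_iff_getElem.1 hb
    refine ⟨i, by simpa [bagSets] using hi, ?_⟩
    rwa [List.getD_eq_getElem _ _ hi]
  · rintro ⟨i, hi, h⟩
    have hi' : i < (bagSets B).length := by simpa [bagSets] using hi
    rw [List.getD_eq_getElem _ _ hi'] at h
    exact ⟨_, List.getElem_mem hi', h⟩

theorem isPathDecomposition_finBags {n : ℕ} {B : List (List ℕ)} {h : ∀ l ∈ B, ∀ v ∈ l, v < n}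
    {G : SimpleGraph (Fin n)} (cover : ∀ v < n, ∃ i < B.length, v ∈ B.getD i [])
    (edge : ∀ v w : Fin n, G.Adj v w → ∃ i < B.length, (v : ℕ) ∈ B.getD i [] ∧ (w : ℕ) ∈ B.getD i [])
    (interval : ∀ v i j l, i ≤ j → j ≤ l → v ∈ B.getD i [] → v ∈ B.getD l [] → v ∈ B.getD j []) :
    IsPathDecomposition G (bagSets (finBags n B h)) := by
  have hlen : (finBags n B h).length = B.length := List.length_pmap ..
  refine ⟨fun v => ?_, fun v w hvw => ?_, fun v i j l hij hjl => ?_⟩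
  · rw [mem_bagSets (P := fun b => v ∈ b), hlen]
    simpa only [mem_finBags_getD] using cover v v.2
  · rw [mem_bagSets (P := fun b => v ∈ b ∧ w ∈ b), hlen]
    simpa only [mem_finBags_getD] using edge v w hvw
  · simpa only [mem_finBags_getD] using interval v i j l hij hjl

theorem foldr_max_le {l : List ℕ} {c : ℕ} (h : ∀ x ∈ l, x ≤ c) : l.foldr max 0 ≤ c := by
  induction l with
  | nil => exact Nat.zero_le _
  | cons x l ih =>
    exact max_le (h x List.mem_cons_self) (ih fun y hy => h y (List.mem_cons_of_mem x hy))

theorem le_foldr_max {l : List ℕ} {x : ℕ} (h : x ∈ l) : x ≤ l.foldr max 0 := by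
  induction l with
  | nil => simp at h
  | cons y l ih =>
    rcases List.mem_cons.1 h with rfl | h
    · exact le_max_left _ _
    · exact (ih h).trans (le_max_right _ _)

theorem width_finBags_le {n c : ℕ} {B : List (List ℕ)} {h : ∀ l ∈ B, ∀ v ∈ l, v < n}
    (hc : ∀ l ∈ B, l.length ≤ c) : width (bagSets (finBags n B h)) ≤ c := by
  refine (Nat.sub_le _ _).trans (foldr_max_le ?_)
  intro x hx
  simp only [bagSets, finBags, List.map_pmap, List.mem_pmap] at hx
  obtain ⟨l, hl, rfl⟩ := hx
  exact (List.toFinset_card_le _).trans ((List.length_pmap ..).le.trans (hc l hl))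

theorem card_le_width {n : ℕ} (B : List (List (Fin n))) (i : ℕ) :
    ((bagSets B).getD i ∅).card ≤ width (bagSets B) + 1 := by
  by_cases hi : i < (bagSets B).length
  · rw [List.getD_eq_getElem _ _ hi]
    have : ((bagSets B)[i]).card ≤ ((bagSets B).map Finset.card).foldr max 0 :=
      le_foldr_max (List.mem_map_of_mem (List.getElem_mem hi))
    unfold width
    omega
  · rw [List.getD_eq_default _ _ (by omega)]
    simp

/-- Passing to colorings of all natural numbers lets the construction be analysed without `Fin`; the
values outside the graph are irrelevant. -/
theorem exists_col_of_colorable {n k : ℕ} (hk : 0 < k) {E : List (Fin n × Fin n)}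
    (hE : ∀ e ∈ E, e.1 ≠ e.2) (h : (edgeGraph E).Colorable k) :
    ∃ col : ℕ → ℕ, (∀ v, col v < k) ∧ ∀ e ∈ E, col e.1 ≠ col e.2 := by
  obtain ⟨C⟩ := h
  refine ⟨fun v => if h : v < n then C ⟨v, h⟩ else 0, fun v => ?_, fun e he => ?_⟩
  · beta_reduce
    split_ifs
    · exact (C _).2
    · exact hk
  · have : (edgeGraph E).Adj e.1 e.2 :=
      (SimpleGraph.fromRel_adj _ _ _).2 ⟨hE e he, Or.inl he⟩
    have := C.valid this
    simpa [Fin.ext_iff] using this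

theorem colorable_of_col {n k : ℕ} {E : List (Fin n × Fin n)} {col : ℕ → ℕ}
    (hcol : ∀ v < n, col v < k) (hC : ∀ e ∈ E, col e.1 ≠ col e.2) : (edgeGraph E).Colorable k := by
  refine ⟨SimpleGraph.Coloring.mk (fun v => ⟨col v, hcol v v.2⟩) ?_⟩
  intro v w hvw
  rw [edgeGraph, SimpleGraph.fromRel_adj] at hvw
  simp only [ne_eq, Fin.mk.injEq]
  rcases hvw.2 with h | h
  · exact hC _ h
  · exact (hC _ h).symm

theorem exists_val_of_satisfiable {n : ℕ} {φ : CNF n} (h : φ.Satisfiable) :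
    ∃ x : ℕ → ℕ, (∀ v, x v < 2) ∧ ∀ C ∈ φ, ∃ l ∈ C, x l.1 = l.2.toNat := by
  obtain ⟨σ, hσ⟩ := h
  refine ⟨fun v => if h : v < n then (σ ⟨v, h⟩).toNat else 0, fun v => ?_, fun C hC => ?_⟩
  · beta_reduce
    split_ifs
    · exact Bool.toNat_lt _
    · omega
  · obtain ⟨l, hl, h⟩ := hσ C hC
    exact ⟨l, hl, by simp [← h]⟩

theorem satisfiable_of_val {n : ℕ} {φ : CNF n} {x : ℕ → ℕ}
    (h : ∀ C ∈ φ, ∃ l ∈ C, x l.1 = l.2.toNat) : φ.Satisfiable := by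
  refine ⟨fun v => decide (x v = 1), fun C hC => ?_⟩
  obtain ⟨l, hl, h⟩ := h C hC
  refine ⟨l, hl, ?_⟩
  beta_reduce
  rw [h]
  cases l.2 <;> rfl

/-! ### The path decomposition of the constructed instance -/

namespace Src

variable (S : Src) (p : Params)

/-- The number of windows. -/
def numWin : ℕ := (S.m + 1) * S.blocks p

/-- The number of vertices for the digits. -/
def numPrim : ℕ := (S.numWin p + S.blocks p) * p.q

/-- The number of auxiliary vertices for one constraint. -/
def auxSize : ℕ := 12 * p.q + 1

def numVert : ℕ := p.b + S.numPrim p + S.numE p * auxSize p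

/-- The vertex for the digit `v`. The vertices below `b` are reserved for a palette. -/
def prim (v : ℕ) : ℕ := p.b + v

/-- The auxiliary vertices for the constraint `e`. -/
def aux (e i : ℕ) : ℕ := p.b + S.numPrim p + e * auxSize p + i

/-- Palette, window, and the auxiliary vertices of a single constraint. Only the middle term depends
on the width of the source. -/
def bagLen : ℕ := p.b + (S.blocks p + 1) * p.q + auxSize p

/-- Each window is repeated so that every constraint has a bag of its own for its auxiliary
vertices. The additional repetition keeps the sequence of bags nonempty when there are no
constraints. -/
def numBags : ℕ := S.numWin p * (S.numE p + 1)

/-- Unused entries are padded with the palette vertex `0`. All bags then have the same length as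
lists, and repetitions do not matter for the sets. -/
def bagEntry (f i : ℕ) : ℕ :=
  if i < p.b then i else
    if i < p.b + (S.blocks p + 1) * p.q then f / (S.numE p + 1) * p.q + i else
      if f % (S.numE p + 1) < S.numE p ∧
          S.win p (cons p (f % (S.numE p + 1))) = f / (S.numE p + 1) then
        S.aux p (f % (S.numE p + 1)) (i - (p.b + (S.blocks p + 1) * p.q))
      else 0

def bagList : List (List ℕ) :=
  (List.range (S.numBags p)).map fun f => (List.range (S.bagLen p)).map (S.bagEntry p f)

variable {S p}

theorem bagList_getD (f : ℕ) (hf : f < S.numBags p) :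
    (S.bagList p).getD f [] = (List.range (S.bagLen p)).map (S.bagEntry p f) := by
  rw [bagList, List.getD_eq_getElem _ _ (by simpa using hf)]
  simp

theorem mem_bag_iff (hp : p.Valid) (f v : ℕ) : v ∈ (S.bagList p).getD f [] ↔ f < S.numBags p ∧
    (v < p.b ∨
      (p.b + f / (S.numE p + 1) * p.q ≤ v ∧
        v < p.b + f / (S.numE p + 1) * p.q + (S.blocks p + 1) * p.q) ∨
      ∃ e < S.numE p, ∃ i < auxSize p, f = S.win p (cons p e) * (S.numE p + 1) + e ∧
        v = S.aux p e i) := by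
  by_cases hf : f < S.numBags p
  swap
  · rw [List.getD_eq_default _ _ (by simpa [bagList] using hf)]
    simp [hf]
  rw [bagList_getD f hf]
  simp only [List.mem_map, List.mem_range, hf, true_and]
  have hb := hp.two_le_b
  have hA : 0 < auxSize p := Nat.succ_pos _
  constructor
  · rintro ⟨i, hi, rfl⟩
    unfold bagEntry
    split_ifs with h1 h2 h3
    · exact Or.inl h1
    · exact Or.inr (Or.inl ⟨by omega, by omega⟩)
    · refine Or.inr (Or.inr ⟨_, h3.1, i - (p.b + (S.blocks p + 1) * p.q), ?_, ?_, rfl⟩)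
      · unfold bagLen at hi
        omega
      · rw [h3.2, mul_comm, Nat.div_add_mod]
    · exact Or.inl (by omega)
  · rintro (h | h | ⟨e, he, i, hi, hfe, rfl⟩)
    · exact ⟨v, by unfold bagLen; omega, by simp [bagEntry, h]⟩
    · refine ⟨v - f / (S.numE p + 1) * p.q, by unfold bagLen; omega, ?_⟩
      unfold bagEntry
      rw [if_neg (by omega), if_pos (by omega)]
      omega
    · have e1 : f % (S.numE p + 1) = e := by
        rw [hfe, mul_comm, Nat.mul_add_mod, Nat.mod_eq_of_lt (by omega)]
      have e2 : f / (S.numE p + 1) = S.win p (cons p e) := by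
        rw [hfe, mul_comm, Nat.mul_add_div (by omega), Nat.div_eq_of_lt (by omega), add_zero]
      refine ⟨p.b + (S.blocks p + 1) * p.q + i, by unfold bagLen; omega, ?_⟩
      unfold bagEntry
      rw [if_neg (by omega), if_neg (by omega), if_pos (by rw [e1, e2]; exact ⟨he, rfl⟩), e1,
        Nat.add_sub_cancel_left]

theorem aux_lt {e i : ℕ} (he : e < S.numE p) (hi : i < auxSize p) : S.aux p e i < S.numVert p := by
  have := Nat.mul_le_mul_right (auxSize p) he
  rw [Nat.succ_mul] at this
  unfold aux numVert
  omega

theorem aux_inj {e i e' i' : ℕ} (hi : i < auxSize p) (hi' : i' < auxSize p)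
    (h : S.aux p e i = S.aux p e' i') : e = e' ∧ i = i' := by
  have h' : auxSize p * e + i = auxSize p * e' + i' := by
    unfold aux at h
    rw [mul_comm _ e, mul_comm _ e']
    omega
  have he : e = e' := by
    have := congrArg (· / auxSize p) h'
    simpa [Nat.mul_add_div (show 0 < auxSize p from Nat.succ_pos _), Nat.div_eq_of_lt hi,
      Nat.div_eq_of_lt hi'] using this
  subst he
  exact ⟨rfl, by omega⟩

theorem cons_lt {e : ℕ} (he : e < S.numE p) : cons p e < S.numC' p :=
  Nat.div_lt_of_lt_mul (by rwa [mul_comm, ← numE])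

theorem bag_lt (hp : p.Valid) (f v : ℕ) (h : v ∈ (S.bagList p).getD f []) : v < S.numVert p := by
  rw [mem_bag_iff hp] at h
  obtain ⟨hf, h | h | ⟨e, he, i, hi, _, rfl⟩⟩ := h
  · unfold numVert
    omega
  · have : f / (S.numE p + 1) < S.numWin p := Nat.div_lt_of_lt_mul (by rwa [mul_comm, ← numBags])
    have h1 : f / (S.numE p + 1) * p.q + (S.blocks p + 1) * p.q ≤ S.numPrim p := by
      rw [numPrim, ← Nat.add_mul]
      exact Nat.mul_le_mul_right _ (by omega)
    unfold numVert
    omega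
  · exact aux_lt he hi

theorem bagList_lt (hp : p.Valid) : ∀ l ∈ S.bagList p, ∀ v ∈ l, v < S.numVert p := by
  intro l hl v hv
  obtain ⟨f, hf, rfl⟩ := List.mem_iff_getElem.1 hl
  exact bag_lt hp f v (by rwa [List.getD_eq_getElem _ _ hf])

theorem length_bagList : (S.bagList p).length = S.numBags p := by simp [bagList]

theorem numWin_pos : 0 < S.numWin p := Nat.mul_pos (Nat.succ_pos _) blocks_pos

theorem win_cons_lt (hS : S.Valid p.a) (hp : p.Valid) {e : ℕ} (he : e < S.numE p) :
    S.win p (cons p e) * (S.numE p + 1) + e < S.numBags p := by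
  have h := win_lt hS hp (cons_lt he)
  have := Nat.mul_le_mul_right (S.numE p + 1) h
  rw [Nat.succ_mul] at this
  unfold numBags numWin
  omega

theorem bag_cover (hS : S.Valid p.a) (hp : p.Valid) :
    ∀ v < S.numVert p, ∃ f < (S.bagList p).length, v ∈ (S.bagList p).getD f [] := by
  intro v hv
  rw [length_bagList]
  have key : ∀ f, f < S.numBags p → (v < p.b ∨
      (p.b + f / (S.numE p + 1) * p.q ≤ v ∧
        v < p.b + f / (S.numE p + 1) * p.q + (S.blocks p + 1) * p.q) ∨
      ∃ e < S.numE p, ∃ i < auxSize p, f = S.win p (cons p e) * (S.numE p + 1) + e ∧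
        v = S.aux p e i) → ∃ f < S.numBags p, v ∈ (S.bagList p).getD f [] :=
    fun f hf h => ⟨f, hf, (mem_bag_iff hp f v).2 ⟨hf, h⟩⟩
  by_cases h1 : v < p.b
  · exact key 0 (Nat.mul_pos numWin_pos (Nat.succ_pos _)) (Or.inl h1)
  by_cases h2 : v < p.b + S.numPrim p
  · have hB : (v - p.b) / p.q < S.numWin p + S.blocks p :=
      (Nat.div_lt_iff_lt_mul hp.q_pos).2 (by unfold numPrim at h2; omega)
    have hv' := Nat.div_add_mod (v - p.b) p.q
    have hm := Nat.mod_lt (v - p.b) hp.q_pos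
    rw [mul_comm] at hv'
    generalize (v - p.b) / p.q = B at hB hv'
    have hW := S.numWin_pos (p := p)
    -- A block normally opens its own window; the final `S.blocks p` blocks lie in the last window.
    refine key (min B (S.numWin p - 1) * (S.numE p + 1)) ?_ (Or.inr (Or.inl ?_))
    · exact Nat.mul_lt_mul_of_pos_right (by omega) (Nat.succ_pos _)
    · rw [Nat.mul_div_cancel _ (Nat.succ_pos _)]
      have h3 : min B (S.numWin p - 1) * p.q ≤ B * p.q := Nat.mul_le_mul_right _ (min_le_left _ _)
      have h4 : (B + 1) * p.q ≤ min B (S.numWin p - 1) * p.q + (S.blocks p + 1) * p.q := by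
        rw [← Nat.add_mul]
        exact Nat.mul_le_mul_right _ (by omega)
      rw [Nat.succ_mul] at h4
      omega
  · set w := v - (p.b + S.numPrim p) with hw
    have hA : 0 < auxSize p := Nat.succ_pos _
    have he : w / auxSize p < S.numE p :=
      (Nat.div_lt_iff_lt_mul hA).2 (by unfold numVert at hv; omega)
    refine key _ (win_cons_lt hS hp he) (Or.inr (Or.inr ⟨_, he, _, Nat.mod_lt w hA, rfl, ?_⟩))
    have := Nat.div_add_mod w (auxSize p)
    rw [mul_comm] at this
    unfold aux
    omega

/-- Palette vertices lie in all bags, a digit lies in a range of consecutive windows, and an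
auxiliary vertex lies in a single bag. -/
theorem bag_interval (hp : p.Valid) : ∀ v i j l, i ≤ j → j ≤ l → v ∈ (S.bagList p).getD i [] →
    v ∈ (S.bagList p).getD l [] → v ∈ (S.bagList p).getD j [] := by
  intro v i j l hij hjl hi hl
  rw [mem_bag_iff hp] at hi hl ⊢
  obtain ⟨-, hi⟩ := hi
  obtain ⟨hlb, hl⟩ := hl
  refine ⟨by omega, ?_⟩
  have bound : ∀ f < S.numBags p,
      p.b + f / (S.numE p + 1) * p.q + (S.blocks p + 1) * p.q ≤ p.b + S.numPrim p := by
    intro f hf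
    have : f / (S.numE p + 1) < S.numWin p := Nat.div_lt_of_lt_mul (by rwa [mul_comm, ← numBags])
    rw [numPrim, Nat.add_assoc, ← Nat.add_mul]
    exact Nat.add_le_add_left (Nat.mul_le_mul_right _ (by omega)) _
  rcases hi with hi | hi | ⟨e, he, x, hx, hfe, rfl⟩
  · exact Or.inl hi
  · rcases hl with hl | hl | ⟨e, he, x, hx, hfe, rfl⟩
    · exact Or.inl hl
    · have h1 := Nat.mul_le_mul_right p.q (Nat.div_le_div_right (c := S.numE p + 1) hij)
      have h2 := Nat.mul_le_mul_right p.q (Nat.div_le_div_right (c := S.numE p + 1) hjl)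
      exact Or.inr (Or.inl ⟨by omega, by omega⟩)
    · have := bound i (by omega)
      unfold aux at hi
      omega
  · rcases hl with hl | hl | ⟨e', he', x', hx', hfe', h⟩
    · unfold aux at hl
      omega
    · have := bound l hlb
      unfold aux at hl
      omega
    · obtain ⟨rfl, rfl⟩ := aux_inj hx hx' h
      exact Or.inr (Or.inr ⟨e, he, x, hx, by omega, rfl⟩)

/-- The vertices that are involved in the gadget for the constraint `e`. -/
def Near (S : Src) (p : Params) (e v : ℕ) : Prop :=
  v < p.b ∨ (∃ r < 3 * p.q, v = prim p (S.litVar p e r)) ∨ ∃ i < auxSize p, v = S.aux p e i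

/-- One bag holds the entire gadget of a constraint: the window contains its digits by `win_le`.
Edges and clauses are thereby covered at once. -/
theorem near_mem (hS : S.Valid p.a) (hp : p.Valid) {e v : ℕ} (he : e < S.numE p)
    (h : S.Near p e v) :
    v ∈ (S.bagList p).getD (S.win p (cons p e) * (S.numE p + 1) + e) [] := by
  rw [mem_bag_iff hp]
  refine ⟨win_cons_lt hS hp he, ?_⟩
  rcases h with h | ⟨r, hr, rfl⟩ | ⟨i, hi, rfl⟩
  · exact Or.inl h
  · right; left
    have e2 : (S.win p (cons p e) * (S.numE p + 1) + e) / (S.numE p + 1) = S.win p (cons p e) := by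
      rw [mul_comm, Nat.mul_add_div (by omega), Nat.div_eq_of_lt (by omega), add_zero]
    rw [e2, prim, litVar]
    have h1 := win_le hS hp (cons p e) (r / p.q)
    have h2 := Nat.mul_le_mul_right p.q h1.1
    have h3 := Nat.mul_le_mul_right p.q h1.2
    have h4 := Nat.mod_lt r hp.q_pos
    rw [Nat.add_mul] at h3
    rw [Nat.succ_mul]
    omega
  · exact Or.inr (Or.inr ⟨e, he, i, hi, rfl, rfl⟩)

theorem near_lt (hS : S.Valid p.a) (hp : p.Valid) {e v : ℕ} (he : e < S.numE p)
    (h : S.Near p e v) : v < S.numVert p :=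
  bag_lt hp _ _ (near_mem hS hp he h)

theorem prim_lt (hS : S.Valid p.a) (hp : p.Valid) {e r : ℕ} (he : e < S.numE p)
    (hr : r < 3 * p.q) : S.litVar p e r < S.numPrim p := by
  have h := near_mem hS hp he (Or.inr (Or.inl ⟨r, hr, rfl⟩))
  rw [mem_bag_iff hp] at h
  obtain ⟨hf, h⟩ := h
  have h1 := win_lt hS hp (cons_lt he)
  have h2 := (win_le hS hp (cons p e) (r / p.q)).2
  have h3 := Nat.mod_lt r hp.q_pos
  have h4 : (S.pos p (cons p e) (r / p.q) / p.t + 1) * p.q ≤ S.numPrim p := by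
    rw [numPrim, numWin]
    exact Nat.mul_le_mul_right _ (by omega)
  rw [Nat.succ_mul] at h4
  rw [litVar]
  omega

end Src

theorem mem_flatMap_range {β : Type} {n : ℕ} {g : ℕ → List β} {x : β} :
    x ∈ (List.range n).flatMap g ↔ ∃ i < n, x ∈ g i := by
  simp [List.mem_flatMap]

theorem mem_map_range {β : Type} {n : ℕ} {g : ℕ → β} {x : β} :
    x ∈ (List.range n).map g ↔ ∃ i < n, g i = x := by
  simp

namespace Src

/-! ### The constructed graph -/

/-- A color other than `x` and `2`. -/
def otherColor (x : ℕ) : ℕ := if x = 0 then 1 else 0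

variable (S : Src) (p : Params)

/-- The colors that are allowed at the auxiliary vertices. Those with `i % 4 = 0` form the chain
that transports the color `0`; it cannot do so through all the steps of a constraint. -/
def Allowed (e i c : ℕ) : Prop :=
  (i % 4 = 0 ∧ c < 2 ∧ (i = 0 → c = 0) ∧ (i = 12 * p.q → S.Live p e → c = 1)) ∨
  (i % 4 = 1 ∧ (c = litVal p e (i / 4) ∨ c = otherColor (litVal p e (i / 4)))) ∨
  (i % 4 = 2 ∧ (c = otherColor (litVal p e (i / 4)) ∨ c = 2)) ∨
  (i % 4 = 3 ∧ c < 3)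

instance (e i c : ℕ) : Decidable (S.Allowed p e i c) := inferInstanceAs (Decidable (_ ∨ _))

/-- The palette edge `(0, 1)` fills the degenerate indices here and in `listEdge`. The number of
list entries is then given by a simple formula, which is needed because the length is written before
the list. -/
def palEdge (f : ℕ) : ℕ × ℕ := if f / p.b ≠ f % p.b then (f / p.b, f % p.b) else (0, 1)

def listEdge (e f : ℕ) : ℕ × ℕ :=
  if S.Allowed p e (f / p.b) (f % p.b) then (0, 1) else (f % p.b, S.aux p e (f / p.b))

/-- The step `r` passes from the chain vertex `4 * r` to `4 * r + 4`. If the digit matches, `4 * r +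
1` must take the other color, so `4 * r + 2` takes `2` and `4 * r + 3` takes `0` or `1`; hence both
chain vertices carry the same color. If it does not match, `4 * r + 3` can take `2`, and the chain
is cut. -/
def stepEdge (e f : ℕ) : ℕ × ℕ :=
  if f % 5 = 0 then (prim p (S.litVar p e (f / 5)), S.aux p e (4 * (f / 5) + 1)) else
  if f % 5 = 1 then (S.aux p e (4 * (f / 5) + 1), S.aux p e (4 * (f / 5) + 2)) else
  if f % 5 = 2 then (S.aux p e (4 * (f / 5) + 2), S.aux p e (4 * (f / 5) + 3)) else
  if f % 5 = 3 then (S.aux p e (4 * (f / 5) + 3), S.aux p e (4 * (f / 5))) else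
    (S.aux p e (4 * (f / 5) + 3), S.aux p e (4 * (f / 5) + 4))

def edgeList : List (ℕ × ℕ) :=
  (List.range (p.b * p.b)).map (palEdge p) ++
    (List.range (S.numE p)).flatMap fun e =>
      (List.range (auxSize p * p.b)).map (S.listEdge p e) ++
        (List.range (15 * p.q)).map (S.stepEdge p e)

variable {S p}

theorem mem_edgeList {x : ℕ × ℕ} : x ∈ S.edgeList p ↔
    (∃ f < p.b * p.b, palEdge p f = x) ∨ ∃ e < S.numE p,
      (∃ f < auxSize p * p.b, S.listEdge p e f = x) ∨ ∃ f < 15 * p.q, S.stepEdge p e f = x := by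
  simp only [edgeList, List.mem_append, mem_map_range, mem_flatMap_range]

theorem forall_mul_lt {m k : ℕ} {P : ℕ → ℕ → Prop} :
    (∀ f < m * k, P (f / k) (f % k)) ↔ ∀ i < m, ∀ j < k, P i j := by
  constructor
  · intro h i hi j hj
    have := h (k * i + j) (by
      have := Nat.mul_le_mul_left k hi
      rw [Nat.mul_succ, mul_comm k m] at this
      omega)
    rwa [Nat.mul_add_div (by omega), Nat.div_eq_of_lt hj, add_zero, Nat.mul_add_mod,
      Nat.mod_eq_of_lt hj] at this
  · intro h f hf
    have hk : 0 < k := Nat.pos_of_ne_zero fun h => by simp [h] at hf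
    exact h _ ((Nat.div_lt_iff_lt_mul hk).2 hf) _ (Nat.mod_lt _ hk)

/-- The edges of the graph, in terms of a predicate on pairs. -/
theorem forall_edgeList {P : ℕ → ℕ → Prop} (h01 : P 0 1) : (∀ x ∈ S.edgeList p, P x.1 x.2) ↔
    (∀ c < p.b, ∀ c' < p.b, c ≠ c' → P c c') ∧ ∀ e < S.numE p,
      (∀ i < auxSize p, ∀ c < p.b, ¬ S.Allowed p e i c → P c (S.aux p e i)) ∧
      ∀ r < 3 * p.q, P (prim p (S.litVar p e r)) (S.aux p e (4 * r + 1)) ∧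
        P (S.aux p e (4 * r + 1)) (S.aux p e (4 * r + 2)) ∧
        P (S.aux p e (4 * r + 2)) (S.aux p e (4 * r + 3)) ∧
        P (S.aux p e (4 * r + 3)) (S.aux p e (4 * r)) ∧
        P (S.aux p e (4 * r + 3)) (S.aux p e (4 * r + 4)) := by
  have h1 : (∀ x ∈ S.edgeList p, P x.1 x.2) ↔
      (∀ f < p.b * p.b, P (palEdge p f).1 (palEdge p f).2) ∧ ∀ e < S.numE p,
        (∀ f < auxSize p * p.b, P (S.listEdge p e f).1 (S.listEdge p e f).2) ∧
        ∀ f < 15 * p.q, P (S.stepEdge p e f).1 (S.stepEdge p e f).2 := by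
    constructor
    · intro h
      refine ⟨fun f hf => h _ (mem_edgeList.2 (Or.inl ⟨f, hf, rfl⟩)), fun e he =>
        ⟨fun f hf => h _ (mem_edgeList.2 (Or.inr ⟨e, he, Or.inl ⟨f, hf, rfl⟩⟩)), fun f hf =>
          h _ (mem_edgeList.2 (Or.inr ⟨e, he, Or.inr ⟨f, hf, rfl⟩⟩))⟩⟩
    · rintro ⟨h1, h2⟩ x hx
      rcases mem_edgeList.1 hx with ⟨f, hf, rfl⟩ | ⟨e, he, ⟨f, hf, rfl⟩ | ⟨f, hf, rfl⟩⟩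
      · exact h1 f hf
      · exact (h2 e he).1 f hf
      · exact (h2 e he).2 f hf
  rw [h1]
  refine and_congr ?_ (forall₂_congr fun e he => and_congr ?_ ?_)
  · rw [← forall_mul_lt (P := fun c c' => c ≠ c' → P c c')]
    refine forall₂_congr fun f _ => ?_
    unfold palEdge
    split_ifs with h
    · exact ⟨fun hP _ => hP, fun hP => hP h⟩
    · exact ⟨fun _ h' => absurd h' h, fun _ => h01⟩
  · rw [← forall_mul_lt (P := fun i c => ¬ S.Allowed p e i c → P c (S.aux p e i))]
    refine forall₂_congr fun f _ => ?_
    unfold listEdge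
    split_ifs with h
    · exact ⟨fun _ h' => absurd h h', fun _ => h01⟩
    · exact ⟨fun hP _ => hP, fun hP => hP h⟩
  · constructor
    · intro h r hr
      have h0 := h (5 * r) (by omega)
      have h1 := h (5 * r + 1) (by omega)
      have h2 := h (5 * r + 2) (by omega)
      have h3 := h (5 * r + 3) (by omega)
      have h4 := h (5 * r + 4) (by omega)
      simp only [stepEdge, show 5 * r % 5 = 0 by omega, show (5 * r + 1) % 5 = 1 by omega,
        show (5 * r + 2) % 5 = 2 by omega, show (5 * r + 3) % 5 = 3 by omega,
        show (5 * r + 4) % 5 = 4 by omega, show 5 * r / 5 = r by omega,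
        show (5 * r + 1) / 5 = r by omega, show (5 * r + 2) / 5 = r by omega,
        show (5 * r + 3) / 5 = r by omega, show (5 * r + 4) / 5 = r by omega, if_true,
        OfNat.ofNat_ne_zero, one_ne_zero, if_false, OfNat.ofNat_ne_one,
        Nat.reduceEqDiff] at h0 h1 h2 h3 h4
      exact ⟨h0, h1, h2, h3, h4⟩
    · intro h f hf
      have := h (f / 5) (by omega)
      unfold stepEdge
      split_ifs
      · exact this.1
      · exact this.2.1
      · exact this.2.2.1
      · exact this.2.2.2.1
      · exact this.2.2.2.2

theorem near_palette {e v : ℕ} (h : v < p.b) : S.Near p e v := Or.inl h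

theorem near_aux {e i : ℕ} (h : i < auxSize p) : S.Near p e (S.aux p e i) := Or.inr (Or.inr ⟨i, h, rfl⟩)

theorem near_prim {e r : ℕ} (h : r < 3 * p.q) : S.Near p e (prim p (S.litVar p e r)) :=
  Or.inr (Or.inl ⟨r, h, rfl⟩)

theorem le_aux (e i : ℕ) : p.b + S.numPrim p ≤ S.aux p e i := by
  unfold aux
  omega

theorem edge_near (hS : S.Valid p.a) (hp : p.Valid) : ∀ x ∈ S.edgeList p, x.1 ≠ x.2 ∧
    ((x.1 < p.b ∧ x.2 < p.b) ∨ ∃ e < S.numE p, S.Near p e x.1 ∧ S.Near p e x.2) := by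
  have hb := hp.two_le_b
  have hA : auxSize p = 12 * p.q + 1 := rfl
  refine (forall_edgeList (P := fun u v => u ≠ v ∧
    ((u < p.b ∧ v < p.b) ∨ ∃ e < S.numE p, S.Near p e u ∧ S.Near p e v))
    ⟨by omega, Or.inl ⟨by omega, by omega⟩⟩).2 ⟨fun c hc c' hc' hne => ⟨hne, Or.inl ⟨hc, hc'⟩⟩,
      fun e he => ⟨fun i hi c hc _ => ⟨?_, Or.inr ⟨e, he, near_palette hc, near_aux hi⟩⟩,
        fun r hr => ⟨⟨?_, Or.inr ⟨e, he, near_prim hr, near_aux (by omega)⟩⟩,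
          ⟨?_, Or.inr ⟨e, he, near_aux (by omega), near_aux (by omega)⟩⟩,
          ⟨?_, Or.inr ⟨e, he, near_aux (by omega), near_aux (by omega)⟩⟩,
          ⟨?_, Or.inr ⟨e, he, near_aux (by omega), near_aux (by omega)⟩⟩,
          ⟨?_, Or.inr ⟨e, he, near_aux (by omega), near_aux (by omega)⟩⟩⟩⟩⟩
  · have := le_aux (S := S) (p := p) e i
    omega
  · have := le_aux (S := S) (p := p) e (4 * r + 1)
    have := prim_lt hS hp he hr
    unfold prim
    omega
  all_goals
    unfold aux
    omega

theorem colorable_of_digitSat (hS : S.Valid p.a) (hp : p.Valid) (h3 : 3 ≤ p.b)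
    (h : S.DigitSat p) :
    ∃ col : ℕ → ℕ, (∀ v, col v < p.b) ∧ ∀ x ∈ S.edgeList p, col x.1 ≠ col x.2 := by
  obtain ⟨x, hx, hC⟩ := h
  classical
  set ok : ℕ → ℕ → Prop := fun e r => x (S.litVar p e r) = litVal p e r with hok
  -- The chain of a live constraint carries `0` up to its first mismatch and `1` afterwards; for
  -- other constraints it carries `0` throughout.
  set z : ℕ → ℕ → ℕ := fun e r => if S.Live p e ∧ ∃ r₀ < r, ¬ ok e r₀ then 1 else 0 with hz
  set g : ℕ → ℕ → ℕ := fun e i =>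
    if i % 4 = 0 then z e (i / 4) else
    if i % 4 = 1 then
      if ok e (i / 4) then otherColor (litVal p e (i / 4)) else litVal p e (i / 4) else
    if i % 4 = 2 then if ok e (i / 4) then 2 else otherColor (litVal p e (i / 4)) else
      if ok e (i / 4) then 1 - z e (i / 4) else 2 with hg
  set col : ℕ → ℕ := fun v => if v < p.b then v else if v < p.b + S.numPrim p then x (v - p.b) else
    g ((v - (p.b + S.numPrim p)) / auxSize p) ((v - (p.b + S.numPrim p)) % auxSize p) with hcol
  have hval : ∀ e r, litVal p e r < p.b := fun e r => digit_lt (by omega) _ _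
  have hother : ∀ y, otherColor y < 2 ∧ otherColor y ≠ y := by
    intro y
    unfold otherColor
    split_ifs <;> omega
  have hz2 : ∀ e r, z e r < 2 := by
    intro e r
    simp only [hz]
    split_ifs <;> omega
  have hgb : ∀ e i, g e i < p.b := by
    intro e i
    simp only [hg]
    have := hz2 e (i / 4)
    have := hval e (i / 4)
    have := hother (litVal p e (i / 4))
    split_ifs <;> omega
  have hpal : ∀ c < p.b, col c = c := fun c hc => by simp [hcol, hc]
  have hprim : ∀ e < S.numE p, ∀ r < 3 * p.q,
      col (prim p (S.litVar p e r)) = x (S.litVar p e r) := by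
    intro e he r hr
    have := prim_lt hS hp he hr
    simp only [hcol, prim]
    rw [if_neg (by omega), if_pos (by omega), Nat.add_sub_cancel_left]
  have haux : ∀ e, ∀ i < auxSize p, col (S.aux p e i) = g e i := by
    intro e i hi
    have h1 := le_aux (S := S) (p := p) e i
    have h2 : S.aux p e i - (p.b + S.numPrim p) = auxSize p * e + i := by
      unfold aux
      rw [mul_comm e]
      omega
    simp only [hcol]
    rw [if_neg (by omega), if_neg (by omega), h2, Nat.mul_add_div (by omega),
      Nat.div_eq_of_lt hi, add_zero, Nat.mul_add_mod, Nat.mod_eq_of_lt hi]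
  refine ⟨col, fun v => ?_, ?_⟩
  · simp only [hcol]
    split_ifs
    · assumption
    · exact hx _
    · exact hgb _ _
  rw [forall_edgeList (P := fun u v => col u ≠ col v) (by
    rw [hpal 0 (by omega), hpal 1 (by omega)]
    omega)]
  refine ⟨fun c hc c' hc' hne => by rwa [hpal c hc, hpal c' hc'], fun e he => ⟨?_, ?_⟩⟩
  · intro i hi c hc hal hcc
    apply hal
    rw [hpal c hc, haux e i hi] at hcc
    subst hcc
    have h1 := hz2 e (i / 4)
    have h2 := hother (litVal p e (i / 4))
    have h4 : i % 4 < 4 := Nat.mod_lt _ (by omega)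
    unfold Allowed
    simp only [hg]
    by_cases i0 : i % 4 = 0
    · left
      rw [if_pos i0]
      refine ⟨i0, h1, fun h => ?_, fun h hl => ?_⟩
      · simp [hz, h]
      · obtain ⟨r, hr, hne⟩ := hC e he hl
        simp only [hz]
        rw [if_pos ⟨hl, r, by omega, hne⟩]
    right
    rw [if_neg i0]
    by_cases i1 : i % 4 = 1
    · left
      rw [if_pos i1]
      refine ⟨i1, ?_⟩
      split_ifs <;> simp
    right
    rw [if_neg i1]
    by_cases i2 : i % 4 = 2
    · left
      rw [if_pos i2]
      refine ⟨i2, ?_⟩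
      split_ifs <;> simp
    right
    rw [if_neg i2]
    refine ⟨by omega, ?_⟩
    split_ifs <;> omega
  · intro r hr
    have hA : auxSize p = 12 * p.q + 1 := rfl
    rw [hprim e he r hr, haux e _ (by omega), haux e _ (by omega), haux e _ (by omega),
      haux e _ (by omega), haux e _ (by omega)]
    have hzr := hz2 e r
    have hzs : ok e r → z e (r + 1) = z e r := by
      intro hk
      simp only [hz]
      congr 2
      apply propext
      constructor
      · rintro ⟨r₀, h0, h1⟩
        refine ⟨r₀, lt_of_le_of_ne (Nat.lt_succ_iff.1 h0) ?_, h1⟩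
        rintro rfl
        exact h1 hk
      · rintro ⟨r₀, h0, h1⟩
        exact ⟨r₀, by omega, h1⟩
    have hz1 := hz2 e (r + 1)
    have ho := hother (litVal p e r)
    simp only [hg, show 4 * r % 4 = 0 by omega, show (4 * r + 1) % 4 = 1 by omega,
      show (4 * r + 2) % 4 = 2 by omega, show (4 * r + 3) % 4 = 3 by omega,
      show (4 * r + 4) % 4 = 0 by omega, show 4 * r / 4 = r by omega,
      show (4 * r + 1) / 4 = r by omega, show (4 * r + 2) / 4 = r by omega,
      show (4 * r + 3) / 4 = r by omega, show (4 * r + 4) / 4 = r + 1 by omega, if_true,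
      OfNat.ofNat_ne_zero, one_ne_zero, if_false, OfNat.ofNat_ne_one, Nat.reduceEqDiff]
    by_cases hk : ok e r
    · have hk' : x (S.litVar p e r) = litVal p e r := hk
      have := hzs hk
      simp only [hk, if_true]
      omega
    · have hk' : x (S.litVar p e r) ≠ litVal p e r := hk
      simp only [hk, if_false]
      omega

/-- The palette is a clique on `b` vertices, so its coloring is a permutation of the colors; its
inverse makes the palette vertex `c` have the color `c`. -/
theorem exists_normal_coloring {b : ℕ} {col : ℕ → ℕ} (hb : ∀ v, col v < b)
    (hpal : ∀ c < b, ∀ c' < b, c ≠ c' → col c ≠ col c') :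
    ∃ π : ℕ → ℕ, (∀ y < b, π y < b) ∧ (∀ y < b, ∀ y' < b, π y = π y' → y = y') ∧
      ∀ c < b, π (col c) = c := by
  let f : Fin b → Fin b := fun c => ⟨col c, hb c⟩
  have hf : Function.Injective f := by
    intro c c' h
    by_contra hne
    exact hpal c c.2 c' c'.2 (fun h' => hne (Fin.ext h')) (Fin.mk.inj_iff.1 h)
  let F := Equiv.ofBijective f (Finite.injective_iff_bijective.1 hf)
  refine ⟨fun y => if h : y < b then F.symm ⟨y, h⟩ else 0, ?_, ?_, ?_⟩
  · intro y hy
    simp only [hy, dif_pos]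
    exact (F.symm _).2
  · intro y hy y' hy' h
    simp only [hy, hy', dif_pos] at h
    have := F.symm.injective (Fin.ext h)
    simpa using this
  · intro c hc
    simp only [hb c, dif_pos]
    have : F ⟨c, hc⟩ = ⟨col c, hb c⟩ := rfl
    rw [← this, Equiv.symm_apply_apply]

/-- After renaming colors, the edges to the palette become color lists. If all digits matched, the
color `0` would travel through the whole chain to a vertex where a live constraint admits only `1`.
-/
theorem digitSat_of_colorable (h3 : 3 ≤ p.b)
    (h : ∃ col : ℕ → ℕ, (∀ v, col v < p.b) ∧ ∀ x ∈ S.edgeList p, col x.1 ≠ col x.2) :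
    S.DigitSat p := by
  obtain ⟨col₀, hb₀, hE₀⟩ := h
  have h01 : col₀ 0 ≠ col₀ 1 :=
    hE₀ (0, 1) (mem_edgeList.2 (Or.inl ⟨0, by positivity, by simp [palEdge]⟩))
  obtain ⟨π, hπ, hinj, hπc⟩ := exists_normal_coloring hb₀
    ((forall_edgeList (P := fun u v => col₀ u ≠ col₀ v) h01).1 hE₀).1
  obtain ⟨col, hcol⟩ : ∃ col, col = fun v => π (col₀ v) := ⟨_, rfl⟩
  have hb : ∀ v, col v < p.b := fun v => by rw [hcol]; exact hπ _ (hb₀ v)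
  have hpal : ∀ c < p.b, col c = c := fun c hc => by rw [hcol]; exact hπc c hc
  have hE : ∀ x ∈ S.edgeList p, col x.1 ≠ col x.2 := by
    intro x hx h
    rw [hcol] at h
    exact hE₀ x hx (hinj _ (hb₀ _) _ (hb₀ _) h)
  rw [forall_edgeList (P := fun u v => col u ≠ col v) (by
    rw [hpal 0 (by omega), hpal 1 (by omega)]
    omega)] at hE
  refine ⟨fun v => col (prim p v), fun v => hb _, fun e he hl => ?_⟩
  by_contra hcon
  push Not at hcon
  obtain ⟨hlist, hstep⟩ := hE.2 e he
  have hal : ∀ i < auxSize p, S.Allowed p e i (col (S.aux p e i)) := by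
    intro i hi
    by_contra hn
    exact hlist i hi _ (hb _) hn (hpal _ (hb _))
  have hA : auxSize p = 12 * p.q + 1 := rfl
  have hz : ∀ r ≤ 3 * p.q, col (S.aux p e (4 * r)) = 0 := by
    intro r
    induction r with
    | zero =>
      intro _
      have := hal 0 (by omega)
      unfold Allowed at this
      rw [mul_zero]
      omega
    | succ r ih =>
      intro hr
      have hzr := ih (by omega)
      have hx := hcon r (by omega)
      obtain ⟨s1, s2, s3, s4, s5⟩ := hstep r (by omega)
      have a1 := hal (4 * r + 1) (by omega)
      have a2 := hal (4 * r + 2) (by omega)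
      have a3 := hal (4 * r + 3) (by omega)
      have a4 := hal (4 * r + 4) (by omega)
      have ho : otherColor (litVal p e r) < 2 := by
        unfold otherColor
        split_ifs <;> omega
      unfold Allowed at a1 a2 a3 a4
      rw [show (4 * r + 1) / 4 = r by omega] at a1
      rw [show (4 * r + 2) / 4 = r by omega] at a2
      rw [show 4 * (r + 1) = 4 * r + 4 by ring]
      beta_reduce at hx
      omega
  have h0 := hz (3 * p.q) le_rfl
  have := hal (12 * p.q) (by omega)
  rw [show 4 * (3 * p.q) = 12 * p.q by ring] at h0
  unfold Allowed at this
  rw [h0] at this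
  have hl' : 12 * p.q = 12 * p.q → S.Live p e → (0 : ℕ) = 1 := by
    rcases this with h | h | h | h
    · exact h.2.2.2
    · omega
    · omega
    · omega
  exact absurd (hl' rfl hl) (by omega)

/-! ### The constructed formula -/

variable (S p)

def headClauses (e : ℕ) : List (List (ℕ × Bool)) :=
  [[(S.aux p e 0, false)], [(S.aux p e (12 * p.q), decide (S.Live p e))]]

/-- For `b = 2` the middle literal says that the digit differs from the pattern. The clause is an
implication: if the chain is false before a matching digit, it is false after it. -/
def stepClause (e r : ℕ) : List (ℕ × Bool) :=
  [(S.aux p e (4 * r), true), (prim p (S.litVar p e r), decide (litVal p e r = 0)),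
    (S.aux p e (4 * r + 4), false)]

def clauseList : List (List (ℕ × Bool)) :=
  (List.range (S.numE p)).flatMap fun e =>
    S.headClauses p e ++ (List.range (3 * p.q)).map (S.stepClause p e)

variable {S p}

theorem mem_clauseList {C : List (ℕ × Bool)} : C ∈ S.clauseList p ↔
    ∃ e < S.numE p, C = [(S.aux p e 0, false)] ∨
      C = [(S.aux p e (12 * p.q), decide (S.Live p e))] ∨ ∃ r < 3 * p.q, S.stepClause p e r = C := by
  simp only [clauseList, headClauses, mem_flatMap_range, List.mem_append, List.mem_cons,
    List.not_mem_nil, or_false, mem_map_range, or_assoc]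

theorem clause_near {C : List (ℕ × Bool)} (hC : C ∈ S.clauseList p) :
    C.length ≤ 3 ∧ ∃ e < S.numE p, ∀ l ∈ C, S.Near p e l.1 := by
  have hA : auxSize p = 12 * p.q + 1 := rfl
  obtain ⟨e, he, rfl | rfl | ⟨r, hr, rfl⟩⟩ := mem_clauseList.1 hC
  · refine ⟨by simp, e, he, fun l hl => ?_⟩
    rw [List.mem_singleton.1 hl]
    exact near_aux (by omega)
  · refine ⟨by simp, e, he, fun l hl => ?_⟩
    rw [List.mem_singleton.1 hl]
    exact near_aux (by omega)
  · refine ⟨by simp [stepClause], e, he, fun l hl => ?_⟩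
    simp only [stepClause, List.mem_cons, List.not_mem_nil, or_false] at hl
    rcases hl with rfl | rfl | rfl
    · exact near_aux (by omega)
    · exact near_prim hr
    · exact near_aux (by omega)

theorem clauseSat_of_digitSat (hS : S.Valid p.a) (hp : p.Valid) (h2 : p.b = 2)
    (h : S.DigitSat p) :
    ∃ x : ℕ → ℕ, (∀ v, x v < 2) ∧ ∀ C ∈ S.clauseList p, ∃ l ∈ C, x l.1 = l.2.toNat := by
  obtain ⟨x, hx, hC⟩ := h
  classical
  set ok : ℕ → ℕ → Prop := fun e r => x (S.litVar p e r) = litVal p e r with hok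
  set z : ℕ → ℕ → ℕ := fun e r => if S.Live p e ∧ ∃ r₀ < r, ¬ ok e r₀ then 1 else 0 with hz
  set y : ℕ → ℕ := fun v => if v < p.b + S.numPrim p then x (v - p.b) else
    z ((v - (p.b + S.numPrim p)) / auxSize p) ((v - (p.b + S.numPrim p)) % auxSize p / 4) with hy
  have hz2 : ∀ e r, z e r < 2 := by
    intro e r
    simp only [hz]
    split_ifs <;> omega
  have hprim : ∀ e < S.numE p, ∀ r < 3 * p.q,
      y (prim p (S.litVar p e r)) = x (S.litVar p e r) := by
    intro e he r hr
    have := prim_lt hS hp he hr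
    simp only [hy, prim]
    rw [if_pos (by omega), Nat.add_sub_cancel_left]
  have hA : auxSize p = 12 * p.q + 1 := rfl
  have haux : ∀ e, ∀ r ≤ 3 * p.q, y (S.aux p e (4 * r)) = z e r := by
    intro e r hr
    have h1 := le_aux (S := S) (p := p) e (4 * r)
    have h2 : S.aux p e (4 * r) - (p.b + S.numPrim p) = auxSize p * e + 4 * r := by
      unfold aux
      rw [mul_comm e]
      omega
    simp only [hy]
    rw [if_neg (by omega), h2, Nat.mul_add_div (by omega),
      Nat.div_eq_of_lt (by omega), add_zero, Nat.mul_add_mod, Nat.mod_eq_of_lt (by omega),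
      Nat.mul_div_cancel_left _ (by omega)]
  refine ⟨y, fun v => ?_, fun C hCm => ?_⟩
  · simp only [hy]
    split_ifs
    · rw [← h2]
      exact hx _
    · exact hz2 _ _
  obtain ⟨e, he, rfl | rfl | ⟨r, hr, rfl⟩⟩ := mem_clauseList.1 hCm
  · refine ⟨_, List.mem_singleton_self _, ?_⟩
    have := haux e 0 (by omega)
    rw [mul_zero] at this
    rw [this]
    simp [hz]
  · refine ⟨_, List.mem_singleton_self _, ?_⟩
    have := haux e (3 * p.q) le_rfl
    rw [show 4 * (3 * p.q) = 12 * p.q by ring] at this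
    rw [this]
    simp only [hz]
    by_cases hl : S.Live p e
    · obtain ⟨r, hr, hne⟩ := hC e he hl
      rw [if_pos ⟨hl, r, hr, hne⟩]
      simp [hl]
    · simp [hl]
  · simp only [stepClause, List.mem_cons, List.not_mem_nil, or_false, exists_eq_or_imp,
      exists_eq_left]
    rw [haux e r hr.le, hprim e he r hr, show 4 * r + 4 = 4 * (r + 1) by ring, haux e (r + 1) hr]
    by_cases hk : ok e r
    · have hzs : z e (r + 1) = z e r := by
        simp only [hz]
        congr 2
        apply propext
        constructor
        · rintro ⟨r₀, h0, h1⟩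
          refine ⟨r₀, lt_of_le_of_ne (Nat.lt_succ_iff.1 h0) ?_, h1⟩
          rintro rfl
          exact h1 hk
        · rintro ⟨r₀, h0, h1⟩
          exact ⟨r₀, by omega, h1⟩
      have := hz2 e r
      simp only [Bool.toNat_true, Bool.toNat_false]
      omega
    · right; left
      have h1 : x (S.litVar p e r) ≠ litVal p e r := hk
      have h2 := hx (S.litVar p e r)
      have h3 : litVal p e r < p.b := digit_lt (by omega) _ _
      by_cases h0 : litVal p e r = 0
      · simp only [h0, decide_true, Bool.toNat_true]
        omega
      · simp only [h0, decide_false, Bool.toNat_false]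
        omega

theorem digitSat_of_clauseSat (h2 : p.b = 2)
    (h : ∃ x : ℕ → ℕ, (∀ v, x v < 2) ∧ ∀ C ∈ S.clauseList p, ∃ l ∈ C, x l.1 = l.2.toNat) :
    S.DigitSat p := by
  obtain ⟨x, hx, hC⟩ := h
  refine ⟨fun v => x (prim p v), fun v => by rw [h2]; exact hx _, fun e he hl => ?_⟩
  by_contra hcon
  push Not at hcon
  have hz : ∀ r ≤ 3 * p.q, x (S.aux p e (4 * r)) = 0 := by
    intro r
    induction r with
    | zero =>
      intro _
      obtain ⟨l, hl, h⟩ := hC _ (mem_clauseList.2 ⟨e, he, Or.inl rfl⟩)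
      rw [List.mem_singleton.1 hl] at h
      simpa using h
    | succ r ih =>
      intro hr
      have hzr := ih (by omega)
      have hxr := hcon r (by omega)
      obtain ⟨l, hl, h⟩ := hC _ (mem_clauseList.2 ⟨e, he, Or.inr (Or.inr ⟨r, hr, rfl⟩)⟩)
      simp only [stepClause, List.mem_cons, List.not_mem_nil, or_false] at hl
      rcases hl with rfl | rfl | rfl
      · simp only [Bool.toNat_true] at h
        omega
      · beta_reduce at hxr
        simp only [hxr] at h
        by_cases h0 : litVal p e r = 0
        · simp [h0] at h
        · simp [h0] at h
      · exact h
  obtain ⟨l, hl', h⟩ := hC _ (mem_clauseList.2 ⟨e, he, Or.inr (Or.inl rfl)⟩)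
  rw [List.mem_singleton.1 hl'] at h
  have := hz (3 * p.q) le_rfl
  rw [show 4 * (3 * p.q) = 12 * p.q by ring] at this
  simp [this, hl] at h

end Src

/-! ### The constructed instances -/

theorem forall_mem_pmap {α β : Type} {P : α → Prop} {f : ∀ x, P x → β} {l : List α}
    {h : ∀ x ∈ l, P x} {Q : β → Prop} {Q' : α → Prop} (hQ : ∀ x hx, Q (f x hx) ↔ Q' x) :
    (∀ y ∈ l.pmap f h, Q y) ↔ ∀ x ∈ l, Q' x := by
  simp only [List.mem_pmap]
  constructor
  · intro H x hx
    exact (hQ x (h x hx)).1 (H _ ⟨x, hx, rfl⟩)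
  · rintro H _ ⟨x, hx, rfl⟩
    exact (hQ x _).2 (H x hx)

theorem exists_mem_pmap {α β : Type} {P : α → Prop} {f : ∀ x, P x → β} {l : List α}
    {h : ∀ x ∈ l, P x} {Q : β → Prop} {Q' : α → Prop} (hQ : ∀ x hx, Q (f x hx) ↔ Q' x) :
    (∃ y ∈ l.pmap f h, Q y) ↔ ∃ x ∈ l, Q' x := by
  simp only [List.mem_pmap]
  constructor
  · rintro ⟨_, ⟨x, hx, rfl⟩, H⟩
    exact ⟨x, hx, (hQ x _).1 H⟩
  · rintro ⟨x, hx, H⟩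
    exact ⟨_, ⟨x, hx, rfl⟩, (hQ x (h x hx)).2 H⟩

def finEdges (n : ℕ) (E : List (ℕ × ℕ)) (h : ∀ e ∈ E, e.1 < n ∧ e.2 < n) : List (Fin n × Fin n) :=
  E.pmap (fun e he => (⟨e.1, he.1⟩, ⟨e.2, he.2⟩)) h

def finClauses (n : ℕ) (F : List (List (ℕ × Bool))) (h : ∀ C ∈ F, ∀ l ∈ C, l.1 < n) : CNF n :=
  F.pmap (fun C hC => C.pmap (fun l hl => (⟨l.1, hl⟩, l.2)) hC) h

namespace Src

variable {S : Src} {p : Params}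

theorem edgeList_lt (hS : S.Valid p.a) (hp : p.Valid) :
    ∀ x ∈ S.edgeList p, x.1 < S.numVert p ∧ x.2 < S.numVert p := by
  intro x hx
  rcases (edge_near hS hp x hx).2 with h | ⟨e, he, h1, h2⟩
  · unfold numVert
    omega
  · exact ⟨near_lt hS hp he h1, near_lt hS hp he h2⟩

theorem clauseList_lt (hS : S.Valid p.a) (hp : p.Valid) :
    ∀ C ∈ S.clauseList p, ∀ l ∈ C, l.1 < S.numVert p := by
  intro C hC l hl
  obtain ⟨-, e, he, h⟩ := clause_near hC
  exact near_lt hS hp he (h l hl)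

theorem numBags_pos : 0 < S.numBags p := Nat.mul_pos numWin_pos (Nat.succ_pos _)

theorem decomposition_edges (hS : S.Valid p.a) (hp : p.Valid) :
    IsPathDecomposition (edgeGraph (finEdges _ (S.edgeList p) (edgeList_lt hS hp)))
      (bagSets (finBags _ (S.bagList p) (bagList_lt hp))) := by
  refine isPathDecomposition_finBags (bag_cover hS hp) ?_ (bag_interval hp)
  rw [length_bagList]
  have key : ∀ v w : Fin (S.numVert p), (v, w) ∈ finEdges _ (S.edgeList p) (edgeList_lt hS hp) →
      ∃ i < S.numBags p, (v : ℕ) ∈ (S.bagList p).getD i [] ∧ (w : ℕ) ∈ (S.bagList p).getD i [] := by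
    intro v w h
    simp only [finEdges, List.mem_pmap, Prod.mk.injEq] at h
    obtain ⟨x, hx, rfl, rfl⟩ := h
    rcases (edge_near hS hp x hx).2 with h | ⟨e, he, h1, h2⟩
    · exact ⟨0, numBags_pos, (mem_bag_iff hp _ _).2 ⟨numBags_pos, Or.inl h.1⟩,
        (mem_bag_iff hp _ _).2 ⟨numBags_pos, Or.inl h.2⟩⟩
    · exact ⟨_, win_cons_lt hS hp he, near_mem hS hp he h1, near_mem hS hp he h2⟩
  intro v w hvw
  rw [edgeGraph, SimpleGraph.fromRel_adj] at hvw
  rcases hvw.2 with h | h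
  · exact key v w h
  · obtain ⟨i, hi, h1, h2⟩ := key w v h
    exact ⟨i, hi, h2, h1⟩

theorem decomposition_clauses (hS : S.Valid p.a) (hp : p.Valid) :
    IsPathDecomposition (finClauses _ (S.clauseList p) (clauseList_lt hS hp)).primalGraph
      (bagSets (finBags _ (S.bagList p) (bagList_lt hp))) := by
  refine isPathDecomposition_finBags (bag_cover hS hp) ?_ (bag_interval hp)
  rw [length_bagList]
  have key : ∀ C ∈ finClauses _ (S.clauseList p) (clauseList_lt hS hp),
      ∃ i < S.numBags p, ∀ v b, (v, b) ∈ C → (v : ℕ) ∈ (S.bagList p).getD i [] := by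
    intro C hC
    simp only [finClauses, List.mem_pmap] at hC
    obtain ⟨C, hC, rfl⟩ := hC
    obtain ⟨-, e, he, h⟩ := clause_near hC
    refine ⟨_, win_cons_lt hS hp he, fun v b hv => ?_⟩
    simp only [List.mem_pmap, Prod.mk.injEq] at hv
    obtain ⟨l, hl, rfl, -⟩ := hv
    exact near_mem hS hp he (h l hl)
  intro v w hvw
  rw [CNF.primalGraph, SimpleGraph.fromRel_adj] at hvw
  rcases hvw.2 with ⟨C, hC, ⟨b, h1⟩, b', h2⟩ | ⟨C, hC, ⟨b, h1⟩, b', h2⟩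
  · obtain ⟨i, hi, h⟩ := key C hC
    exact ⟨i, hi, h _ _ h1, h _ _ h2⟩
  · obtain ⟨i, hi, h⟩ := key C hC
    exact ⟨i, hi, h _ _ h2, h _ _ h1⟩

/-- The constructed input of coloring. -/
def toColoring (hS : S.Valid p.a) (hp : p.Valid) : ColoringInstance where
  n := S.numVert p
  edges := finEdges _ (S.edgeList p) (edgeList_lt hS hp)
  bags := finBags _ (S.bagList p) (bagList_lt hp)
  loopless := by
    refine (forall_mem_pmap (Q' := fun x => x.1 ≠ x.2) fun x hx => ?_).2
      fun x hx => (edge_near hS hp x hx).1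
    simp
  decomposition := decomposition_edges hS hp

/-- The constructed input of satisfiability. -/
def toThreeSAT (hS : S.Valid p.a) (hp : p.Valid) : ThreeSATInstance where
  n := S.numVert p
  formula := finClauses _ (S.clauseList p) (clauseList_lt hS hp)
  bags := finBags _ (S.bagList p) (bagList_lt hp)
  arity := by
    refine (forall_mem_pmap (Q' := fun C => C.length ≤ 3) fun C hC => ?_).2
      fun C hC => (clause_near hC).1
    rw [List.length_pmap]
  decomposition := decomposition_clauses hS hp

variable (S p) in
def bagWord : List ℕ := encodeList (encodeList fun v => [v]) (S.bagList p)

variable (S p) in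
def coloringWord : List ℕ :=
  S.numVert p :: (encodeList (fun e => [e.1, e.2]) (S.edgeList p) ++ S.bagWord p)

variable (S p) in
def threeSATWord : List ℕ :=
  S.numVert p :: (encodeList (encodeList fun l => [l.1, l.2.toNat]) (S.clauseList p) ++ S.bagWord p)

theorem encode_toColoring (hS : S.Valid p.a) (hp : p.Valid) :
    (toColoring hS hp).encode = S.coloringWord p := by
  unfold ColoringInstance.encode coloringWord bagWord
  rw [← encodeBags_finBags _ _ (bagList_lt hp)]
  congr 2
  exact encodeList_pmap _ _ _ _ _ fun _ _ => rfl

theorem encode_toThreeSAT (hS : S.Valid p.a) (hp : p.Valid) :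
    (toThreeSAT hS hp).encode = S.threeSATWord p := by
  unfold ThreeSATInstance.encode threeSATWord bagWord
  rw [← encodeBags_finBags _ _ (bagList_lt hp)]
  congr 2
  exact encodeList_pmap _ _ _ _ _ fun _ _ => encodeList_pmap _ _ _ _ _ fun _ _ => rfl

theorem colorable_toColoring (hS : S.Valid p.a) (hp : p.Valid) (h3 : 3 ≤ p.b) :
    (edgeGraph (toColoring hS hp).edges).Colorable p.b ↔ S.Sat p.a := by
  have h (col : ℕ → ℕ) : (∀ e ∈ (toColoring hS hp).edges, col e.1 ≠ col e.2) ↔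
      ∀ x ∈ S.edgeList p, col x.1 ≠ col x.2 := forall_mem_pmap fun _ _ => Iff.rfl
  rw [sat_iff_digitSat hS hp]
  constructor
  · intro hc
    obtain ⟨col, h1, h2⟩ := exists_col_of_colorable (by omega) (toColoring hS hp).loopless hc
    exact digitSat_of_colorable h3 ⟨col, h1, (h col).1 h2⟩
  · intro hd
    obtain ⟨col, h1, h2⟩ := colorable_of_digitSat hS hp h3 hd
    exact colorable_of_col (fun v _ => h1 v) ((h col).2 h2)

theorem satisfiable_toThreeSAT (hS : S.Valid p.a) (hp : p.Valid) (h2 : p.b = 2) :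
    (toThreeSAT hS hp).formula.Satisfiable ↔ S.Sat p.a := by
  have h (x : ℕ → ℕ) : (∀ C ∈ (toThreeSAT hS hp).formula, ∃ l ∈ C, x l.1 = l.2.toNat) ↔
      ∀ C ∈ S.clauseList p, ∃ l ∈ C, x l.1 = l.2.toNat :=
    forall_mem_pmap fun _ _ => exists_mem_pmap fun _ _ => Iff.rfl
  rw [sat_iff_digitSat hS hp]
  constructor
  · intro hc
    obtain ⟨x, h1, h3⟩ := exists_val_of_satisfiable hc
    exact digitSat_of_clauseSat h2 ⟨x, h1, (h x).1 h3⟩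
  · intro hd
    obtain ⟨x, h1, h3⟩ := clauseSat_of_digitSat hS hp h2 hd
    exact satisfiable_of_val ((h x).2 h3)

theorem width_finBags_bagList (hp : p.Valid) :
    width (bagSets (finBags _ (S.bagList p) (bagList_lt hp))) ≤ S.bagLen p := by
  refine width_finBags_le fun l hl => ?_
  simp only [bagList, List.mem_map] at hl
  obtain ⟨f, -, rfl⟩ := hl
  simp

end Src

/-! ### Reading the input -/

/-- The address of the list number `i` in a sequence of lists written from the address `o` on,
where each entry of a list takes `s` cells. -/
def ptr (s o : ℕ) (w : List ℕ) : ℕ → ℕ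
  | 0 => o
  | i + 1 => ptr s o w i + 1 + s * w.getD (ptr s o w i) 0

/-- The definition steps at the far end; peeling off the first record instead fits induction on the
list. -/
theorem ptr_succ' (s o : ℕ) (w : List ℕ) (i : ℕ) :
    ptr s o w (i + 1) = ptr s (o + 1 + s * w.getD o 0) w i := by
  induction i with
  | zero => rfl
  | succ i ih => rw [ptr, ih, ptr]

theorem getD_append_length (l l' : List ℕ) (i : ℕ) :
    (l ++ l').getD (l.length + i) 0 = l'.getD i 0 := by
  simp [List.getD_eq_getElem?_getD, List.getElem?_append_right]

theorem getD_append_lt (l l' : List ℕ) {i : ℕ} (h : i < l.length) :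
    (l ++ l').getD i 0 = l.getD i 0 := by
  simp [List.getD_eq_getElem?_getD, List.getElem?_append_left h]

/-- The prefix `pre` is arbitrary so that the induction can move the first record into it. -/
theorem ptr_spec {α : Type} {s : ℕ} {cnt : α → ℕ} {body : α → List ℕ}
    (hb : ∀ x, (body x).length = s * cnt x) (L : List α) :
    ∀ (pre post : List ℕ) (i : ℕ) (hi : i < L.length), ∃ pre' post',
      pre ++ (L.flatMap (fun x => cnt x :: body x) ++ post) =
        pre' ++ (cnt L[i] :: (body L[i] ++ post')) ∧
      ptr s pre.length (pre ++ (L.flatMap (fun x => cnt x :: body x) ++ post)) i = pre'.length := by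
  induction L with
  | nil => intro _ _ i hi; simp at hi
  | cons x L ih =>
    intro pre post i hi
    cases i with
    | zero => exact ⟨pre, L.flatMap (fun x => cnt x :: body x) ++ post, by simp, rfl⟩
    | succ i =>
      obtain ⟨pre', post', h1, h2⟩ := ih (pre ++ cnt x :: body x) post i
        (by simpa using hi)
      have e : pre ++ (List.flatMap (fun x => cnt x :: body x) (x :: L) ++ post) =
          (pre ++ cnt x :: body x) ++ (L.flatMap (fun x => cnt x :: body x) ++ post) := by
        simp
      refine ⟨pre', post', by rw [e, h1]; rfl, ?_⟩
      rw [ptr_succ', e, ← h2]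
      congr 1
      rw [List.append_assoc, ← add_zero pre.length, getD_append_length]
      simp [hb]
      omega

/-- The pointer past the last record is where the bags begin in an input of 3-SAT. -/
theorem ptr_length {α : Type} {s : ℕ} {cnt : α → ℕ} {body : α → List ℕ}
    (hb : ∀ x, (body x).length = s * cnt x) (L : List α) : ∀ (pre post : List ℕ),
      ptr s pre.length (pre ++ (L.flatMap (fun x => cnt x :: body x) ++ post)) L.length =
        (pre ++ L.flatMap fun x => cnt x :: body x).length := by
  induction L with
  | nil => intro pre post; simp [ptr]
  | cons x L ih =>
    intro pre post
    have := ih (pre ++ cnt x :: body x) post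
    have e : pre ++ (List.flatMap (fun x => cnt x :: body x) (x :: L) ++ post) =
        (pre ++ cnt x :: body x) ++ (L.flatMap (fun x => cnt x :: body x) ++ post) := by
      simp
    rw [e, List.length_cons, ptr_succ',
      show pre ++ List.flatMap (fun x => cnt x :: body x) (x :: L) =
        (pre ++ cnt x :: body x) ++ L.flatMap fun x => cnt x :: body x by simp, ← this]
    congr 1
    rw [List.append_assoc, ← add_zero pre.length, getD_append_length]
    simp [hb]
    omega

theorem length_flatMap_pair {α : Type} (f g : α → ℕ) (L : List α) :
    (L.flatMap fun x => [f x, g x]).length = 2 * L.length := by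
  induction L with
  | nil => rfl
  | cons x L ih => simp only [List.flatMap_cons, List.length_append, ih]; simp; ring

theorem getD_flatMap_pair {α : Type} (f g : α → ℕ) (L : List α) (post : List ℕ) :
    ∀ (i : ℕ) (hi : i < L.length),
      ((L.flatMap fun x => [f x, g x]) ++ post).getD (2 * i) 0 = f L[i] ∧
      ((L.flatMap fun x => [f x, g x]) ++ post).getD (2 * i + 1) 0 = g L[i] := by
  induction L with
  | nil => intro i hi; simp at hi
  | cons x L ih =>
    intro i hi
    cases i with
    | zero => simp
    | succ i =>
      have := ih i (by simpa using hi)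
      simpa [Nat.mul_succ] using this

/-- Membership in the bags that are written from the address `o` on. -/
def bagMem (o : ℕ) (w : List ℕ) (i v : ℕ) : Bool :=
  decide (i < w.getD o 0 ∧ ∃ x < w.getD (ptr 1 (o + 1) w i) 0,
    w.getD (ptr 1 (o + 1) w i + 1 + x) 0 = v)

theorem bagMem_iff {n : ℕ} (B : List (List (Fin n))) (pre : List ℕ) (i v : ℕ) :
    bagMem pre.length (pre ++ encodeBags B) i v = true ↔
      ∃ u : Fin n, (u : ℕ) = v ∧ u ∈ (bagSets B).getD i ∅ := by
  have h0 : (pre ++ encodeBags B).getD pre.length 0 = B.length := by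
    have := getD_append_length pre (encodeBags B) 0
    rw [add_zero] at this
    rw [this]
    simp [encodeBags, encodeList]
  rw [bagMem, decide_eq_true_iff, h0, getD_bagSets]
  by_cases hi : i < B.length
  swap
  · rw [show B.getD i [] = [] from List.getD_eq_default _ _ (by omega)]
    simp [hi]
  have hw : pre ++ encodeBags B = (pre ++ [B.length]) ++
      (B.flatMap (fun l => l.length :: l.flatMap fun v : Fin n => [(v : ℕ)]) ++ []) := by
    simp only [encodeBags, encodeList, List.append_nil, List.append_assoc, List.singleton_append]
    rfl
  have hl : pre.length + 1 = (pre ++ [B.length]).length := by simp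
  obtain ⟨pre', post', h1, h2⟩ := ptr_spec (s := 1) (cnt := List.length)
    (body := fun l : List (Fin n) => l.flatMap fun v : Fin n => [(v : ℕ)])
    (by intro l; simp) B (pre ++ [B.length]) [] i hi
  rw [hw, hl, h2, h1]
  have e1 : (pre' ++ (B[i].length :: ((B[i].flatMap fun v : Fin n => [(v : ℕ)]) ++ post'))).getD
      pre'.length 0 = B[i].length := by
    rw [← add_zero pre'.length, getD_append_length]
    rfl
  have e2 : ∀ x (hx : x < B[i].length),
      (pre' ++ (B[i].length :: ((B[i].flatMap fun v : Fin n => [(v : ℕ)]) ++ post'))).getD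
      (pre'.length + 1 + x) 0 = (B[i][x] : ℕ) := by
    intro x hx
    rw [add_assoc, getD_append_length, add_comm 1 x, List.getD_cons_succ,
      getD_append_lt _ _ (by simpa using hx)]
    rw [← List.map_eq_flatMap]
    simp [hx]
  rw [e1, List.getD_eq_getElem _ _ hi]
  simp only [hi, true_and, List.mem_toFinset]
  constructor
  · rintro ⟨x, hx, h⟩
    rw [e2 x hx] at h
    exact ⟨_, h, List.getElem_mem hx⟩
  · rintro ⟨u, rfl, hu⟩
    obtain ⟨x, hx, rfl⟩ := List.mem_iff_getElem.1 hu
    exact ⟨x, hx, e2 x hx⟩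

/-- The part of validity that concerns the bags only. -/
theorem Src.valid_of_decomposition {S : Src} {a n : ℕ} {G : SimpleGraph (Fin n)}
    {B : List (List (Fin n))} (h : IsPathDecomposition G (bagSets B)) (hn : S.n = n)
    (hm : S.m = B.length)
    (hmem : ∀ i v, S.mem i v = true ↔ ∃ u : Fin n, (u : ℕ) = v ∧ u ∈ (bagSets B).getD i ∅)
    (hscope : ∀ j < S.numC, (∀ r < 3, S.val j r = a) ∨ ∀ r < 3, ∀ r' < 3, ∃ u u' : Fin n,
      (u : ℕ) = S.var j r ∧ (u' : ℕ) = S.var j r' ∧ (u = u' ∨ G.Adj u u')) : S.Valid a := by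
  have one : ∀ v : Fin n, ∃ i, S.mem i v = true := by
    intro v
    obtain ⟨i, hi, h⟩ := (mem_bagSets (P := fun b => v ∈ b)).1 (h.vertex_mem v)
    exact ⟨i, (hmem _ _).2 ⟨v, rfl, h⟩⟩
  refine ⟨fun i v hv => ?_, fun v i j l hij hjl hi hl => ?_, fun j hj => ?_⟩
  · obtain ⟨u, rfl, hu⟩ := (hmem i v).1 hv
    refine ⟨?_, by rw [hn]; exact u.2⟩
    by_contra hi
    rw [List.getD_eq_default _ _ (by simp [bagSets]; omega)] at hu
    simp at hu
  · obtain ⟨u, rfl, hu⟩ := (hmem i v).1 hi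
    obtain ⟨u', hu', hl'⟩ := (hmem l u).1 hl
    rw [Fin.ext hu'] at hl'
    exact (hmem j u).2 ⟨u, rfl, h.interval u i j l hij hjl hu hl'⟩
  · refine (hscope j hj).imp_right fun H r hr r' hr' => ?_
    obtain ⟨u, u', h1, h2, rfl | hadj⟩ := H r hr r' hr'
    · obtain ⟨i, hi⟩ := one u
      rw [← h1, ← h2]
      exact ⟨i, hi, hi⟩
    · obtain ⟨i, hi, h3, h4⟩ := (mem_bagSets (P := fun b => u ∈ b ∧ u' ∈ b)).1
        (h.edge_mem u u' hadj)
      exact ⟨i, (hmem _ _).2 ⟨u, h1, h3⟩, (hmem _ _).2 ⟨u', h2, h4⟩⟩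

theorem Src.maxCard_le {S : Src} {n : ℕ} {B : List (List (Fin n))}
    (hmem : ∀ i v, S.mem i v = true ↔ ∃ u : Fin n, (u : ℕ) = v ∧ u ∈ (bagSets B).getD i ∅) :
    S.maxCard ≤ width (bagSets B) + 1 := by
  unfold maxCard maxBelow
  refine Finset.sup_le fun i _ => ?_
  refine le_trans ?_ (card_le_width B i)
  refine (card_le_card (t := ((bagSets B).getD i ∅).image fun u : Fin n => (u : ℕ))
    fun v hv => ?_).trans card_image_le
  obtain ⟨u, h1, h2⟩ := (hmem i v).1 (mem_filter.1 hv).2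
  exact mem_image.2 ⟨u, h2, h1⟩

/-! ### Entries of an input word are bounded by its length -/

theorem mem_encodeList {α : Type} {f : α → List ℕ} {l : List α} {v : ℕ} :
    v ∈ encodeList f l ↔ v = l.length ∨ ∃ x ∈ l, v ∈ f x := by
  simp [encodeList]

theorem length_le_encodeList {α : Type} {f : α → List ℕ} {l : List α} (hf : ∀ x, 1 ≤ (f x).length) :
    l.length < (encodeList f l).length := by
  rw [encodeList, List.length_cons, Nat.lt_succ_iff, List.length_flatMap]
  induction l with
  | nil => simp
  | cons x l ih =>
    have := hf x
    simp only [List.length_cons, List.map_cons, List.sum_cons]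
    omega

theorem length_le_encodeList_of_mem {α : Type} {f : α → List ℕ} {l : List α} {x : α} (hx : x ∈ l) :
    (f x).length ≤ (encodeList f l).length := by
  rw [encodeList, List.length_cons, List.length_flatMap]
  exact (List.le_sum_of_mem (List.mem_map_of_mem (f := fun a => (f a).length) hx)).trans
    (Nat.le_succ _)

/-- Although `n` occupies a single cell, it cannot exceed the length of the word, since every vertex
is listed in some bag. Loops over all vertices are therefore polynomial. -/
theorem le_encodeBags {n : ℕ} {G : SimpleGraph (Fin n)} {B : List (List (Fin n))}
    (h : IsPathDecomposition G (bagSets B)) : n ≤ (encodeBags B).length := by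
  classical
  have h1 : (univ : Finset (Fin n)) ⊆ B.flatten.toFinset := by
    intro v _
    obtain ⟨b, hb, hv⟩ := h.vertex_mem v
    simp only [bagSets, List.mem_map] at hb
    obtain ⟨l, hl, rfl⟩ := hb
    exact List.mem_toFinset.2 (List.mem_flatten.2 ⟨l, hl, List.mem_toFinset.1 hv⟩)
  have h2 := (card_le_card h1).trans (List.toFinset_card_le _)
  rw [card_univ, Fintype.card_fin] at h2
  refine h2.trans ?_
  rw [encodeBags, encodeList, List.length_cons, List.length_flatMap, List.length_flatten]
  refine le_trans ?_ (Nat.le_succ _)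
  refine List.sum_le_sum fun l _ => ?_
  exact (length_le_encodeList fun _ => by simp).le

theorem encodeBags_bound {n : ℕ} {G : SimpleGraph (Fin n)} {B : List (List (Fin n))}
    (h : IsPathDecomposition G (bagSets B)) : ∀ v ∈ encodeBags B, v ≤ (encodeBags B).length := by
  intro v hv
  have hn := le_encodeBags h
  have hl : ∀ l : List (Fin n), l.length < (encodeList (fun v : Fin n => [(v : ℕ)]) l).length :=
    fun l => length_le_encodeList fun _ => by simp
  rcases mem_encodeList.1 hv with rfl | ⟨l, hlB, hv⟩
  · exact (length_le_encodeList fun l => by have := hl l; omega).le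
  · have h1 := length_le_encodeList_of_mem (f := encodeList fun v : Fin n => [(v : ℕ)]) hlB
    rcases mem_encodeList.1 hv with rfl | ⟨x, _, hv⟩
    · exact ((hl l).le.trans h1)
    · rw [List.mem_singleton.1 hv]
      omega

theorem ColoringInstance.encode_bound (I : ColoringInstance) :
    1 ≤ I.encode.length ∧ ∀ v ∈ I.encode, v ≤ I.encode.length := by
  have hn := le_encodeBags I.decomposition
  have hb := encodeBags_bound I.decomposition
  have hE : I.edges.length < (encodeList (fun e : Fin I.n × Fin I.n => [(e.1 : ℕ), (e.2 : ℕ)])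
    I.edges).length := length_le_encodeList fun _ => by simp
  unfold ColoringInstance.encode
  rw [List.length_cons, List.length_append]
  refine ⟨by omega, fun v hv => ?_⟩
  rcases List.mem_cons.1 hv with rfl | hv
  · omega
  rcases List.mem_append.1 hv with hv | hv
  · rcases mem_encodeList.1 hv with rfl | ⟨e, _, hv⟩
    · omega
    · simp only [List.mem_cons, List.not_mem_nil, or_false] at hv
      omega
  · have := hb v hv
    omega

theorem ThreeSATInstance.encode_bound (I : ThreeSATInstance) :
    1 ≤ I.encode.length ∧ ∀ v ∈ I.encode, v ≤ I.encode.length := by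
  have hn := le_encodeBags I.decomposition
  have hb := encodeBags_bound I.decomposition
  have hC : ∀ C : List (Literal I.n),
      C.length < (encodeList (fun l : Literal I.n => [(l.1 : ℕ), l.2.toNat]) C).length :=
    fun C => length_le_encodeList fun _ => by simp
  have hE : I.formula.length < (encodeList (encodeList fun l : Literal I.n =>
    [(l.1 : ℕ), l.2.toNat]) I.formula).length :=
      length_le_encodeList fun C => by have := hC C; omega
  unfold ThreeSATInstance.encode
  rw [List.length_cons, List.length_append]
  refine ⟨by omega, fun v hv => ?_⟩
  rcases List.mem_cons.1 hv with rfl | hv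
  · omega
  rcases List.mem_append.1 hv with hv | hv
  · rcases mem_encodeList.1 hv with rfl | ⟨C, hCm, hv⟩
    · omega
    · have h1 := length_le_encodeList_of_mem
        (f := encodeList fun l : Literal I.n => [(l.1 : ℕ), l.2.toNat]) hCm
      have h2 := hC C
      rcases mem_encodeList.1 hv with rfl | ⟨l, _, hv⟩
      · omega
      · simp only [List.mem_cons, List.not_mem_nil, or_false] at hv
        have := Bool.toNat_le l.2
        omega
  · have := hb v hv
    omega

/-! ### Coloring as a constraint satisfaction problem -/

/-- The problem that is described by an input of `k`-Coloring. -/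
def colorSrc (k : ℕ) (w : List ℕ) : Src where
  n := w.getD 0 0
  m := w.getD (2 + 2 * w.getD 1 0) 0
  numC := w.getD 1 0 * k
  mem := bagMem (2 + 2 * w.getD 1 0) w
  var j r := if r = 0 then w.getD (2 + 2 * (j / k)) 0 else w.getD (2 + 2 * (j / k) + 1) 0
  val j _ := j % k

theorem getD_length_append (l l' : List ℕ) : (l ++ l').getD l.length 0 = l'.getD 0 0 :=
  getD_append_length l l' 0

section
variable (I : ColoringInstance)

theorem ColoringInstance.encode_eq : I.encode =
    (I.n :: I.edges.length :: I.edges.flatMap fun e => [(e.1 : ℕ), (e.2 : ℕ)]) ++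
      encodeBags I.bags := by
  simp [ColoringInstance.encode, encodeList]

theorem ColoringInstance.length_prefix :
    (I.n :: I.edges.length :: I.edges.flatMap fun e => [(e.1 : ℕ), (e.2 : ℕ)]).length =
      2 + 2 * I.edges.length := by
  rw [List.length_cons, List.length_cons, length_flatMap_pair]
  ring

theorem ColoringInstance.encode_one : I.encode.getD 1 0 = I.edges.length := by
  rw [I.encode_eq]
  rfl

theorem colorSrc_n (k : ℕ) : (colorSrc k I.encode).n = I.n := by
  rw [colorSrc, I.encode_eq]
  rfl

theorem colorSrc_m (k : ℕ) : (colorSrc k I.encode).m = I.bags.length := by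
  simp only [colorSrc]
  rw [I.encode_one, I.encode_eq, ← I.length_prefix, getD_length_append]
  rfl

theorem colorSrc_mem (k i v : ℕ) : (colorSrc k I.encode).mem i v = true ↔
    ∃ u : Fin I.n, (u : ℕ) = v ∧ u ∈ (bagSets I.bags).getD i ∅ := by
  simp only [colorSrc]
  rw [I.encode_one, ← I.length_prefix, I.encode_eq, bagMem_iff]

theorem colorSrc_var {k e c r : ℕ} (he : e < I.edges.length) (hc : c < k) :
    (colorSrc k I.encode).var (k * e + c) r =
      if r = 0 then ((I.edges[e]).1 : ℕ) else ((I.edges[e]).2 : ℕ) := by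
  have := getD_flatMap_pair (fun e : Fin I.n × Fin I.n => (e.1 : ℕ)) (fun e => (e.2 : ℕ)) I.edges
    (encodeBags I.bags) e he
  simp only [colorSrc]
  rw [Nat.mul_add_div (by omega), Nat.div_eq_of_lt hc, add_zero, I.encode_eq, ← this.1, ← this.2,
    show 2 + 2 * e = 2 * e + 1 + 1 by ring]
  rfl

theorem forall_mul_add {m k : ℕ} {P : ℕ → Prop} :
    (∀ j < m * k, P j) ↔ ∀ e < m, ∀ c < k, P (k * e + c) := by
  rw [← Src.forall_mul_lt (P := fun e c => P (k * e + c))]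
  simp only [Nat.div_add_mod]

theorem colorSrc_numC (k : ℕ) : (colorSrc k I.encode).numC = I.edges.length * k := by
  simp only [colorSrc]
  rw [I.encode_one]

theorem colorSrc_valid (k : ℕ) : (colorSrc k I.encode).Valid k := by
  refine Src.valid_of_decomposition I.decomposition (colorSrc_n I k) (colorSrc_m I k)
    (colorSrc_mem I k) ?_
  rw [colorSrc_numC, forall_mul_add]
  intro e he c hc
  right
  have hmem : I.edges[e] ∈ I.edges := List.getElem_mem he
  have hadj : (edgeGraph I.edges).Adj (I.edges[e]).1 (I.edges[e]).2 :=
    (SimpleGraph.fromRel_adj _ _ _).2 ⟨I.loopless _ hmem, Or.inl hmem⟩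
  intro r _ r' _
  rw [colorSrc_var I he hc, colorSrc_var I he hc]
  split_ifs
  · exact ⟨_, _, rfl, rfl, Or.inl rfl⟩
  · exact ⟨_, _, rfl, rfl, Or.inr hadj⟩
  · exact ⟨_, _, rfl, rfl, Or.inr hadj.symm⟩
  · exact ⟨_, _, rfl, rfl, Or.inl rfl⟩

/-- The constraint `k * e + c` excludes that both ends of the edge `e` have the color `c`; the `k`
constraints of an edge together make its ends differ. -/
theorem colorSrc_sat {k : ℕ} (hk : 0 < k) :
    (colorSrc k I.encode).Sat k ↔ (edgeGraph I.edges).Colorable k := by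
  have key (col : ℕ → ℕ) (hcol : ∀ v < I.n, col v < k) : (∀ j < (colorSrc k I.encode).numC,
      ∃ r < 3, ¬ Match k ((colorSrc k I.encode).val j r) (col ((colorSrc k I.encode).var j r))) ↔
      ∀ e ∈ I.edges, col e.1 ≠ col e.2 := by
    rw [colorSrc_numC, forall_mul_add, List.forall_mem_iff_getElem]
    refine forall₂_congr fun e he => ?_
    have h1 := hcol _ (I.edges[e]).1.2
    have h2 := hcol _ (I.edges[e]).2.2
    constructor
    · intro h heq
      obtain ⟨r, hr, hm⟩ := h (col (I.edges[e]).1) h1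
      rw [colorSrc_var I he h1] at hm
      simp only [colorSrc, Nat.mul_add_mod, Nat.mod_eq_of_lt h1, Match] at hm
      split_ifs at hm <;> omega
    · intro h c hc
      by_contra hcon
      push Not at hcon
      have c0 := hcon 0 (by omega)
      have c1 := hcon 1 (by omega)
      rw [colorSrc_var I he hc] at c0 c1
      simp only [colorSrc, Nat.mul_add_mod, Nat.mod_eq_of_lt hc, Match, if_true, one_ne_zero,
        if_false] at c0 c1
      omega
  constructor
  · rintro ⟨col, h1, h2⟩
    rw [colorSrc_n] at h1
    exact colorable_of_col h1 ((key col h1).1 h2)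
  · intro h
    obtain ⟨col, h1, h2⟩ := exists_col_of_colorable hk I.loopless h
    exact ⟨col, fun v _ => h1 v, (key col fun v _ => h1 v).2 h2⟩

end

/-! ### Satisfiability as a constraint satisfaction problem -/

/-- The problem that is described by an input of 3-SAT. -/
def satSrc (w : List ℕ) : Src where
  n := w.getD 0 0
  m := w.getD (ptr 2 2 w (w.getD 1 0)) 0
  numC := w.getD 1 0
  mem := bagMem (ptr 2 2 w (w.getD 1 0)) w
  var j r := w.getD (ptr 2 2 w j + 1 + 2 * min r (w.getD (ptr 2 2 w j) 0 - 1)) 0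
  val j r := if w.getD (ptr 2 2 w j) 0 = 0 then 2 else
    1 - w.getD (ptr 2 2 w j + 1 + 2 * min r (w.getD (ptr 2 2 w j) 0 - 1) + 1) 0

section
variable (I : ThreeSATInstance)

theorem ThreeSATInstance.encode_eq : I.encode = [I.n, I.formula.length] ++
    (I.formula.flatMap (fun C => C.length :: C.flatMap fun l => [(l.1 : ℕ), l.2.toNat]) ++
      encodeBags I.bags) := by
  simp only [ThreeSATInstance.encode, encodeList, List.cons_append, List.nil_append]
  rfl

theorem ThreeSATInstance.encode_one : I.encode.getD 1 0 = I.formula.length := by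
  rw [I.encode_eq]
  rfl

theorem ThreeSATInstance.ptr_formula : ptr 2 2 I.encode I.formula.length =
    ([I.n, I.formula.length] ++ I.formula.flatMap (fun C => C.length ::
      C.flatMap fun l => [(l.1 : ℕ), l.2.toNat])).length := by
  rw [I.encode_eq]
  exact ptr_length (s := 2) (cnt := List.length)
    (body := fun C : List (Literal I.n) => C.flatMap fun l => [(l.1 : ℕ), l.2.toNat])
    (fun C => length_flatMap_pair (fun l => (l.1 : ℕ)) (fun l => l.2.toNat) C) I.formula [I.n, I.formula.length] (encodeBags I.bags)

theorem ThreeSATInstance.read_clause {j : ℕ} (hj : j < I.formula.length) :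
    I.encode.getD (ptr 2 2 I.encode j) 0 = (I.formula[j]).length ∧
      ∀ x (hx : x < (I.formula[j]).length),
        I.encode.getD (ptr 2 2 I.encode j + 1 + 2 * x) 0 = ((I.formula[j])[x].1 : ℕ) ∧
        I.encode.getD (ptr 2 2 I.encode j + 1 + 2 * x + 1) 0 = (I.formula[j])[x].2.toNat := by
  obtain ⟨pre, post, h1, h2⟩ := ptr_spec (s := 2) (cnt := List.length)
    (body := fun C : List (Literal I.n) => C.flatMap fun l => [(l.1 : ℕ), l.2.toNat])
    (fun C => length_flatMap_pair (fun l => (l.1 : ℕ)) (fun l => l.2.toNat) C) I.formula [I.n, I.formula.length] (encodeBags I.bags) j hj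
  rw [← I.encode_eq] at h1 h2
  have h2' : ptr 2 2 I.encode j = pre.length := h2
  rw [h2', h1, getD_length_append]
  refine ⟨rfl, fun x hx => ?_⟩
  rw [add_assoc _ _ 1, add_assoc, getD_append_length, add_assoc, getD_append_length,
    add_comm 1 (2 * x), add_comm 1 (2 * x + 1), List.getD_cons_succ, List.getD_cons_succ]
  exact getD_flatMap_pair (fun l : Literal I.n => (l.1 : ℕ)) (fun l => l.2.toNat) _ post x hx

theorem satSrc_n : (satSrc I.encode).n = I.n := by
  rw [satSrc, I.encode_eq]
  rfl

theorem satSrc_numC : (satSrc I.encode).numC = I.formula.length := I.encode_one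

theorem satSrc_m : (satSrc I.encode).m = I.bags.length := by
  simp only [satSrc]
  rw [I.encode_one, I.ptr_formula, I.encode_eq, ← List.append_assoc, getD_length_append]
  rfl

theorem satSrc_mem (i v : ℕ) : (satSrc I.encode).mem i v = true ↔
    ∃ u : Fin I.n, (u : ℕ) = v ∧ u ∈ (bagSets I.bags).getD i ∅ := by
  simp only [satSrc]
  rw [I.encode_one, I.ptr_formula, I.encode_eq, ← List.append_assoc, bagMem_iff]

/-- The wildcard at all positions makes the constraint of an empty clause fail under every
assignment. -/
theorem satSrc_val_empty {j r : ℕ} (hj : j < I.formula.length) (h : I.formula[j] = []) :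
    (satSrc I.encode).val j r = 2 := by
  simp only [satSrc]
  rw [(I.read_clause hj).1, h]
  rfl

/-- A clause with fewer than three literals is padded by repeating its last one. The forbidden value
is the one that falsifies the literal. -/
theorem satSrc_lit {j r : ℕ} (hj : j < I.formula.length) (h : 0 < (I.formula[j]).length) :
    (satSrc I.encode).var j r =
      ((I.formula[j])[min r ((I.formula[j]).length - 1)]'(by omega)).1 ∧
    (satSrc I.encode).val j r =
      1 - ((I.formula[j])[min r ((I.formula[j]).length - 1)]'(by omega)).2.toNat := by
  obtain ⟨h1, h2⟩ := I.read_clause hj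
  have := h2 (min r ((I.formula[j]).length - 1)) (by omega)
  simp only [satSrc, h1]
  rw [if_neg (by omega), this.1, this.2]
  exact ⟨rfl, rfl⟩

theorem satSrc_valid : (satSrc I.encode).Valid 2 := by
  refine Src.valid_of_decomposition I.decomposition (satSrc_n I) (satSrc_m I) (satSrc_mem I) ?_
  rw [satSrc_numC]
  intro j hj
  rcases Nat.eq_zero_or_pos (I.formula[j]).length with h | h
  · exact Or.inl fun r _ => satSrc_val_empty I hj (List.length_eq_zero_iff.1 h)
  · right
    intro r _ r' _
    rw [(satSrc_lit I hj h).1, (satSrc_lit I hj h).1]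
    refine ⟨_, _, rfl, rfl, ?_⟩
    by_cases heq : ((I.formula[j])[min r ((I.formula[j]).length - 1)]'(by omega)).1 =
        ((I.formula[j])[min r' ((I.formula[j]).length - 1)]'(by omega)).1
    · exact Or.inl heq
    · right
      rw [CNF.primalGraph, SimpleGraph.fromRel_adj]
      exact ⟨heq, Or.inl ⟨_, List.getElem_mem hj, ⟨_, List.getElem_mem _⟩, _, List.getElem_mem _⟩⟩

theorem satSrc_sat : (satSrc I.encode).Sat 2 ↔ I.formula.Satisfiable := by
  have key (x : ℕ → ℕ) (hx : ∀ v < I.n, x v < 2) : (∀ j < (satSrc I.encode).numC,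
      ∃ r < 3, ¬ Match 2 ((satSrc I.encode).val j r) (x ((satSrc I.encode).var j r))) ↔
      ∀ C ∈ I.formula, ∃ l ∈ C, x l.1 = l.2.toNat := by
    rw [satSrc_numC, List.forall_mem_iff_getElem]
    refine forall₂_congr fun j hj => ?_
    have har := I.arity _ (List.getElem_mem hj)
    rcases Nat.eq_zero_or_pos (I.formula[j]).length with h | h
    · have h0 := List.length_eq_zero_iff.1 h
      constructor
      · rintro ⟨r, hr, hm⟩
        exact absurd (Or.inr (satSrc_val_empty I hj h0)) hm
      · rintro ⟨l, hl, -⟩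
        rw [h0] at hl
        simp at hl
    · have lit : ∀ l : Literal I.n, ¬ Match 2 (1 - l.2.toNat) (x l.1) ↔ x l.1 = l.2.toNat := by
        intro l
        have h1 := hx l.1 l.1.2
        have h2 := Bool.toNat_le l.2
        unfold Match
        omega
      constructor
      · rintro ⟨r, hr, hm⟩
        rw [(satSrc_lit I hj h).1, (satSrc_lit I hj h).2, lit] at hm
        exact ⟨_, List.getElem_mem _, hm⟩
      · rintro ⟨l, hl, heq⟩
        obtain ⟨r, hr, rfl⟩ := List.mem_iff_getElem.1 hl
        refine ⟨r, by omega, ?_⟩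
        rw [(satSrc_lit I hj h).1, (satSrc_lit I hj h).2, lit]
        simpa only [min_eq_left (show r ≤ (I.formula[j]).length - 1 by omega)] using heq
  constructor
  · rintro ⟨x, h1, h2⟩
    rw [satSrc_n] at h1
    exact satisfiable_of_val ((key x h1).1 h2)
  · intro h
    obtain ⟨x, h1, h2⟩ := exists_val_of_satisfiable h
    exact ⟨x, fun v _ => h1 v, (key x fun v _ => h1 v).2 h2⟩

end

/-! ### The construction takes polynomial time -/

/-- The data of a problem that is described by a word can be computed in polynomial time. -/
structure PolySrc (src : List ℕ → Src) : Prop where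
  n : ∀ {α : Type} [Ctx α], PolyT fun x : α => (src (Ctx.word x)).n
  m : ∀ {α : Type} [Ctx α], PolyT fun x : α => (src (Ctx.word x)).m
  numC : ∀ {α : Type} [Ctx α], PolyT fun x : α => (src (Ctx.word x)).numC
  mem : ∀ {α : Type} [Ctx α] {f g : α → ℕ}, PolyT f → PolyT g →
    PolyP fun x => (src (Ctx.word x)).mem (f x) (g x) = true
  var : ∀ {α : Type} [Ctx α] {f g : α → ℕ}, PolyT f → PolyT g →
    PolyT fun x => (src (Ctx.word x)).var (f x) (g x)
  val : ∀ {α : Type} [Ctx α] {f g : α → ℕ}, PolyT f → PolyT g →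
    PolyT fun x => (src (Ctx.word x)).val (f x) (g x)

section
variable {α : Type} [Ctx α]

theorem PolyT.ptr {o i : α → ℕ} (s : ℕ) (ho : PolyT o) (hi : PolyT i) :
    PolyT fun x => ptr s (o x) (Ctx.word x) (i x) := by
  obtain ⟨S, hS, hSb, -⟩ := id hi
  obtain ⟨U, hU, hUb, -⟩ := id ho
  refine PolyT.recursion (f := o)
    (g := fun p => p.2 + 1 + s * (Ctx.word p.1.1).getD p.2 0) hi ho
    ((PolyT.snd.add (.const 1)).add ((PolyT.const s).mul (PolyT.read .snd)))
    (hU.add (hS.mul ((PolyBd.const 1).add ((PolyBd.const s).mul .id))))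
    (fun x k => PathwidthSETH.ptr s (o x) (Ctx.word x) k) (fun _ => rfl) (fun _ _ => rfl) ?_
  intro x M hx k hk
  have h1 := hSb x M hx
  have h2 := hUb x M hx
  -- Every cell contains at most `M`, so a record advances the pointer by at most `1 + s * M`, even
  -- in words that encode no instance.
  have : PathwidthSETH.ptr s (o x) (Ctx.word x) k ≤ o x + k * (1 + s * M) := by
    clear hk
    induction k with
    | zero => simp [PathwidthSETH.ptr]
    | succ k ih =>
      have := Nat.mul_le_mul_left s (hx.getD (PathwidthSETH.ptr s (o x) (Ctx.word x) k))
      rw [PathwidthSETH.ptr, Nat.succ_mul]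
      omega
  have := Nat.mul_le_mul_right (1 + s * M) (hk.trans h1)
  omega

theorem PolyP.bagMem {o i v : α → ℕ} (ho : PolyT o) (hi : PolyT i) (hv : PolyT v) :
    PolyP fun x => bagMem (o x) (Ctx.word x) (i x) (v x) = true := by
  have hptr := PolyT.ptr 1 (ho.add (.const 1)) hi
  refine PolyP.congr ((PolyP.lt hi (PolyT.read ho)).and (PolyP.exists_lt
    (p := fun x y => (Ctx.word x).getD (PathwidthSETH.ptr 1 (o x + 1) (Ctx.word x) (i x) + 1 + y) 0
      = v x) (PolyT.read hptr)
    (PolyP.eq (PolyT.read (α := α × ℕ) ((hptr.fst.add (.const 1)).add .snd)) hv.fst)))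
    fun x => ?_
  rw [PathwidthSETH.bagMem, decide_eq_true_iff]

end

theorem polySrc_color (k : ℕ) : PolySrc (colorSrc k) where
  n := PolyT.read (.const 0)
  m := PolyT.read ((PolyT.const 2).add ((PolyT.const 2).mul (PolyT.read (.const 1))))
  numC := (PolyT.read (.const 1)).mul (.const k)
  mem hf hg := PolyP.bagMem ((PolyT.const 2).add ((PolyT.const 2).mul (PolyT.read (.const 1)))) hf hg
  var hf hg := PolyT.ite (PolyP.eq hg (.const 0))
    (PolyT.read ((PolyT.const 2).add ((PolyT.const 2).mul (hf.div (.const k)))))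
    (PolyT.read (((PolyT.const 2).add ((PolyT.const 2).mul (hf.div (.const k)))).add (.const 1)))
  val hf _ := hf.mod (.const k)

theorem polySrc_sat : PolySrc satSrc := by
  have min {α : Type} [Ctx α] {f g : α → ℕ} (hf : PolyT f) (hg : PolyT g) :
      PolyT fun x => min (f x) (g x) := (hf.sub (hf.sub hg)).congr fun _ => by omega
  have len {α : Type} [Ctx α] {f : α → ℕ} (hf : PolyT f) :
      PolyT fun x => (Ctx.word x).getD (ptr 2 2 (Ctx.word x) (f x)) 0 :=
    PolyT.read (PolyT.ptr 2 (.const 2) hf)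
  have addr {α : Type} [Ctx α] {f g : α → ℕ} (hf : PolyT f) (hg : PolyT g) :
      PolyT fun x => ptr 2 2 (Ctx.word x) (f x) + 1 + 2 * Min.min (g x)
        ((Ctx.word x).getD (ptr 2 2 (Ctx.word x) (f x)) 0 - 1) :=
    ((PolyT.ptr 2 (.const 2) hf).add (.const 1)).add
      ((PolyT.const 2).mul (min hg ((len hf).sub (.const 1))))
  exact
    { n := PolyT.read (.const 0)
      m := len (PolyT.read (.const 1))
      numC := PolyT.read (.const 1)
      mem := fun hf hg => PolyP.bagMem (PolyT.ptr 2 (.const 2) (PolyT.read (.const 1))) hf hg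
      var := fun hf hg => PolyT.read (addr hf hg)
      val := fun hf hg => PolyT.ite (PolyP.eq (len hf) (.const 0)) (.const 2)
        ((PolyT.const 1).sub (PolyT.read ((addr hf hg).add (.const 1)))) }

/-! ### Places, windows and bags in polynomial time -/

namespace PolySrc

variable {src : List ℕ → Src} (h : PolySrc src) (p : Params) {α : Type} [Ctx α] {f g : α → ℕ}
include h

theorem first (hf : PolyT f) : PolyT fun x => (src (Ctx.word x)).first (f x) :=
  PolyT.count (p := fun x i => ∀ i' < i + 1, ¬ (src (Ctx.word x)).mem i' (f x) = true) h.m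
    (PolyP.forall_lt (n := fun x : α × ℕ => x.2 + 1)
      (p := fun x i' => ¬ (src (Ctx.word x)).mem i' (f x.1) = true) (PolyT.snd.add (.const 1))
      (h.mem .snd hf.fst.fst).not)

theorem before (hf : PolyT f) (hg : PolyT g) :
    PolyP fun x => (src (Ctx.word x)).Before (f x) (g x) :=
  (PolyP.lt (h.first hf) (h.first hg)).or
    ((PolyP.eq (h.first hf) (h.first hg)).and (PolyP.lt hf hg))

theorem rank (hf : PolyT f) (hg : PolyT g) : PolyT fun x => (src (Ctx.word x)).rank (f x) (g x) :=
  PolyT.count (p := fun x u => (src (Ctx.word x)).mem (f x) u = true ∧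
    (src (Ctx.word x)).Before u (g x)) h.n ((h.mem hf.fst .snd).and (h.before .snd hg.fst))

theorem bagCard (hf : PolyT f) : PolyT fun x => (src (Ctx.word x)).bagCard (f x) :=
  PolyT.count (p := fun x u => (src (Ctx.word x)).mem (f x) u = true) h.n (h.mem hf.fst .snd)

theorem maxCard : PolyT fun x : α => (src (Ctx.word x)).maxCard :=
  PolyT.maxBelow (g := fun x => (src (Ctx.word x)).bagCard) h.m (h.bagCard .snd)

theorem blocks : PolyT fun x : α => (src (Ctx.word x)).blocks p :=
  (h.maxCard.div (.const p.t)).add (.const 1)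

theorem place (hf : PolyT f) (hg : PolyT g) :
    PolyT fun x => (src (Ctx.word x)).place p (f x) (g x) :=
  (hf.mul ((h.blocks p).mul (.const p.t))).add (h.rank hf hg)

theorem home (hf : PolyT f) : PolyT fun x => (src (Ctx.word x)).home (f x) :=
  PolyT.maxBelow (g := fun x r => (src (Ctx.word x)).first ((src (Ctx.word x)).var (f x) r))
    (.const 3) (h.first (h.var hf.fst .snd))

theorem numC' : PolyT fun x : α => (src (Ctx.word x)).numC' p :=
  h.numC.add (((h.m.mul h.n).mul (.const p.a)).mul (.const p.a))

theorem eqVar (hf : PolyT f) : PolyT fun x => (src (Ctx.word x)).eqVar p (f x) :=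
  ((hf.div (.const p.a)).div (.const p.a)).mod h.n

theorem eqBag (hf : PolyT f) : PolyT fun x => (src (Ctx.word x)).eqBag p (f x) :=
  ((hf.div (.const p.a)).div (.const p.a)).div h.n

theorem link (hf : PolyT f) : PolyP fun x => (src (Ctx.word x)).Link p (f x) :=
  (PolyP.eq (hf.mod (.const p.a)) ((hf.div (.const p.a)).mod (.const p.a))).not.and
    ((h.mem (h.eqBag p hf) (h.eqVar p hf)).and
      (h.mem ((h.eqBag p hf).add (.const 1)) (h.eqVar p hf)))

theorem pos (hf : PolyT f) (hg : PolyT g) : PolyT fun x => (src (Ctx.word x)).pos p (f x) (g x) :=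
  have hf' := hf.sub h.numC
  PolyT.ite (PolyP.lt hf h.numC) (h.place p (h.home hf) (h.var hf hg))
    (PolyT.ite ((h.link p hf').and (PolyP.lt (.const 0) hg))
      (h.place p ((h.eqBag p hf').add (.const 1)) (h.eqVar p hf'))
      (h.place p (h.eqBag p hf') (h.eqVar p hf')))

theorem value (hf : PolyT f) (hg : PolyT g) :
    PolyT fun x => (src (Ctx.word x)).value p (f x) (g x) :=
  have hf' := hf.sub h.numC
  PolyT.ite (PolyP.lt hf h.numC) (h.val hf hg)
    (PolyT.ite (h.link p hf') (PolyT.ite (PolyP.lt (.const 0) hg)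
      ((hf'.div (.const p.a)).mod (.const p.a)) (hf'.mod (.const p.a))) (.const (p.a + 1)))

theorem win (hf : PolyT f) : PolyT fun x => (src (Ctx.word x)).win p (f x) :=
  have hf' := hf.sub h.numC
  PolyT.ite (PolyP.lt hf h.numC) ((h.home hf).mul (h.blocks p))
    ((h.place p (h.eqBag p hf') (h.eqVar p hf')).div (.const p.t))

theorem numE : PolyT fun x : α => (src (Ctx.word x)).numE p :=
  (h.numC' p).mul (.const _)

omit h in
theorem cons (hf : PolyT f) : PolyT fun x => Src.cons p (f x) := hf.div (.const _)

omit h in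
theorem code (hf : PolyT f) (hg : PolyT g) : PolyT fun x => Src.code p (f x) (g x) :=
  PolyT.digit _ hf hg

theorem live (hf : PolyT f) : PolyP fun x => (src (Ctx.word x)).Live p (f x) :=
  have hc := cons p hf.fst
  PolyP.forall_lt (n := fun _ => 3) (p := fun x r => Match p.a
      ((src (Ctx.word x)).value p (Src.cons p (f x)) r) (digit p.a (Src.code p (f x) r)
        ((src (Ctx.word x)).pos p (Src.cons p (f x)) r % p.t))) (.const 3)
    ((PolyP.eq (h.value p hc .snd) (PolyT.digit p.a (code p hf.fst .snd)
      ((h.pos p hc .snd).mod (.const p.t)))).or (PolyP.eq (h.value p hc .snd) (.const p.a)))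

theorem litVar (hf : PolyT f) (hg : PolyT g) :
    PolyT fun x => (src (Ctx.word x)).litVar p (f x) (g x) :=
  (((h.pos p (cons p hf) (hg.div (.const p.q))).div (.const p.t)).mul (.const p.q)).add
    (hg.mod (.const p.q))

omit h in
theorem litVal (hf : PolyT f) (hg : PolyT g) : PolyT fun x => Src.litVal p (f x) (g x) :=
  PolyT.digit p.b (code p hf (hg.div (.const p.q))) (hg.mod (.const p.q))

theorem numWin : PolyT fun x : α => (src (Ctx.word x)).numWin p :=
  (h.m.add (.const 1)).mul (h.blocks p)

theorem numPrim : PolyT fun x : α => (src (Ctx.word x)).numPrim p :=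
  ((h.numWin p).add (h.blocks p)).mul (.const p.q)

theorem numVert : PolyT fun x : α => (src (Ctx.word x)).numVert p :=
  ((PolyT.const p.b).add (h.numPrim p)).add ((h.numE p).mul (.const _))

omit h in
theorem prim (hf : PolyT f) : PolyT fun x => Src.prim p (f x) := (PolyT.const p.b).add hf

theorem aux (hf : PolyT f) (hg : PolyT g) : PolyT fun x => (src (Ctx.word x)).aux p (f x) (g x) :=
  (((PolyT.const p.b).add (h.numPrim p)).add (hf.mul (.const _))).add hg

theorem bagLen : PolyT fun x : α => (src (Ctx.word x)).bagLen p :=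
  ((PolyT.const p.b).add (((h.blocks p).add (.const 1)).mul (.const p.q))).add (.const _)

theorem numBags : PolyT fun x : α => (src (Ctx.word x)).numBags p :=
  (h.numWin p).mul ((h.numE p).add (.const 1))

theorem bagEntry (hf : PolyT f) (hg : PolyT g) :
    PolyT fun x => (src (Ctx.word x)).bagEntry p (f x) (g x) :=
  have hE := (h.numE p).add (.const 1)
  have hw := (PolyT.const p.b).add (((h.blocks p).add (.const 1)).mul (.const p.q))
  PolyT.ite (PolyP.lt hg (.const p.b)) hg (PolyT.ite (PolyP.lt hg hw)
    (((hf.div hE).mul (.const p.q)).add hg) (PolyT.ite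
      ((PolyP.lt (hf.mod hE) (h.numE p)).and (PolyP.eq (h.win p (cons p (hf.mod hE))) (hf.div hE)))
      (h.aux p (hf.mod hE) (hg.sub hw)) (.const 0)))

theorem bagWord : Emit fun x : α => (src (Ctx.word x)).bagWord p := by
  refine (Emit.cons (h.numBags p) (Emit.flatMap
    (g := fun x f => (src (Ctx.word x)).bagLen p :: (List.range ((src (Ctx.word x)).bagLen p)).flatMap
      fun i => [(src (Ctx.word x)).bagEntry p f i]) (h.numBags p)
    (Emit.cons (h.bagLen p) (Emit.flatMap
      (g := fun (x : α × ℕ) i => [(src (Ctx.word x)).bagEntry p x.2 i]) (h.bagLen p)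
      (Emit.singleton (h.bagEntry p PolyT.snd.fst .snd)))))).congr fun x => ?_
  simp only [Src.bagWord, Src.bagList, encodeList, List.length_map, List.length_range,
    List.flatMap_map]

end PolySrc

/-- A pair of numbers that are computed in polynomial time. -/
def PolyPair {α : Type} [Ctx α] (f : α → ℕ × ℕ) : Prop :=
  PolyT (fun x => (f x).1) ∧ PolyT fun x => (f x).2

section
variable {α : Type} [Ctx α]

theorem PolyPair.mk {f g : α → ℕ} (hf : PolyT f) (hg : PolyT g) : PolyPair fun x => (f x, g x) :=
  ⟨hf, hg⟩

theorem PolyPair.ite {c : α → Prop} [DecidablePred c] {f g : α → ℕ × ℕ} (hc : PolyP c)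
    (hf : PolyPair f) (hg : PolyPair g) : PolyPair fun x => if c x then f x else g x :=
  ⟨(PolyT.ite hc hf.1 hg.1).congr fun _ => apply_ite Prod.fst _ _ _,
    (PolyT.ite hc hf.2 hg.2).congr fun _ => apply_ite Prod.snd _ _ _⟩

theorem PolyPair.emit {f : α → ℕ × ℕ} (hf : PolyPair f) : Emit fun x => [(f x).1, (f x).2] :=
  Emit.cons hf.1 (Emit.singleton hf.2)

end

/-! ### The words of the constructed instances in polynomial time -/

namespace PolySrc

variable {src : List ℕ → Src} (h : PolySrc src) (p : Params) {α : Type} [Ctx α] {f g : α → ℕ}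

theorem otherColor (hf : PolyT f) : PolyT fun x => Src.otherColor (f x) :=
  PolyT.ite (PolyP.eq hf (.const 0)) (.const 1) (.const 0)

theorem palEdge (hf : PolyT f) : PolyPair fun x => Src.palEdge p (f x) :=
  have h1 := hf.div (.const p.b)
  have h2 := hf.mod (.const p.b)
  PolyPair.ite (PolyP.eq h1 h2).not (.mk h1 h2) (.mk (.const 0) (.const 1))

include h

theorem allowed {c : α → ℕ} (hf : PolyT f) (hg : PolyT g) (hc : PolyT c) :
    PolyP fun x => (src (Ctx.word x)).Allowed p (f x) (g x) (c x) := by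
  have hm (i : ℕ) : PolyP fun x => g x % 4 = i := PolyP.eq (hg.mod (.const 4)) (.const i)
  have hl := litVal p hf (hg.div (.const 4))
  refine ((hm 0).and ((PolyP.lt hc (.const 2)).and (PolyP.and ?_ ?_))).or
    (((hm 1).and ((PolyP.eq hc hl).or (PolyP.eq hc (otherColor hl)))).or
    (((hm 2).and ((PolyP.eq hc (otherColor hl)).or (PolyP.eq hc (.const 2)))).or
      ((hm 3).and (PolyP.lt hc (.const 3)))))
  · exact ((PolyP.eq hg (.const 0)).not.or (PolyP.eq hc (.const 0))).congr fun _ => by tauto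
  · exact ((PolyP.eq hg (.const (12 * p.q))).not.or ((h.live p hf).not.or
      (PolyP.eq hc (.const 1)))).congr fun _ => by tauto

theorem listEdge (hf : PolyT f) (hg : PolyT g) :
    PolyPair fun x => (src (Ctx.word x)).listEdge p (f x) (g x) :=
  have h1 := hg.div (.const p.b)
  have h2 := hg.mod (.const p.b)
  PolyPair.ite (h.allowed p hf h1 h2) (.mk (.const 0) (.const 1)) (.mk h2 (h.aux p hf h1))

theorem stepEdge (hf : PolyT f) (hg : PolyT g) :
    PolyPair fun x => (src (Ctx.word x)).stepEdge p (f x) (g x) :=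
  have h1 := hg.div (.const 5)
  have hm (i : ℕ) : PolyP fun x => g x % 5 = i := PolyP.eq (hg.mod (.const 5)) (.const i)
  have ha (i : ℕ) : PolyT fun x => (src (Ctx.word x)).aux p (f x) (4 * (g x / 5) + i) := h.aux p hf (((PolyT.const 4).mul h1).add (.const i))
  PolyPair.ite (hm 0) (.mk (prim p (h.litVar p hf h1)) (ha 1))
    (PolyPair.ite (hm 1) (.mk (ha 1) (ha 2)) (PolyPair.ite (hm 2) (.mk (ha 2) (ha 3))
      (PolyPair.ite (hm 3) (.mk (ha 3) (h.aux p hf ((PolyT.const 4).mul h1))) (.mk (ha 3) (ha 4)))))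

theorem coloringWord : Emit fun x : α => (src (Ctx.word x)).coloringWord p := by
  have hpal : Emit fun x : α => (List.range (p.b * p.b)).flatMap fun f =>
      [(Src.palEdge p f).1, (Src.palEdge p f).2] :=
    Emit.flatMap (g := fun _ f => [(Src.palEdge p f).1, (Src.palEdge p f).2]) (.const _)
      (palEdge p .snd).emit
  have hlist : Emit fun x : α × ℕ => (List.range (Src.auxSize p * p.b)).flatMap fun f =>
      [((src (Ctx.word x)).listEdge p x.2 f).1, ((src (Ctx.word x)).listEdge p x.2 f).2] :=
    Emit.flatMap (g := fun (x : α × ℕ) f => [((src (Ctx.word x)).listEdge p x.2 f).1,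
      ((src (Ctx.word x)).listEdge p x.2 f).2]) (.const _) (h.listEdge p PolyT.snd.fst .snd).emit
  have hstep : Emit fun x : α × ℕ => (List.range (15 * p.q)).flatMap fun f =>
      [((src (Ctx.word x)).stepEdge p x.2 f).1, ((src (Ctx.word x)).stepEdge p x.2 f).2] :=
    Emit.flatMap (g := fun (x : α × ℕ) f => [((src (Ctx.word x)).stepEdge p x.2 f).1,
      ((src (Ctx.word x)).stepEdge p x.2 f).2]) (.const _) (h.stepEdge p PolyT.snd.fst .snd).emit
  have hE := Emit.flatMap (g := fun (x : α) e =>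
    ((List.range (Src.auxSize p * p.b)).flatMap fun f =>
      [((src (Ctx.word x)).listEdge p e f).1, ((src (Ctx.word x)).listEdge p e f).2]) ++
    (List.range (15 * p.q)).flatMap fun f =>
      [((src (Ctx.word x)).stepEdge p e f).1, ((src (Ctx.word x)).stepEdge p e f).2])
    (h.numE p) (hlist.append hstep)
  -- The length of the edge list has to be written first; it is `b * b` plus a constant number of
  -- edges for each constraint.
  refine (Emit.cons (h.numVert p) ((Emit.cons ((PolyT.const (p.b * p.b)).add
    ((h.numE p).mul (.const (Src.auxSize p * p.b + 15 * p.q)))) (hpal.append hE)).append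
      (h.bagWord p))).congr fun x => ?_
  simp only [Src.coloringWord, Src.edgeList, encodeList, List.length_append, List.length_map,
    List.length_range, List.flatMap_append, List.flatMap_map, List.flatMap_assoc,
    List.length_flatMap, List.map_const', List.sum_replicate, smul_eq_mul]

theorem threeSATWord : Emit fun x : α => (src (Ctx.word x)).threeSATWord p := by
  have hbool {c : α × ℕ → Prop} [DecidablePred c] (hc : PolyP c) :
      PolyT fun x => (decide (c x)).toNat :=
    (PolyT.ite hc (.const 1) (.const 0)).congr fun x => by by_cases hx : c x <;> simp [hx]
  have hbool' {c : (α × ℕ) × ℕ → Prop} [DecidablePred c] (hc : PolyP c) :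
      PolyT fun x => (decide (c x)).toNat :=
    (PolyT.ite hc (.const 1) (.const 0)).congr fun x => by by_cases hx : c x <;> simp [hx]
  have hhead : Emit fun x : α × ℕ => [1, (src (Ctx.word x)).aux p x.2 0, 0,
      1, (src (Ctx.word x)).aux p x.2 (12 * p.q),
        (decide ((src (Ctx.word x)).Live p x.2)).toNat] :=
    .cons (.const 1) (.cons (h.aux p .snd (.const 0)) (.cons (.const 0) (.cons (.const 1)
      (.cons (h.aux p .snd (.const _)) (.singleton (hbool (h.live p .snd)))))))
  have hs : PolyT fun x : (α × ℕ) × ℕ => x.1.2 := PolyT.snd.fst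
  have hr : PolyT fun x : (α × ℕ) × ℕ => 4 * x.2 := (PolyT.const 4).mul .snd
  have hstep : Emit fun x : α × ℕ => (List.range (3 * p.q)).flatMap fun r =>
      [3, (src (Ctx.word x)).aux p x.2 (4 * r), 1,
        Src.prim p ((src (Ctx.word x)).litVar p x.2 r),
        (decide (Src.litVal p x.2 r = 0)).toNat, (src (Ctx.word x)).aux p x.2 (4 * r + 4), 0] :=
    Emit.flatMap (g := fun (x : α × ℕ) r => [3, (src (Ctx.word x)).aux p x.2 (4 * r), 1,
        Src.prim p ((src (Ctx.word x)).litVar p x.2 r),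
        (decide (Src.litVal p x.2 r = 0)).toNat, (src (Ctx.word x)).aux p x.2 (4 * r + 4), 0])
      (.const _)
      (.cons (.const 3) (.cons (h.aux p hs hr) (.cons (.const 1)
        (.cons (prim p (h.litVar p hs .snd)) (.cons
          (hbool' (PolyP.eq (litVal p hs .snd) (.const 0)))
          (.cons (h.aux p hs (hr.add (.const 4))) (.singleton (.const 0))))))))
  have hE := Emit.flatMap (g := fun (x : α) e =>
    [1, (src (Ctx.word x)).aux p e 0, 0, 1, (src (Ctx.word x)).aux p e (12 * p.q),
        (decide ((src (Ctx.word x)).Live p e)).toNat] ++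
    (List.range (3 * p.q)).flatMap fun r =>
      [3, (src (Ctx.word x)).aux p e (4 * r), 1,
        Src.prim p ((src (Ctx.word x)).litVar p e r),
        (decide (Src.litVal p e r = 0)).toNat, (src (Ctx.word x)).aux p e (4 * r + 4), 0])
    (h.numE p) (hhead.append hstep)
  refine (Emit.cons (h.numVert p) ((Emit.cons ((h.numE p).mul (.const (2 + 3 * p.q))) hE).append
      (h.bagWord p))).congr fun x => ?_
  have hlen : (Src.clauseList (src (Ctx.word x)) p).length =
      (src (Ctx.word x)).numE p * (2 + 3 * p.q) := by
    simp [Src.clauseList, Src.headClauses, List.length_flatMap, List.map_const']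
    exact Or.inl (by ring)
  rw [Src.threeSATWord, encodeList, hlen]
  simp only [Src.clauseList, Src.headClauses, Src.stepClause, encodeList,
    List.flatMap_map, List.flatMap_assoc, List.flatMap_cons, List.flatMap_nil, List.length_cons,
    List.length_nil, Bool.toNat_true, Bool.toNat_false, List.cons_append, List.nil_append,
    List.append_nil, zero_add, Nat.reduceAdd]

end PolySrc

/-! ### The running time -/

/-- Write `β = b ^ θ` with `θ < 1`, and take `q` least with `a ^ t ≤ b ^ q`. Then `b ^ (q - 1) ≤ a ^
t`, so `β ^ q ≤ β * a ^ (t * θ)`. The factor `β` from rounding up is at most `a ^ (t * (1 - θ) / 2)`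
once `t` is large. This gives `β' = a ^ ((1 + θ) / 2) < a`. -/
theorem exists_params {a b : ℕ} (ha : 2 ≤ a) (hb : 2 ≤ b) {β : ℝ} (h1 : 1 ≤ β) (hβ : β < b) :
    ∃ (t q : ℕ) (β' : ℝ), (⟨a, b, t, q⟩ : Params).Valid ∧ 1 ≤ β' ∧ β' < a ∧ β ^ q ≤ β' ^ t := by
  have ha1 : (1 : ℝ) < a := by exact_mod_cast ha
  have hb1 : (1 : ℝ) < b := by exact_mod_cast hb
  have hlb : 0 < Real.log b := Real.log_pos hb1
  set θ : ℝ := Real.log β / Real.log b with hθ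
  have hθ0 : 0 ≤ θ := div_nonneg (Real.log_nonneg h1) hlb.le
  have hθ1 : θ < 1 := (div_lt_one hlb).2 (Real.log_lt_log (by linarith) hβ)
  have hβθ : (b : ℝ) ^ θ = β := by
    rw [Real.rpow_def_of_pos (by linarith), hθ, mul_div_cancel₀ _ hlb.ne',
      Real.exp_log (by linarith)]
  obtain ⟨t, ht⟩ := pow_unbounded_of_one_lt β
    (Real.one_lt_rpow ha1 (show 0 < (1 - θ) / 2 by linarith))
  have ht0 : 0 < t := Nat.pos_of_ne_zero fun h => by
    rw [h, pow_zero] at ht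
    linarith
  have hat : 1 < a ^ t := Nat.one_lt_pow ht0.ne' (by omega)
  have hq : 0 < Nat.clog b (a ^ t) := Nat.clog_pos hb hat
  refine ⟨t, Nat.clog b (a ^ t), (a : ℝ) ^ ((1 + θ) / 2),
    ⟨ha, hb, ht0, hq, Nat.le_pow_clog hb _⟩, Real.one_le_rpow ha1.le (by linarith), ?_, ?_⟩
  · calc (a : ℝ) ^ ((1 + θ) / 2) < (a : ℝ) ^ (1 : ℝ) :=
          Real.rpow_lt_rpow_of_exponent_lt ha1 (by linarith)
      _ = a := Real.rpow_one _
  · have hlt : (b : ℝ) ^ (Nat.clog b (a ^ t) - 1) ≤ (a : ℝ) ^ t := by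
      exact_mod_cast (Nat.pow_pred_clog_lt_self hb hat).le
    calc β ^ Nat.clog b (a ^ t) = β * β ^ (Nat.clog b (a ^ t) - 1) := by
          rw [← pow_succ', Nat.sub_add_cancel hq]
      _ = β * ((b : ℝ) ^ (Nat.clog b (a ^ t) - 1)) ^ θ := by
          rw [← Real.rpow_natCast_mul (by linarith), mul_comm _ θ,
            Real.rpow_mul_natCast (by linarith), hβθ]
      _ ≤ ((a : ℝ) ^ ((1 - θ) / 2)) ^ t * ((a : ℝ) ^ t) ^ θ := by gcongr
      _ = ((a : ℝ) ^ ((1 + θ) / 2)) ^ t := by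
          rw [← Real.rpow_natCast_mul (by linarith), mul_comm _ θ,
            Real.rpow_mul_natCast (by linarith), ← mul_pow, ← Real.rpow_add (by linarith)]
          congr 2
          ring

/-- A window has `S.maxCard / t + 2` blocks, each costing `β ^ q ≤ β' ^ t`. The rounding to whole
blocks, the extra block, the palette and the auxiliary vertices contribute only the constant factor
`K`. -/
theorem pow_width_le {p : Params} {β β' : ℝ} (h1 : 1 ≤ β) (h1' : 1 ≤ β')
    (h : β ^ p.q ≤ β' ^ p.t) :
    ∃ K : ℕ, ∀ (S : Src) (w w' : ℕ), S.maxCard ≤ w + 1 → w' ≤ S.bagLen p →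
      β ^ w' ≤ K * β' ^ w := by
  obtain ⟨K, hK⟩ := exists_nat_ge (β ^ (p.b + Src.auxSize p) * β' ^ (1 + 2 * p.t))
  refine ⟨K, fun S w w' hS hw => ?_⟩
  have e : p.t * (S.blocks p + 1) ≤ w + (1 + 2 * p.t) := by
    have := Nat.mul_div_le S.maxCard p.t
    rw [Src.blocks, Nat.mul_succ, Nat.mul_succ]
    omega
  calc β ^ w' ≤ β ^ S.bagLen p := pow_le_pow_right₀ h1 hw
    _ = β ^ (p.b + Src.auxSize p) * (β ^ p.q) ^ (S.blocks p + 1) := by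
        rw [← pow_mul, ← pow_add, Src.bagLen]
        congr 1
        ring
    _ ≤ β ^ (p.b + Src.auxSize p) * (β' ^ p.t) ^ (S.blocks p + 1) := by gcongr
    _ ≤ β ^ (p.b + Src.auxSize p) * β' ^ (w + (1 + 2 * p.t)) := by
        rw [← pow_mul]
        gcongr
    _ = β ^ (p.b + Src.auxSize p) * β' ^ (1 + 2 * p.t) * β' ^ w := by ring
    _ ≤ K * β' ^ w := by gcongr

theorem SolvableInTime.mono {ι : Type} {enc : ι → List ℕ} {yes : ι → Prop} {p : ι → ℕ} {β β' : ℝ}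
    (hβ : 0 ≤ β) (h : β ≤ β') (hs : SolvableInTime enc yes p β) : SolvableInTime enc yes p β' := by
  obtain ⟨P, C, c, hP⟩ := hs
  refine ⟨P, C, c, fun x => ?_⟩
  obtain ⟨s, t, h1, h2, h3⟩ := hP x
  exact ⟨s, t, h1, h2, h3.trans (by gcongr)⟩

/-- The base is first raised to `max β 1`, because an upper bound on the width bounds the power only
for a base of at least `1`. -/
theorem threeSAT_of_coloring {k : ℕ} (hk : 3 ≤ k) {β : ℝ} (h0 : 0 < β) (hβ : β < k)
    (h : ColoringSolvableInTime k β) : ∃ β' : ℝ, 1 ≤ β' ∧ β' < 2 ∧ ThreeSATSolvableInTime β' := by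
  have hk1 : (1 : ℝ) < k := by exact_mod_cast (show 1 < k by omega)
  obtain ⟨t, q, β', hp, h1', h2', hpow⟩ :=
    exists_params (a := 2) le_rfl (show 2 ≤ k by omega) (le_max_right β 1) (max_lt hβ hk1)
  obtain ⟨K, hK⟩ := pow_width_le (p := ⟨2, k, t, q⟩) (le_max_right β 1) h1' hpow
  refine ⟨β', h1', by exact_mod_cast h2', ?_⟩
  exact Emit.transfer (fun I : ThreeSATInstance => Src.toColoring (satSrc_valid I) hp)
    (fun w => (satSrc w).coloringWord ⟨2, k, t, q⟩) (polySrc_sat.coloringWord _)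
    (fun I => Src.encode_toColoring _ hp)
    (fun I => (Src.colorable_toColoring (satSrc_valid I) hp hk).trans (satSrc_sat I))
    (fun I => I.encode_bound) (h0.le.trans (le_max_left β 1)) h1' K
    (fun I => hK _ _ _ (Src.maxCard_le (satSrc_mem I)) (Src.width_finBags_bagList hp))
    (h.mono h0.le (le_max_left β 1))

theorem coloring_of_threeSAT {k : ℕ} (hk : 2 ≤ k) {β : ℝ} (h0 : 0 < β) (hβ : β < 2)
    (h : ThreeSATSolvableInTime β) : ∃ β' : ℝ, 1 ≤ β' ∧ β' < k ∧ ColoringSolvableInTime k β' := by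
  obtain ⟨t, q, β', hp, h1', h2', hpow⟩ :=
    exists_params (b := 2) hk le_rfl (le_max_right β 1)
      (max_lt (by exact_mod_cast hβ) (by norm_num))
  obtain ⟨K, hK⟩ := pow_width_le (p := ⟨k, 2, t, q⟩) (le_max_right β 1) h1' hpow
  refine ⟨β', h1', h2', ?_⟩
  exact Emit.transfer (fun I : ColoringInstance => Src.toThreeSAT (colorSrc_valid I k) hp)
    (fun w => (colorSrc k w).threeSATWord ⟨k, 2, t, q⟩) ((polySrc_color k).threeSATWord _)
    (fun I => Src.encode_toThreeSAT _ hp)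
    (fun I => (Src.satisfiable_toThreeSAT (colorSrc_valid I k) hp rfl).trans
      (colorSrc_sat I (Nat.zero_lt_of_lt hk)))
    (fun I => I.encode_bound) (h0.le.trans (le_max_left β 1)) h1' K
    (fun I => hK _ _ _ (Src.maxCard_le (colorSrc_mem I k)) (Src.width_finBags_bagList hp))
    (h.mono h0.le (le_max_left β 1))

end PathwidthSETH

/-! ### The equivalence -/

theorem mainTheorem8 (k : ℕ) (hk : 3 ≤ k) :
    (∃ ε : ℝ, 0 < ε ∧ ε < k ∧ PathwidthSETH.ColoringSolvableInTime k (k - ε)) ↔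
      ¬ PathwidthSETH.PPSETH := by
  constructor
  · rintro ⟨ε, h0, h1, h⟩ hP
    obtain ⟨β, h2, h3, h4⟩ := PathwidthSETH.threeSAT_of_coloring hk (sub_pos.2 h1) (by linarith) h
    refine hP (2 - β) (by linarith) (by linarith) ?_
    rwa [sub_sub_cancel]
  · intro hP
    unfold PathwidthSETH.PPSETH at hP
    push Not at hP
    obtain ⟨ε, h0, h1, h⟩ := hP
    obtain ⟨β, h2, h3, h4⟩ := PathwidthSETH.coloring_of_threeSAT (k := k) (by omega)
      (sub_pos.2 h1) (by linarith) h
    exact ⟨k - β, by linarith, by linarith, by rwa [sub_sub_cancel]⟩
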